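/- Let $u\ge 1$, let $\mathcal P$ be the set of partitions, and let $\mathbb{Z}^u_+=\{\lambda\in\mathbb{Z}^u : \lambda_1\ge\cdots\ge\lambda_u\}$. For $\lambda\in\mathbb{Z}^u_+$ put $\lambda^*=(-\lambda_u,\dots,-\lambda_1)$; a partition of length at most $u$ is regarded as an element of $\mathbb{Z}^u_+$. **Tableaux.** Let $\mathbf B=\{\cdots<\overline 2<\overline 1<1<2<\cdots\}$, with $|\overline k|=0$ and $|k|=1$ for $k\ge1$; let $\mathbf B^+$ (resp. $\mathbf B^-$) be the set of letters of degree $0$ (resp. $1$). A semi-infinite word of charge $c\in\mathbb Z$ is a sequence $w=\cdots w_3w_2w_1$ in $\mathbf B$ with $w_{i+1}\le w_i$ for all $i\geq 1$, with $w_{i+1}=w_i$ only if $|w_i|=1$, and with $w_i=\overline{i+c}$ for all $i\gg1$. Its weight is $\mathrm{wt}(w)=\Lambda+\sum_{b}m_b\epsilon_b\in\mathbb{Z}\Lambda\oplus\bigoplus_{b\in\mathbf B}\mathbb{Z}\epsilon_b$, where $m_b=|\{k: w_k=b\}|-\delta_{|b|,0}$. For $\lambda\in\mathbb{Z}^u_+$,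 let $\mathbf B(\lambda)$ be the $\mathfrak g$-crystal of semi-infinite semistandard tableaux of charge $\lambda$, i.e. the set of $u$-tuples $\mathbf w=(w^{(1)},\dots,w^{(u)})$ of semi-infinite words such that $w^{(i)}$ has charge $\lambda_i$ for $1\le i\le u$ and, for $1\le i<u$, $k\ge1$ and $d_i=\lambda_i-\lambda_{i+1}$, one has $w^{(i)}_k\ge w^{(i+1)}_{k+d_i}$, with equality only if $|w^{(i)}_k|=0$. Let $\mathrm{wt}(\mathbf w)=\sum_i\mathrm{wt}(w^{(i)})$, let $x^{k\Lambda+\sum m_b\epsilon_b}=\prod_b x_b^{m_b}$, and let $\mathrm{ch}\,\mathbf B(\lambda)=\sum_{\mathbf w\in\mathbf B(\lambda)}x^{\mathrm{wt}(\mathbf w)}$. **Rational Schur functions.** Let $\mathbf B_u=\{\overline u<\cdots<\overline1\}$ and let $\mathbf B_u^\vee=\{-\overline1<\cdots<-\overline u\}$. For $\lambda\in\mathbb{Z}^u_+$ a rational semistandard tableau of shape $\lambda$ is a filling of the boxes $(i,j)$, $1\le i\le u$, with $1\le j\le\lambda_i$ or $\lambda_i\le j\le-1$, where columns $j>0$ (resp.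 $j<0$) have entries in $\mathbf B_u$ (resp. $\mathbf B_u^\vee$), rows increase weakly from left to right, columns increase strictly from top to bottom, and, if $b_1<\cdots<b_s$ are the entries of column $1$, $-b'_1<\cdots<-b'_t$ those of column $-1$ and $\{b''_1<\cdots<b''_{u-t}\}=\mathbf B_u\setminus\{b'_1,\dots,b'_t\}$, then $b''_i\le b_i$ for $1\le i\le s$. Let $s_\lambda(y)=\sum_T y^{\mathrm{wt}(T)}$, the sum over all such $T$, where an entry $b$ contributes $y_b$ and an entry $-b$ contributes $y_b^{-1}$ to $y^{\mathrm{wt}(T)}$. For $\mu,\nu\in\mathcal P$ define $N^{\kappa}_{\mu\nu}\in\mathbb{Z}_{\ge0}$ ($\kappa\in\mathbb{Z}^u_+$, almost all zero) by $$s_{\mu^*}(y)\,s_\nu(y)=\sum_{\kappa\in\mathbb{Z}^u_+}N^{\kappa}_{\mu\nu}\,s_\kappa(y),$$ where $s_{\mu^*}(y)$, resp. $s_\nu(y)$, is understood to be $0$ if $\mu$, resp. $\nu$, has more than $u$ parts. **Statement.** The coefficients $N^\kappa_{\mu\nu}\in\mathbb{Z}_{\ge 0}$ exist and are unique. For every $\lambda\in\mathbb{Z}^u_+$,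 each monomial occurs only finitely often in $\mathrm{ch}\,\mathbf B(\lambda)$, and $$\mathrm{ch}\,\mathbf B(\lambda)=\sum_{\mu,\nu\in\mathcal P}N^{\lambda^*}_{\mu\nu}\,s_{\mu'}(x_+^{-1})\,s_\nu(x_-)$$ as formal series (the sum on the right converges coefficientwise). Here $\mu'$ is the conjugate partition, $s_{\mu'}$ and $s_\nu$ on the right are ordinary Schur functions in infinitely many variables, $x_+^{-1}=\{x_b^{-1}: b\in\mathbf B^+\}$ and $x_-=\{x_b: b\in\mathbf B^-\}$. -/

import Mathlib

noncomputable section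

namespace SemiInf

/-! ### The alphabet and semi-infinite words -/

/-- The linearly ordered alphabet `⋯ < 2̄ < 1̄ < 1 < 2 < ⋯`, realised as the non-zero integers:
the letter `k̄` (`k ≥ 1`) is `-k`, the letter `k` (`k ≥ 1`) is `k`. -/
abbrev Letter : Type := {b : ℤ // b ≠ 0}

/-- The degree `|b|`: `0` for the barred letters, `1` for the unbarred ones. -/
def deg (b : Letter) : ℕ := if (b : ℤ) < 0 then 0 else 1

/-- The barred letter with bar over `k + 1`. -/
def barLetter (k : ℕ) : Letter := ⟨-((k : ℤ) + 1), by omega⟩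

/-- The unbarred letter `k + 1`. -/
def posLetter (k : ℕ) : Letter := ⟨(k : ℤ) + 1, by omega⟩

/-- The word `⋯ w₃ w₂ w₁`, stored as the sequence `k ↦ w_{k+1}`, has charge `c`:
`w_i` is the barred letter `i + c` for all `i ≫ 1`. -/
def HasCharge (w : ℕ → Letter) (c : ℤ) : Prop :=
  ∀ᶠ k : ℕ in Filter.atTop, (w k : ℤ) = -(((k : ℤ) + 1) + c)

/-- Semi-infinite words `⋯ w₃ w₂ w₁`; `letter k` is `w_{k+1}`. -/
@[ext] structure Word where
  letter : ℕ → Letter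
  weak : ∀ k, letter (k + 1) ≤ letter k
  strict : ∀ k, letter (k + 1) = letter k → deg (letter k) = 1
  charged : ∃ c : ℤ, HasCharge letter c

/-- `m_b = |{k | w_k = b}| - δ_{|b|,0}`. -/
def Word.mult (w : Word) (b : Letter) : ℤ :=
  ({k : ℕ | w.letter k = b}.ncard : ℤ) - if deg b = 0 then 1 else 0

theorem Word.antitone (w : Word) : Antitone w.letter := antitone_nat_of_succ_le w.weak

theorem Word.finite_mult_support (w : Word) : (Function.support w.mult).Finite := by
  obtain ⟨c, hc⟩ := w.charged
  obtain ⟨K₀, hK₀⟩ := Filter.eventually_atTop.1 hc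
  obtain ⟨K, hKK, hK⟩ : ∃ K : ℕ, K₀ ≤ K ∧ -((K : ℤ) + 1 + c) < 0 :=
    ⟨max K₀ (c.natAbs), le_max_left _ _, by have := le_max_right K₀ c.natAbs; omega⟩
  have hw : ∀ k, K ≤ k → (w.letter k : ℤ) = -((k : ℤ) + 1 + c) :=
    fun k hk => hK₀ k (hKK.trans hk)
  have hfin : {b : Letter | (b : ℤ) ∈ Set.Icc (-((K : ℤ) + 1 + c)) (max (w.letter 0 : ℤ) 0)}.Finite :=
    (Set.finite_Icc _ _).preimage Subtype.val_injective.injOn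
  refine hfin.subset fun b hb => ?_
  by_contra hcon
  apply hb
  rw [Set.mem_ofPred_eq, Set.mem_Icc, not_and_or, not_le, not_le] at hcon
  have h0 := b.2
  rcases hcon with h | h
  · obtain ⟨j, hj⟩ : ∃ j : ℕ, (b : ℤ) = -((j : ℤ) + 1 + c) := ⟨(-(b : ℤ) - 1 - c).toNat, by omega⟩
    have hset : {k : ℕ | w.letter k = b} = {j} := by
      ext k
      simp only [Set.mem_ofPred_eq, Set.mem_singleton_iff, Subtype.ext_iff]
      constructor
      · intro hk
        by_cases hkK : K ≤ k
        · have := hw k hkK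
          omega
        · have h1 : (w.letter K : ℤ) ≤ w.letter k := w.antitone (by omega)
          have := hw K le_rfl
          omega
      · rintro rfl
        rw [hw k (by omega), hj]
    have hd : deg b = 0 := if_pos (by omega)
    simp [Word.mult, hset, hd]
  · have hset : {k : ℕ | w.letter k = b} = ∅ := by
      ext k
      simp only [Set.mem_ofPred_eq, Set.mem_empty_iff_false, iff_false, Subtype.ext_iff]
      intro hk
      have h1 : (w.letter k : ℤ) ≤ w.letter 0 := w.antitone (Nat.zero_le k)
      omega
    have hd : deg b = 1 := if_neg (by omega)
    simp [Word.mult, hset, hd]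

/-- The weight lattice `P = ℤΛ ⊕ ⨁_b ℤ ε_b`. -/
abbrev WeightLattice : Type := ℤ × (Letter →₀ ℤ)

/-- `wt(w) = Λ + ∑_b m_b ε_b`. -/
def Word.wt (w : Word) : WeightLattice :=
  (1, Finsupp.ofSupportFinite w.mult w.finite_mult_support)

/-! ### Generalized partitions and semi-infinite semistandard tableaux -/

/-- `ℤ^u_+`: weakly decreasing `u`-tuples of integers. -/
abbrev GenPartition (u : ℕ) : Type := {lam : Fin u → ℤ // Antitone lam}

/-- `λ* = (-λ_u, …, -λ_1)`. -/
def GenPartition.star {u : ℕ} (lam : GenPartition u) : GenPartition u :=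
  ⟨fun i => -(lam.1 i.rev), fun _ _ h => neg_le_neg (lam.2 (Fin.rev_le_rev.2 h))⟩

/-- The first `u` parts of a partition; this is the partition itself if its length is at
most `u`. -/
def GenPartition.ofPartition (u : ℕ) (μ : YoungDiagram) : GenPartition u :=
  ⟨fun i => (μ.rowLen i : ℤ), fun _ _ h => Int.ofNat_le.2 (μ.rowLen_anti _ _ h)⟩

/-- The set `B(λ)` of semi-infinite semistandard tableaux of charge `λ`. -/
def tableaux {u : ℕ} (lam : GenPartition u) : Set (Fin u → Word) :=
  {w | (∀ i, HasCharge (w i).letter (lam.1 i)) ∧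
    ∀ i j : Fin u, (i : ℕ) + 1 = (j : ℕ) → ∀ k : ℕ,
      (w j).letter (k + (lam.1 i - lam.1 j).toNat) ≤ (w i).letter k ∧
      ((w i).letter k = (w j).letter (k + (lam.1 i - lam.1 j).toNat) →
        deg ((w i).letter k) = 0)}

/-- The weight of a tuple of words, viewed in the `u`-fold tensor power. -/
def wt {u : ℕ} (w : Fin u → Word) : WeightLattice := ∑ i, (w i).wt

/-! ### Formal series in the variables `x_b` -/

/-- Formal, possibly infinite, integral linear combinations of the Laurent monomials
`x^γ = ∏_b x_b ^ γ_b`; the value at `γ` is the coefficient of `x^γ`. -/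
abbrev FormalSeries : Type := (Letter →₀ ℤ) → ℤ

/-- The tableaux in `B(λ)` whose weight `kΛ + ∑_b γ_b ε_b` has the given `ε`-part, that is,
those with `x^{wt(w)} = x^γ`. -/
def weightSpace {u : ℕ} (lam : GenPartition u) (γ : Letter →₀ ℤ) : Set (Fin u → Word) :=
  {w ∈ tableaux lam | (wt w).2 = γ}

/-- `ch B(λ) = ∑_{w ∈ B(λ)} x^{wt(w)}`. -/
def ch {u : ℕ} (lam : GenPartition u) : FormalSeries :=
  fun γ => ((weightSpace lam γ).ncard : ℤ)

/-- Power series in the variables `z_b`, read as formal series in the `x_b` by putting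
`z_b = x_b⁻¹` for `|b| = 0` and `z_b = x_b` for `|b| = 1`. -/
def toFormalSeries (F : MvPowerSeries Letter ℤ) : FormalSeries :=
  open Classical in
  fun γ =>
    if ∀ b, (deg b = 0 → γ b ≤ 0) ∧ (deg b = 1 → 0 ≤ γ b) then
      MvPowerSeries.coeff (γ.mapRange Int.natAbs Int.natAbs_zero) F
    else 0

/-- The Schur function `s_μ(z_{v 0}, z_{v 1}, …)`, the generating function of the semistandard
tableaux of shape `μ`, for an enumerated alphabet `v`. -/
def schur {σ : Type} (v : ℕ → σ) (μ : YoungDiagram) : MvPowerSeries σ ℤ :=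
  fun n => (Nat.card {T : SemistandardYoungTableau μ //
    ∑ c ∈ μ.cells, Finsupp.single (v (T c.1 c.2)) 1 = n} : ℤ)

/-- `s_{μ'}(x_+⁻¹) s_ν(x_-)`, where `μ'` is the conjugate of `μ`. -/
def schurProduct (μ ν : YoungDiagram) : FormalSeries :=
  toFormalSeries (schur barLetter μ.transpose * schur posLetter ν)

/-! ### Rational semistandard tableaux and rational Schur functions -/

/-- The boxes of the generalized Young diagram of `λ`: in row `i`, the columns `1, …, λ_i` if
`λ_i ≥ 0` and the columns `λ_i, …, -1` if `λ_i ≤ 0`. -/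
abbrev Box {u : ℕ} (lam : GenPartition u) : Type :=
  Σ i : Fin u, {j : ℤ // j ∈ Finset.Icc 1 (lam.1 i) ∪ Finset.Icc (lam.1 i) (-1)}

/-- The row of a box (from top to bottom, starting with `0`). -/
def Box.row {u : ℕ} {lam : GenPartition u} (p : Box lam) : Fin u := p.1

/-- The column of a box, a non-zero integer. -/
def Box.col {u : ℕ} {lam : GenPartition u} (p : Box lam) : ℤ := p.2.1

/-- The letters `b` whose duals `-b` occur in the column `-1`. -/
def entriesOfColNegOne {u : ℕ} {lam : GenPartition u} (T : Box lam → Fin u) : Finset (Fin u) :=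
  (Finset.univ.filter fun p : Box lam => p.col = -1).image T

/-- Rational semistandard fillings. The alphabet `ū < ⋯ < 1̄` is identified with `Fin u` as an
ordered set. The filling `T` has the entry `T p` in a box `p` of a positive column, and the dual
letter `-(T p)` in a box `p` of a negative column; dual letters are ordered by
`-b < -c` if and only if `c < b`. -/
structure IsRationalSemistandard {u : ℕ} {lam : GenPartition u} (T : Box lam → Fin u) : Prop where
  row_pos : ∀ p q : Box lam, p.row = q.row → 0 < p.col → p.col < q.col → T p ≤ T q
  row_neg : ∀ p q : Box lam, p.row = q.row → q.col < 0 → p.col < q.col → T q ≤ T p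
  col_pos : ∀ p q : Box lam, p.col = q.col → 0 < p.col → p.row < q.row → T p < T q
  col_neg : ∀ p q : Box lam, p.col = q.col → p.col < 0 → p.row < q.row → T q < T p
  /-- The `i`-th smallest letter whose dual is not in the column `-1` is at most the `i`-th entry
  of the column `1`. -/
  compat : ∀ p : Box lam, p.col = 1 →
    ∃ h : (p.row : ℕ) < (entriesOfColNegOne T)ᶜ.card,
      (entriesOfColNegOne T)ᶜ.orderEmbOfFin rfl ⟨p.row, h⟩ ≤ T p

/-- The set `B_u(λ)` of rational semistandard tableaux of shape `λ`. -/
abbrev RationalTableau {u : ℕ} (lam : GenPartition u) : Type :=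
  {T : Box lam → Fin u // IsRationalSemistandard T}

/-- The weight of a filling: an entry `b` contributes `ε_b`, an entry `-b` contributes `-ε_b`. -/
def rationalWt {u : ℕ} {lam : GenPartition u} (T : Box lam → Fin u) : Fin u →₀ ℤ :=
  ∑ p : Box lam, Finsupp.single (T p) (if 0 < p.col then 1 else -1)

/-- The Laurent polynomial ring in the variables `y_b`. -/
abbrev Laurent (u : ℕ) : Type := AddMonoidAlgebra ℤ (Fin u →₀ ℤ)

/-- The rational Schur function `s_λ(y) = ∑_{T ∈ B_u(λ)} y^{wt T}`. -/
def rationalSchur {u : ℕ} (lam : GenPartition u) : Laurent u :=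
  open Classical in
  ∑ T : RationalTableau lam, AddMonoidAlgebra.single (rationalWt T.1) 1

/-- `s_ν(y)` for a partition `ν`; it is zero if `ν` has more than `u` parts. -/
def schurY (u : ℕ) (ν : YoungDiagram) : Laurent u :=
  if ν.colLen 0 ≤ u then rationalSchur (GenPartition.ofPartition u ν) else 0

/-- `s_{μ*}(y) = s_μ(y⁻¹)` for a partition `μ`; it is zero if `μ` has more than `u` parts. -/
def schurYStar (u : ℕ) (μ : YoungDiagram) : Laurent u :=
  if μ.colLen 0 ≤ u then rationalSchur (GenPartition.ofPartition u μ).star else 0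

/-- `N μ ν κ` is the coefficient `N^κ_{μν}` in
`s_{μ*}(y) s_ν(y) = ∑_{κ ∈ ℤ^u_+} N^κ_{μν} s_κ(y)`, for all partitions `μ`, `ν`. -/
def IsLRCoefficients (u : ℕ) (N : YoungDiagram → YoungDiagram → GenPartition u →₀ ℕ) : Prop :=
  ∀ μ ν : YoungDiagram,
    schurYStar u μ * schurY u ν = (N μ ν).sum fun κ n => n • rationalSchur κ

end SemiInf

end

/-!
A rational tableau of shape `κ` is the same as a Gelfand–Tsetlin pattern with top row `κ`, its rows
being the shapes of the subtableaux below each cut. Multiplying by an alternant gives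
`a_{τ + ρ} s_κ = ∑_T a_{τ + wt(T) + ρ}`, the sum over these patterns, and a sign-reversing
involution of Bender–Knuth type, applied to the part of `T` below a cut, cancels all terms except
those that stay dominant at every cut: this is a Littlewood–Richardson rule. For `τ = 0` only the
pattern of highest weight survives, so `a_ρ s_κ = a_{κ + ρ}`, and the `s_κ` are linearly independent
and multiply with nonnegative coefficients.

Multiplication by `h_r(y)` or by `e_r(y⁻¹)` adds a horizontal strip or removes a vertical strip
(Pieri's rule). The words of a semi-infinite tableau, read one letter at a time, trace out a chain
of such steps from `0` to `λ*`: vertical strips for the letters `k̄`, horizontal ones for the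
letters `k`. Hence `ch B(λ)` has as its coefficients those of `s_{λ*}` in products of the form
`∏ e_r(y⁻¹) · ∏ h_r(y)`. Expanding the two factors separately, `∏ e_r(y⁻¹)` into the `s_{μ*}` with
coefficients counting tableaux of shape `μ'` and `∏ h_r(y)` into the `s_ν` with coefficients
counting tableaux of shape `ν`, gives the formula.
-/

noncomputable section

namespace SemiInf

open Equiv Equiv.Perm Finset

/-! ### Alternants -/

theorem eq_zero_of_eq_neg_self {M : Type*} {P : AddMonoidAlgebra ℤ M} (hP : P = -P) : P = 0 := by
  ext m
  have hm := congrArg (fun Q : AddMonoidAlgebra ℤ M => Q.coeff m) hP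
  rw [AddMonoidAlgebra.coeff_neg, Finsupp.neg_apply] at hm
  rw [self_eq_neg.1 hm, AddMonoidAlgebra.coeff_zero, Finsupp.zero_apply]

theorem perm_eq_one_of_strictAnti {ι : Type*} [LinearOrder ι] [Finite ι] {α : ι → ℤ}
    {σ : Perm ι} (hα : StrictAnti α) (hσ : StrictAnti (α ∘ σ)) : σ = 1 := by
  have hmono : StrictMono σ := fun i j hij => hα.lt_iff_gt.1 (hσ hij)
  have hrefl := Subsingleton.elim (hmono.orderIsoOfSurjective σ σ.surjective) (OrderIso.refl ι)
  exact Equiv.ext fun i => congrArg (fun e : ι ≃o ι => e i) hrefl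

section Alternant

variable {ι : Type*} [Fintype ι]

/-- The Laurent monomial `y^α = ∏ i, y_i ^ α i`. -/
def monomial (α : ι → ℤ) : AddMonoidAlgebra ℤ (ι →₀ ℤ) :=
  AddMonoidAlgebra.single (Finsupp.equivFunOnFinite.symm α) 1

theorem monomial_mul_monomial (α β : ι → ℤ) : monomial α * monomial β = monomial (α + β) := by
  rw [monomial, monomial, monomial, AddMonoidAlgebra.single_mul_single, mul_one]
  congr 1
  ext
  rfl

theorem coeff_monomial (α β : ι → ℤ) :
    (monomial α).coeff (Finsupp.equivFunOnFinite.symm β) = if α = β then 1 else 0 := by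
  classical
  rw [monomial, AddMonoidAlgebra.coeff_single, Finsupp.single_apply]
  simp only [EmbeddingLike.apply_eq_iff_eq]

/-- The alternant `a_α(y) = ∑ σ, sgn(σ) y^(α ∘ σ)`, that is, `det (y_i ^ α_j)`. -/
def alternant [DecidableEq ι] (α : ι → ℤ) : AddMonoidAlgebra ℤ (ι →₀ ℤ) :=
  ∑ σ : Perm ι, (sign σ : ℤ) • monomial (α ∘ σ)

section DecidableEq

variable [DecidableEq ι]

theorem alternant_comp_perm (α : ι → ℤ) (τ : Perm ι) :
    alternant (α ∘ τ) = (sign τ : ℤ) • alternant α := by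
  rw [alternant, alternant, smul_sum]
  refine Fintype.sum_equiv (Equiv.mulLeft τ) _ _ fun σ => ?_
  rw [Equiv.coe_mulLeft, smul_smul, Perm.sign_mul, Units.val_mul, ← mul_assoc, ← Units.val_mul,
    Int.units_mul_self, Units.val_one, one_mul]
  rfl

theorem alternant_comp_swap (α : ι → ℤ) {i j : ι} (hij : i ≠ j) :
    alternant (α ∘ swap i j) = -alternant α := by
  rw [alternant_comp_perm, sign_swap hij, Units.val_neg, Units.val_one, neg_one_smul]

theorem alternant_eq_zero {α : ι → ℤ} {i j : ι} (hij : i ≠ j) (hα : α i = α j) :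
    alternant α = 0 := by
  have hcomp : α ∘ swap i j = α := by
    rw [comp_swap_eq_update, hα, Function.update_eq_self, ← hα, Function.update_eq_self]
  exact eq_zero_of_eq_neg_self (by rw [← alternant_comp_swap α hij, hcomp])

theorem alternant_mul_sum_monomial {J : Type*} (S : Finset J) (f : J → ι → ℤ)
    (hf : ∀ σ : Perm ι, ∑ j ∈ S, monomial (f j ∘ σ) = ∑ j ∈ S, monomial (f j)) (α : ι → ℤ) :
    alternant α * ∑ j ∈ S, monomial (f j) = ∑ j ∈ S, alternant (α + f j) := by
  simp only [alternant]
  rw [sum_mul, sum_comm]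
  refine sum_congr rfl fun σ _ => ?_
  rw [← hf σ, smul_mul_assoc, mul_sum, ← smul_sum]
  simp only [monomial_mul_monomial]
  rfl

end DecidableEq

theorem coeff_alternant [LinearOrder ι] {α β : ι → ℤ} (hα : StrictAnti α) (hβ : StrictAnti β) :
    (alternant α).coeff (Finsupp.equivFunOnFinite.symm β) = if α = β then 1 else 0 := by
  rw [alternant, AddMonoidAlgebra.coeff_sum, Finsupp.finsetSum_apply,
    sum_eq_single (1 : Perm ι)]
  · rw [AddMonoidAlgebra.coeff_smul_apply, coeff_monomial, Perm.sign_one, Units.val_one, one_smul,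
      Perm.coe_one, Function.comp_id]
  · intro σ _ hσ
    rw [AddMonoidAlgebra.coeff_smul_apply, coeff_monomial, if_neg, smul_zero]
    rintro rfl
    exact hσ (perm_eq_one_of_strictAnti hα hβ)
  · exact fun h => absurd (mem_univ _) h

end Alternant

/-- The staircase vector `ρ = (0, -1, …, -(u-1))`. -/
def staircase (u : ℕ) : Fin u → ℤ := fun i => -(i : ℤ)

theorem staircase_strictAnti (u : ℕ) : StrictAnti (staircase u) := fun _ _ hij =>
  neg_lt_neg (Int.ofNat_lt.2 hij)

theorem strictAnti_add_staircase {u : ℕ} {κ : Fin u → ℤ} (hκ : Antitone κ) :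
    StrictAnti (κ + staircase u) :=
  hκ.add_strictAnti (staircase_strictAnti u)

theorem alternant_staircase_ne_zero (u : ℕ) : alternant (staircase u) ≠ 0 := fun h => by
  have hcoeff := coeff_alternant (staircase_strictAnti u) (staircase_strictAnti u)
  rw [h, if_pos rfl] at hcoeff
  exact zero_ne_one hcoeff

/-- The coefficient of `y^(κ+ρ)` in `a_ρ P`, that is, the coefficient of `s_κ` in `P` if `P` is
symmetric. -/
def schurCoeff {u : ℕ} (κ : GenPartition u) : Laurent u →+ ℤ where
  toFun P := (alternant (staircase u) * P).coeff (Finsupp.equivFunOnFinite.symm (κ.1 + staircase u))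
  map_zero' := by rw [mul_zero, AddMonoidAlgebra.coeff_zero, Finsupp.zero_apply]
  map_add' P Q := by rw [mul_add, AddMonoidAlgebra.coeff_add, Finsupp.add_apply]

theorem schurCoeff_of_alternant_mul_eq_sum {u : ℕ} {J : Type*} (S : Finset J) (f : J → Fin u → ℤ)
    (hf : ∀ j ∈ S, Antitone (f j)) {P : Laurent u}
    (hP : alternant (staircase u) * P = ∑ j ∈ S, alternant (f j + staircase u))
    (κ : GenPartition u) : schurCoeff κ P = #{j ∈ S | f j = κ.1} := by
  rw [← sum_boole, schurCoeff, AddMonoidHom.coe_mk, ZeroHom.coe_mk, hP,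
    AddMonoidAlgebra.coeff_sum, Finsupp.finsetSum_apply]
  refine sum_congr rfl fun j hj => ?_
  rw [coeff_alternant (strictAnti_add_staircase (hf j hj)) (strictAnti_add_staircase κ.2)]
  simp only [add_left_inj]

/-! ### Gelfand–Tsetlin patterns and Bender–Knuth involutions -/

/-- Gelfand–Tsetlin patterns with top row `κ`: the row `k ≤ u` has the entries `g k i`, `i < k`,
and interlaces with the row `k + 1`; all the other values of `g` are zero. -/
structure IsGelfandTsetlin {u : ℕ} (κ : Fin u → ℤ) (g : ℕ → ℕ → ℤ) : Prop where
  top : ∀ i : Fin u, g u i = κ i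
  upper : ∀ k i, i < k → k < u → g k i ≤ g (k + 1) i
  lower : ∀ k i, i < k → k < u → g (k + 1) (i + 1) ≤ g k i
  outside : ∀ k i, u < k ∨ k ≤ i → g k i = 0

/-- The type of Gelfand–Tsetlin patterns with top row `κ`. -/
abbrev GelfandTsetlinPattern {u : ℕ} (κ : Fin u → ℤ) : Type :=
  {g : ℕ → ℕ → ℤ // IsGelfandTsetlin κ g}

/-- The sum of the entries of row `k` of a pattern. -/
def rowSum (g : ℕ → ℕ → ℤ) (k : ℕ) : ℤ := ∑ i ∈ range k, g k i

/-- The sum of the entries of row `k` of a pattern, truncated from above at `c`. -/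
def minRowSum (g : ℕ → ℕ → ℤ) (c : ℤ) (k : ℕ) : ℤ := ∑ i ∈ range k, min (g k i) c

/-- The weight of a pattern: the differences of successive row sums. -/
def patternWt (u : ℕ) (g : ℕ → ℕ → ℤ) : Fin u → ℤ := fun a => rowSum g (a + 1) - rowSum g a

/-- The lower end of the interval in which the entry `i` of row `k + 1` of the pattern
`min (g · ·) c` moves while the rows `k` and `k + 2` are fixed. -/
def slotMin (g : ℕ → ℕ → ℤ) (c : ℤ) (k i : ℕ) : ℤ :=
  if i < k then max (min (g (k + 2) (i + 1)) c) (min (g k i) c) else min (g (k + 2) (i + 1)) c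

/-- The upper end of the interval in which the entry `i` of row `k + 1` of the pattern
`min (g · ·) c` moves while the rows `k` and `k + 2` are fixed. -/
def slotMax (g : ℕ → ℕ → ℤ) (c : ℤ) (k i : ℕ) : ℤ :=
  if 0 < i then min (min (g (k + 2) i) c) (min (g k (i - 1)) c) else min (g (k + 2) i) c

/-- The Bender–Knuth involution on row `k + 1`, restricted to the entries that are at most `c`:
such an entry is reflected in the interval `[slotMin g c k i, slotMax g c k i]`. -/
def benderKnuth (c : ℤ) (k : ℕ) (g : ℕ → ℕ → ℤ) : ℕ → ℕ → ℤ := fun r i =>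
  if r = k + 1 ∧ i < k + 1 ∧ g r i ≤ c then slotMin g c k i + slotMax g c k i - g r i else g r i

/-- The condition under which the entries of row `k + 1` above the cut `c` do not interact with
those below it: whenever an entry of row `k + 1` is above `c`, so is the entry of row `k` at the
same place. -/
def IsCuttable (c : ℤ) (k : ℕ) (g : ℕ → ℕ → ℤ) : Prop :=
  ∀ i < k + 1, c < g (k + 1) i → i < k ∧ c < g k i

theorem sum_slotMin_add_slotMax (g : ℕ → ℕ → ℤ) (c : ℤ) (k : ℕ) :
    ∑ i ∈ range (k + 1), (slotMin g c k i + slotMax g c k i) =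
      minRowSum g c (k + 2) + minRowSum g c k := by
  have hmin : ∑ i ∈ range (k + 1), slotMin g c k i =
      ∑ i ∈ range k, max (min (g (k + 2) (i + 1)) c) (min (g k i) c) +
        min (g (k + 2) (k + 1)) c := by
    rw [sum_range_succ]
    exact congrArg₂ _ (sum_congr rfl fun i hi => if_pos (mem_range.1 hi)) (if_neg (lt_irrefl k))
  have hmax : ∑ i ∈ range (k + 1), slotMax g c k i =
      ∑ i ∈ range k, min (min (g (k + 2) (i + 1)) c) (min (g k i) c) + min (g (k + 2) 0) c := by
    rw [sum_range_succ']
    rfl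
  have hmaxmin : ∑ i ∈ range k, max (min (g (k + 2) (i + 1)) c) (min (g k i) c) +
      ∑ i ∈ range k, min (min (g (k + 2) (i + 1)) c) (min (g k i) c) =
      ∑ i ∈ range k, min (g (k + 2) (i + 1)) c + ∑ i ∈ range k, min (g k i) c := by
    rw [← sum_add_distrib, ← sum_add_distrib]
    exact sum_congr rfl fun i _ => max_add_min _ _
  rw [sum_add_distrib, hmin, hmax, minRowSum, minRowSum, sum_range_succ, sum_range_succ']
  linarith

theorem slotMax_le (g : ℕ → ℕ → ℤ) (c : ℤ) (k i : ℕ) : slotMax g c k i ≤ c := by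
  rw [slotMax]
  split_ifs <;> omega

section BenderKnuth

variable {u : ℕ} {κ : Fin u → ℤ} {g : ℕ → ℕ → ℤ} {c : ℤ} {k i : ℕ}

theorem IsGelfandTsetlin.slotMin_le (hg : IsGelfandTsetlin κ g) (hk : k + 1 < u) (hi : i < k + 1) :
    slotMin g c k i ≤ min (g (k + 1) i) c := by
  have hlower : g (k + 2) (i + 1) ≤ g (k + 1) i := hg.lower _ _ hi hk
  rw [slotMin]
  split_ifs with hik
  · have hupper := hg.upper k i hik (by omega)
    omega
  · omega

theorem IsGelfandTsetlin.le_slotMax (hg : IsGelfandTsetlin κ g) (hk : k + 1 < u) (hi : i < k + 1) :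
    min (g (k + 1) i) c ≤ slotMax g c k i := by
  have hupper : g (k + 1) i ≤ g (k + 2) i := hg.upper _ _ hi hk
  rw [slotMax]
  split_ifs with hi0
  · have hlower := hg.lower k (i - 1) (by omega) (by omega)
    rw [Nat.sub_add_cancel hi0] at hlower
    omega
  · omega

theorem IsGelfandTsetlin.slotMin_eq (hg : IsGelfandTsetlin κ g) (hk : k + 1 < u)
    (hcut : IsCuttable c k g) (hi : i < k + 1) (hc : c < g (k + 1) i) : slotMin g c k i = c := by
  obtain ⟨hik, hck⟩ := hcut i hi hc
  have hle := hg.slotMin_le (c := c) hk hi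
  rw [slotMin, if_pos hik] at hle ⊢
  omega

theorem IsGelfandTsetlin.slotMax_eq (hg : IsGelfandTsetlin κ g) (hk : k + 1 < u) (hi : i < k + 1)
    (hc : c < g (k + 1) i) : slotMax g c k i = c :=
  (slotMax_le g c k i).antisymm ((min_eq_right hc.le).symm.trans_le (hg.le_slotMax hk hi))

theorem benderKnuth_of_ne {r : ℕ} (g : ℕ → ℕ → ℤ) (hr : r ≠ k + 1) (i : ℕ) :
    benderKnuth c k g r i = g r i :=
  if_neg fun h => hr h.1

theorem benderKnuth_of_lt {r : ℕ} (hc : c < g r i) : benderKnuth c k g r i = g r i :=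
  if_neg fun h => hc.not_ge h.2.2

theorem benderKnuth_of_le (hi : i < k + 1) (hc : g (k + 1) i ≤ c) :
    benderKnuth c k g (k + 1) i = slotMin g c k i + slotMax g c k i - g (k + 1) i :=
  if_pos ⟨rfl, hi, hc⟩

theorem slotMin_benderKnuth : slotMin (benderKnuth c k g) c k i = slotMin g c k i := by
  simp only [slotMin]
  rw [benderKnuth_of_ne g (by omega), benderKnuth_of_ne g (by omega)]

theorem slotMax_benderKnuth : slotMax (benderKnuth c k g) c k i = slotMax g c k i := by
  simp only [slotMax]
  rw [benderKnuth_of_ne g (by omega), benderKnuth_of_ne g (by omega)]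

theorem IsGelfandTsetlin.benderKnuth_mem_Icc (hg : IsGelfandTsetlin κ g) (hk : k + 1 < u)
    (hi : i < k + 1) (hc : g (k + 1) i ≤ c) :
    benderKnuth c k g (k + 1) i ∈ Set.Icc (slotMin g c k i) (slotMax g c k i) := by
  have hmin := hg.slotMin_le (c := c) hk hi
  have hmax := hg.le_slotMax (c := c) hk hi
  rw [benderKnuth_of_le hi hc, Set.mem_Icc]
  omega

theorem IsGelfandTsetlin.benderKnuth_mem_Icc_row_succ (hg : IsGelfandTsetlin κ g) (hk : k + 1 < u)
    (hi : i < k + 1) :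
    benderKnuth c k g (k + 1) i ∈ Set.Icc (g (k + 2) (i + 1)) (g (k + 2) i) := by
  have hlower : g (k + 2) (i + 1) ≤ g (k + 1) i := hg.lower _ _ hi hk
  have hupper : g (k + 1) i ≤ g (k + 2) i := hg.upper _ _ hi hk
  rcases lt_or_ge c (g (k + 1) i) with hc | hc
  · rw [benderKnuth_of_lt hc]
    exact ⟨hlower, hupper⟩
  · refine Set.Icc_subset_Icc ?_ ?_ (hg.benderKnuth_mem_Icc hk hi hc)
    · rw [slotMin]
      split_ifs <;> omega
    · rw [slotMax]
      split_ifs <;> omega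

theorem IsGelfandTsetlin.le_benderKnuth (hg : IsGelfandTsetlin κ g) (hk : k + 1 < u)
    (hi : i < k) : g k i ≤ benderKnuth c k g (k + 1) i := by
  have hupper := hg.upper k i hi (by omega)
  rcases lt_or_ge c (g (k + 1) i) with hc | hc
  · rwa [benderKnuth_of_lt hc]
  · refine le_trans ?_ (hg.benderKnuth_mem_Icc hk (by omega) hc).1
    rw [slotMin, if_pos hi]
    omega

theorem IsGelfandTsetlin.benderKnuth_le (hg : IsGelfandTsetlin κ g) (hk : k + 1 < u)
    (hi : i < k) : benderKnuth c k g (k + 1) (i + 1) ≤ g k i := by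
  rcases lt_or_ge c (g (k + 1) (i + 1)) with hc | hc
  · rw [benderKnuth_of_lt hc]
    exact hg.lower k i hi (by omega)
  · refine (hg.benderKnuth_mem_Icc hk (by omega) hc).2.trans ?_
    rw [slotMax, if_pos (Nat.succ_pos i), Nat.add_sub_cancel]
    omega

theorem isGelfandTsetlin_benderKnuth (hg : IsGelfandTsetlin κ g) (hk : k + 1 < u) :
    IsGelfandTsetlin κ (benderKnuth c k g) where
  top i := by rw [benderKnuth_of_ne g (by omega), hg.top]
  upper r i hi hr := by
    rcases eq_or_ne r (k + 1) with rfl | hrk1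
    · rw [benderKnuth_of_ne g (by omega : k + 1 + 1 ≠ k + 1)]
      exact (hg.benderKnuth_mem_Icc_row_succ hk hi).2
    · rw [benderKnuth_of_ne g hrk1]
      rcases eq_or_ne r k with rfl | hrk
      · exact hg.le_benderKnuth hk hi
      · rw [benderKnuth_of_ne g (by omega)]
        exact hg.upper r i hi hr
  lower r i hi hr := by
    rcases eq_or_ne r (k + 1) with rfl | hrk1
    · rw [benderKnuth_of_ne g (by omega : k + 1 + 1 ≠ k + 1)]
      exact (hg.benderKnuth_mem_Icc_row_succ hk hi).1
    · rw [benderKnuth_of_ne g hrk1]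
      rcases eq_or_ne r k with rfl | hrk
      · exact hg.benderKnuth_le hk hi
      · rw [benderKnuth_of_ne g (by omega)]
        exact hg.lower r i hi hr
  outside r i hri := by
    rw [benderKnuth, if_neg (by omega)]
    exact hg.outside r i hri

theorem max_benderKnuth (hg : IsGelfandTsetlin κ g) (hk : k + 1 < u) (r i : ℕ) :
    max (benderKnuth c k g r i) c = max (g r i) c := by
  by_cases hmoved : r = k + 1 ∧ i < k + 1 ∧ g r i ≤ c
  · obtain ⟨rfl, hi, hc⟩ := hmoved
    rw [max_eq_right hc,
      max_eq_right ((hg.benderKnuth_mem_Icc hk hi hc).2.trans (slotMax_le g c k i))]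
  · rw [benderKnuth, if_neg hmoved]

theorem benderKnuth_benderKnuth (hg : IsGelfandTsetlin κ g) (hk : k + 1 < u) :
    benderKnuth c k (benderKnuth c k g) = g := by
  funext r i
  by_cases hmoved : r = k + 1 ∧ i < k + 1 ∧ g r i ≤ c
  · obtain ⟨rfl, hi, hc⟩ := hmoved
    have hc' := (hg.benderKnuth_mem_Icc hk hi hc).2.trans (slotMax_le g c k i)
    rw [benderKnuth_of_le hi hc', slotMin_benderKnuth, slotMax_benderKnuth,
      benderKnuth_of_le hi hc, sub_sub_cancel]
  · have hfixed : benderKnuth c k g r i = g r i := if_neg hmoved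
    rw [benderKnuth, hfixed, if_neg hmoved]

theorem rowSum_benderKnuth_of_ne {r : ℕ} (g : ℕ → ℕ → ℤ) (hr : r ≠ k + 1) :
    rowSum (benderKnuth c k g) r = rowSum g r :=
  sum_congr rfl fun i _ => benderKnuth_of_ne g hr i

theorem rowSum_benderKnuth (hg : IsGelfandTsetlin κ g) (hk : k + 1 < u)
    (hcut : IsCuttable c k g) :
    rowSum (benderKnuth c k g) (k + 1) =
      rowSum g (k + 1) + minRowSum g c (k + 2) - 2 * minRowSum g c (k + 1) + minRowSum g c k := by
  have hentry : ∀ i ∈ range (k + 1), benderKnuth c k g (k + 1) i =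
      g (k + 1) i - 2 * min (g (k + 1) i) c + (slotMin g c k i + slotMax g c k i) := by
    intro i hi
    rw [mem_range] at hi
    rcases lt_or_ge c (g (k + 1) i) with hc | hc
    · rw [benderKnuth_of_lt hc, hg.slotMin_eq hk hcut hi hc, hg.slotMax_eq hk hi hc,
        min_eq_right hc.le]
      ring
    · rw [benderKnuth_of_le hi hc, min_eq_left hc]
      ring
  rw [rowSum, sum_congr rfl hentry, sum_add_distrib, sum_sub_distrib, ← mul_sum,
    sum_slotMin_add_slotMax, rowSum, minRowSum, minRowSum, minRowSum]
  ring

theorem add_patternWt_benderKnuth (hg : IsGelfandTsetlin κ g) (hk : k + 1 < u)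
    (hcut : IsCuttable c k g) (β : Fin u → ℤ)
    (hβ : (β + patternWt u g) ⟨k + 1, hk⟩ - (β + patternWt u g) ⟨k, by omega⟩ =
      minRowSum g c (k + 2) - 2 * minRowSum g c (k + 1) + minRowSum g c k) :
    β + patternWt u (benderKnuth c k g) =
      (β + patternWt u g) ∘ swap ⟨k, by omega⟩ ⟨k + 1, hk⟩ := by
  have hsum := rowSum_benderKnuth hg hk hcut
  simp only [Pi.add_apply, patternWt] at hβ
  ext a
  rw [Function.comp_apply, swap_apply_def]
  split_ifs with hak hak1
  · subst hak
    simp only [Pi.add_apply, patternWt]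
    rw [hsum, rowSum_benderKnuth_of_ne g (by omega)]
    linarith
  · subst hak1
    simp only [Pi.add_apply, patternWt]
    rw [hsum, rowSum_benderKnuth_of_ne g (by omega)]
    linarith
  · simp only [Pi.add_apply, patternWt]
    rw [rowSum_benderKnuth_of_ne g fun h => hak (Fin.ext (Nat.succ.inj h)),
      rowSum_benderKnuth_of_ne g fun h => hak1 (Fin.ext h)]

end BenderKnuth

section Symmetry

variable {u : ℕ} {κ : Fin u → ℤ} {g : ℕ → ℕ → ℤ}

theorem IsGelfandTsetlin.le_top (hg : IsGelfandTsetlin κ g) {k i : ℕ} (hi : i < k) (hk : k ≤ u) :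
    g k i ≤ κ ⟨i, by omega⟩ := by
  suffices h : ∀ r, k ≤ r → r ≤ u → g k i ≤ g r i from hg.top ⟨i, _⟩ ▸ h u hk le_rfl
  intro r hr
  induction r, hr using Nat.le_induction with
  | base => exact fun _ => le_rfl
  | succ r hr ih => exact fun h => (ih (by omega)).trans (hg.upper r i (by omega) (by omega))

theorem exists_perm_patternWt_swap (κ : Fin u → ℤ) {k : ℕ} (hk : k + 1 < u) :
    ∃ e : Perm (GelfandTsetlinPattern κ), ∀ T,
      patternWt u (e T).1 = patternWt u T.1 ∘ swap ⟨k, by omega⟩ ⟨k + 1, hk⟩ := by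
  obtain ⟨c, hc⟩ := (Set.finite_range κ).bddAbove
  have hle : ∀ T : GelfandTsetlinPattern κ, ∀ r i, i < r → r ≤ u → T.1 r i ≤ c :=
    fun T r i hi hr => (T.2.le_top hi hr).trans (hc ⟨_, rfl⟩)
  have hinv : Function.Involutive fun T : GelfandTsetlinPattern κ =>
      (⟨benderKnuth c k T.1, isGelfandTsetlin_benderKnuth T.2 hk⟩ : GelfandTsetlinPattern κ) :=
    fun T => Subtype.ext (benderKnuth_benderKnuth T.2 hk)
  refine ⟨hinv.toPerm, fun T => ?_⟩
  have hcut : IsCuttable c k T.1 := fun i hi h => absurd (hle T _ i hi hk.le) (not_le.2 h)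
  have hrow : ∀ r ≤ u, minRowSum T.1 c r = rowSum T.1 r := fun r hr =>
    sum_congr rfl fun i hi => min_eq_left (hle T r i (mem_range.1 hi) hr)
  have hwt := add_patternWt_benderKnuth T.2 hk hcut 0 (by
    rw [hrow _ (by omega), hrow _ (by omega), hrow _ (by omega)]
    simp only [zero_add, patternWt]
    ring)
  rwa [zero_add, zero_add] at hwt

theorem exists_perm_patternWt (κ : Fin u → ℤ) (σ : Perm (Fin u)) :
    ∃ e : Perm (GelfandTsetlinPattern κ), ∀ T, patternWt u (e T).1 = patternWt u T.1 ∘ σ := by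
  rcases u with _ | u
  · exact ⟨1, fun T => Subsingleton.elim _ _⟩
  have hσ : σ ∈ Submonoid.closure (Set.range fun i : Fin u => swap i.castSucc i.succ) :=
    mclosure_swap_castSucc_succ u ▸ Submonoid.mem_top σ
  induction hσ using Submonoid.closure_induction with
  | one => exact ⟨1, fun T => rfl⟩
  | mem σ h =>
    obtain ⟨k, rfl⟩ := h
    exact exists_perm_patternWt_swap κ (by omega)
  | mul σ τ _ _ hσ hτ =>
    obtain ⟨eσ, hσ⟩ := hσ
    obtain ⟨eτ, hτ⟩ := hτ
    refine ⟨eτ * eσ, fun T => ?_⟩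
    rw [Perm.mul_apply, hτ, hσ]
    rfl

end Symmetry

/-! ### The Littlewood–Richardson rule -/

theorem antitone_of_succ_le {u : ℕ} {κ : Fin u → ℤ}
    (h : ∀ (k : ℕ) (hk : k + 1 < u), κ ⟨k + 1, hk⟩ ≤ κ ⟨k, by omega⟩) : Antitone κ := by
  rcases u with _ | u
  · exact Subsingleton.antitone _
  · exact Fin.antitone_iff_succ_le.2 fun i => h i (by omega)

/-- The sum of the entries of row `k` of a pattern, truncated from below at `c`. -/
def maxRowSum (g : ℕ → ℕ → ℤ) (c : ℤ) (k : ℕ) : ℤ := ∑ i ∈ range k, max (g k i) c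

/-- The weight of the pattern `max (g · ·) c`, that is, of the part of `g` above the cut `c`. -/
def upperWt (u : ℕ) (g : ℕ → ℕ → ℤ) (c : ℤ) : Fin u → ℤ :=
  fun a => maxRowSum g c (a + 1) - maxRowSum g c a

/-- The condition on a pattern that replaces the lattice word condition in the
Littlewood–Richardson rule: adding to `τ` the weight of the part above any cut gives a dominant
vector. -/
def IsDominantOver {u : ℕ} (τ : Fin u → ℤ) (g : ℕ → ℕ → ℤ) : Prop :=
  ∀ c, Antitone (τ + upperWt u g c)

/-- Adding to `τ` the weight of the part of `g` above the cut `c` destroys the dominance between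
the positions `k` and `k + 1`. -/
def Violates {u : ℕ} (τ : Fin u → ℤ) (g : ℕ → ℕ → ℤ) (c : ℤ) (k : ℕ) : Prop :=
  ∃ hk : k + 1 < u, (τ + upperWt u g c) ⟨k, by omega⟩ < (τ + upperWt u g c) ⟨k + 1, hk⟩

/-- The violation at the highest cut, and there at the smallest position. -/
structure IsFirstViolation {u : ℕ} (τ : Fin u → ℤ) (g : ℕ → ℕ → ℤ) (c : ℤ) (k : ℕ) : Prop where
  violates : Violates τ g c k
  not_violates_above : ∀ c' k', c < c' → ¬Violates τ g c' k'
  not_violates_before : ∀ k' < k, ¬Violates τ g c k'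

/-- The positions of the entries of row `r` that are at most `c`. -/
def lowEntries (g : ℕ → ℕ → ℤ) (c : ℤ) (r : ℕ) : Finset ℕ := {i ∈ range r | g r i ≤ c}

theorem minRowSum_add_maxRowSum (g : ℕ → ℕ → ℤ) (c : ℤ) (k : ℕ) :
    minRowSum g c k + maxRowSum g c k = rowSum g k + k * c := by
  rw [minRowSum, maxRowSum, rowSum, ← sum_add_distrib]
  simp only [min_add_max, sum_add_distrib, sum_const, card_range, nsmul_eq_mul]

theorem maxRowSum_add_one (g : ℕ → ℕ → ℤ) (c : ℤ) (r : ℕ) :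
    maxRowSum g (c + 1) r = maxRowSum g c r + #(lowEntries g c r) := by
  rw [maxRowSum, maxRowSum, lowEntries, ← sum_boole, ← sum_add_distrib]
  refine sum_congr rfl fun i _ => ?_
  split_ifs <;> omega

section Violation

variable {u : ℕ} {τ κ : Fin u → ℤ} {g : ℕ → ℕ → ℤ} {c : ℤ} {k : ℕ}

theorem violates_iff (hk : k + 1 < u) : Violates τ g c k ↔
    (τ + upperWt u g c) ⟨k, by omega⟩ < (τ + upperWt u g c) ⟨k + 1, hk⟩ :=
  exists_prop_of_true hk

theorem isDominantOver_of_forall_not_violates (h : ∀ c k, ¬Violates τ g c k) :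
    IsDominantOver τ g := fun c =>
  antitone_of_succ_le fun k hk => not_lt.1 fun hlt => h c k ⟨hk, hlt⟩

theorem Violates.not_isDominantOver (h : Violates τ g c k) : ¬IsDominantOver τ g := fun hdom =>
  h.choose_spec.not_ge (hdom c (Fin.mk_le_mk.2 (Nat.le_succ k)))

theorem IsFirstViolation.unique {c' : ℤ} {k' : ℕ} (h : IsFirstViolation τ g c k)
    (h' : IsFirstViolation τ g c' k') : c = c' ∧ k = k' := by
  obtain rfl : c = c' := le_antisymm
    (not_lt.1 fun hlt => h'.not_violates_above _ _ hlt h.violates)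
    (not_lt.1 fun hlt => h.not_violates_above _ _ hlt h'.violates)
  exact ⟨rfl, le_antisymm (not_lt.1 fun hlt => h.not_violates_before _ hlt h'.violates)
    (not_lt.1 fun hlt => h'.not_violates_before _ hlt h.violates)⟩

theorem IsGelfandTsetlin.upperWt_eq_const (hg : IsGelfandTsetlin κ g) (hκ : ∀ i, κ i ≤ c) :
    upperWt u g c = fun _ => c := by
  have hrow : ∀ r ≤ u, maxRowSum g c r = r * c := fun r hr => by
    rw [maxRowSum, sum_congr rfl fun i hi =>
      max_eq_right ((hg.le_top (mem_range.1 hi) hr).trans (hκ _)), sum_const, card_range,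
      nsmul_eq_mul]
  ext a
  rw [upperWt, hrow _ (by omega), hrow _ (by omega)]
  push_cast
  ring

theorem IsGelfandTsetlin.exists_isFirstViolation (hg : IsGelfandTsetlin κ g) (hτ : Antitone τ)
    (h : ¬IsDominantOver τ g) : ∃ c k, IsFirstViolation τ g c k := by
  classical
  obtain ⟨b, hb⟩ := (Set.finite_range κ).bddAbove
  obtain ⟨c₀, k₀, h₀⟩ : ∃ c k, Violates τ g c k := by
    by_contra! hcon
    exact h (isDominantOver_of_forall_not_violates hcon)
  have hbdd : ∀ c, (∃ k, Violates τ g c k) → c ≤ b := by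
    rintro c ⟨k, hk, hlt⟩
    by_contra! hbc
    rw [hg.upperWt_eq_const fun i => (hb ⟨i, rfl⟩).trans hbc.le] at hlt
    exact hlt.not_ge (add_le_add_left (hτ (Fin.mk_le_mk.2 (Nat.le_succ k))) c)
  obtain ⟨c, hc, hmax⟩ := Int.exists_greatest_of_bdd ⟨b, hbdd⟩ ⟨c₀, k₀, h₀⟩
  exact ⟨c, Nat.find hc, Nat.find_spec hc,
    fun c' k' hlt hviol => hlt.not_ge (hmax c' ⟨k', hviol⟩), fun k' hk' => Nat.find_min hc hk'⟩

theorem IsGelfandTsetlin.card_lowEntries_le (hg : IsGelfandTsetlin κ g) {a : ℕ} (ha : a < u) :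
    #(lowEntries g c a) ≤ #(lowEntries g c (a + 1)) := by
  refine card_le_card_of_injOn (· + 1) (fun i hi => ?_) (add_left_injective 1).injOn
  simp only [lowEntries, coe_filter, mem_range, Set.mem_ofPred_eq] at hi ⊢
  exact ⟨by omega, (hg.lower a i hi.1 ha).trans hi.2⟩

theorem IsGelfandTsetlin.lowEntries_succ_subset (hg : IsGelfandTsetlin κ g) {a : ℕ} (ha : a < u) :
    lowEntries g c (a + 1) ⊆ insert a (lowEntries g c a) := by
  intro i hi
  simp only [lowEntries, mem_filter, mem_insert, mem_range] at hi ⊢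
  rcases Nat.lt_succ_iff_lt_or_eq.1 hi.1 with hia | hia
  · exact Or.inr ⟨hia, (hg.upper a i hia ha).trans hi.2⟩
  · exact Or.inl hia

theorem card_insert_lowEntries (g : ℕ → ℕ → ℤ) (c : ℤ) (a : ℕ) :
    #(insert a (lowEntries g c a)) = #(lowEntries g c a) + 1 :=
  card_insert_of_notMem fun h => (mem_range.1 (mem_filter.1 h).1).false

theorem IsGelfandTsetlin.card_lowEntries_succ_le (hg : IsGelfandTsetlin κ g) {a : ℕ} (ha : a < u) :
    #(lowEntries g c (a + 1)) ≤ #(lowEntries g c a) + 1 :=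
  (card_le_card (hg.lowEntries_succ_subset ha)).trans_eq (card_insert_lowEntries g c a)

theorem IsGelfandTsetlin.isCuttable (hg : IsGelfandTsetlin κ g) (hk : k < u)
    (hcard : #(lowEntries g c k) < #(lowEntries g c (k + 1))) : IsCuttable c k g := by
  have heq : lowEntries g c (k + 1) = insert k (lowEntries g c k) :=
    eq_of_subset_of_card_le (hg.lowEntries_succ_subset hk) (by rwa [card_insert_lowEntries])
  intro i hi hc
  have hmem : i ∉ insert k (lowEntries g c k) := by
    rw [← heq, lowEntries, mem_filter]
    exact fun h => hc.not_ge h.2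
  rw [mem_insert, lowEntries, mem_filter, mem_range, not_or, not_and, not_le] at hmem
  have hik : i < k := by omega
  exact ⟨hik, hmem.2 hik⟩

-- Lowering the cut by one changes every entry of `upperWt` by `0` or `-1`, so the first violation
-- is a violation by exactly one and leaves no choice for the sizes of the sets `lowEntries`.
theorem IsFirstViolation.isCuttable_and_eq (h : IsFirstViolation τ g c k)
    (hg : IsGelfandTsetlin κ g) :
    ∃ hk : k + 1 < u, IsCuttable c k g ∧
      (τ + upperWt u g c) ⟨k, by omega⟩ + 1 = (τ + upperWt u g c) ⟨k + 1, hk⟩ := by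
  obtain ⟨hk, hlt⟩ := h.violates
  have hge := h.not_violates_above (c + 1) k (lt_add_one c)
  rw [violates_iff hk, not_lt] at hge
  simp only [Pi.add_apply, upperWt, maxRowSum_add_one] at hge hlt ⊢
  have hle := hg.card_lowEntries_le (c := c) (a := k) (by omega)
  have hsucc := hg.card_lowEntries_succ_le (c := c) (a := k) (by omega)
  have hle' := hg.card_lowEntries_le (c := c) hk
  have hsucc' := hg.card_lowEntries_succ_le (c := c) hk
  exact ⟨hk, hg.isCuttable (by omega) (by omega), by omega⟩

theorem upperWt_benderKnuth (hg : IsGelfandTsetlin κ g) (hk : k + 1 < u) {c' : ℤ} (hc : c ≤ c') :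
    upperWt u (benderKnuth c k g) c' = upperWt u g c' := by
  have hrow : ∀ r, maxRowSum (benderKnuth c k g) c' r = maxRowSum g c' r := fun r =>
    sum_congr rfl fun i _ => by
      have hmax := max_benderKnuth (c := c) hg hk r i
      omega
  ext a
  rw [upperWt, upperWt, hrow, hrow]

theorem isFirstViolation_benderKnuth (h : IsFirstViolation τ g c k) (hg : IsGelfandTsetlin κ g) :
    IsFirstViolation τ (benderKnuth c k g) c k := by
  have hk := h.violates.choose
  have hiff : ∀ c', c ≤ c' → ∀ a, Violates τ (benderKnuth c k g) c' a ↔ Violates τ g c' a :=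
    fun c' hc' a => by rw [Violates, Violates, upperWt_benderKnuth hg hk hc']
  exact ⟨(hiff c le_rfl k).2 h.violates,
    fun c' k' hlt => (hiff c' hlt.le k').not.2 (h.not_violates_above c' k' hlt),
    fun k' hk' => (hiff c le_rfl k').not.2 (h.not_violates_before k' hk')⟩

theorem alternant_benderKnuth (h : IsFirstViolation τ g c k) (hg : IsGelfandTsetlin κ g) :
    alternant (τ + patternWt u (benderKnuth c k g) + staircase u) =
      -alternant (τ + patternWt u g + staircase u) := by
  obtain ⟨hk, hcut, heq⟩ := h.isCuttable_and_eq hg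
  rw [add_right_comm τ _ (staircase u), add_right_comm τ _ (staircase u),
    add_patternWt_benderKnuth hg hk hcut (τ + staircase u), alternant_comp_swap]
  · exact fun h => absurd (Fin.mk.inj h) (Nat.lt_succ_self k).ne
  · have hsum₀ := minRowSum_add_maxRowSum g c k
    have hsum₁ := minRowSum_add_maxRowSum g c (k + 1)
    have hsum₂ := minRowSum_add_maxRowSum g c (k + 2)
    simp only [Pi.add_apply, upperWt, patternWt, staircase] at heq ⊢
    push_cast at hsum₁ hsum₂ ⊢
    linarith

end Violation

section LittlewoodRichardson

variable {u : ℕ} {τ κ : Fin u → ℤ} [Fintype (GelfandTsetlinPattern κ)]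

open Classical in
theorem sum_alternant_not_isDominantOver (hτ : Antitone τ) :
    ∑ T : GelfandTsetlinPattern κ with ¬IsDominantOver τ T.1,
      alternant (τ + patternWt u T.1 + staircase u) = 0 := by
  have hex : ∀ T : GelfandTsetlinPattern κ, ¬IsDominantOver τ T.1 →
      ∃ p : ℤ × ℕ, IsFirstViolation τ T.1 p.1 p.2 := fun T hT => by
    obtain ⟨c, k, h⟩ := T.2.exists_isFirstViolation hτ hT
    exact ⟨(c, k), h⟩
  choose! p hp using hex
  let flip (T : GelfandTsetlinPattern κ) (hT : ¬IsDominantOver τ T.1) :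
      GelfandTsetlinPattern κ :=
    ⟨benderKnuth (p T).1 (p T).2 T.1, isGelfandTsetlin_benderKnuth T.2 (hp T hT).violates.choose⟩
  have hflip : ∀ T hT, IsFirstViolation τ (flip T hT).1 (p T).1 (p T).2 := fun T hT =>
    isFirstViolation_benderKnuth (hp T hT) T.2
  have hneg : ∀ T hT, alternant (τ + patternWt u (flip T hT).1 + staircase u) =
      -alternant (τ + patternWt u T.1 + staircase u) := fun T hT =>
    alternant_benderKnuth (hp T hT) T.2
  have hnot : ∀ T hT, ¬IsDominantOver τ (flip T hT).1 := fun T hT =>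
    (hflip T hT).violates.not_isDominantOver
  refine sum_involution (fun T hT => flip T (mem_filter.1 hT).2) (fun T hT => ?_)
    (fun T hT hne heq => hne (eq_zero_of_eq_neg_self ?_))
    (fun T hT => mem_filter.2 ⟨mem_univ _, hnot T (mem_filter.1 hT).2⟩) (fun T hT => ?_)
  · rw [hneg T (mem_filter.1 hT).2, add_neg_cancel]
  · rw [← hneg T (mem_filter.1 hT).2, heq]
  · have hT := (mem_filter.1 hT).2
    obtain ⟨hc, hk⟩ := (hflip T hT).unique (hp _ (hnot T hT))
    refine Subtype.ext ?_
    change benderKnuth (p (flip T hT)).1 (p (flip T hT)).2 (benderKnuth (p T).1 (p T).2 T.1) = T.1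
    rw [← hc, ← hk, benderKnuth_benderKnuth T.2 (hp T hT).violates.choose]

open Classical in
theorem alternant_mul_sum_pattern (hτ : Antitone τ) :
    alternant (τ + staircase u) * ∑ T : GelfandTsetlinPattern κ, monomial (patternWt u T.1) =
      ∑ T : GelfandTsetlinPattern κ with IsDominantOver τ T.1,
        alternant (τ + patternWt u T.1 + staircase u) := by
  rw [alternant_mul_sum_monomial]
  · simp only [add_right_comm τ (staircase u)]
    rw [← sum_filter_add_sum_filter_not univ fun T : GelfandTsetlinPattern κ =>
      IsDominantOver τ T.1, sum_alternant_not_isDominantOver hτ, add_zero]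
  · intro σ
    obtain ⟨e, he⟩ := exists_perm_patternWt κ σ
    simp only [← he]
    exact Equiv.sum_comp e fun T : GelfandTsetlinPattern κ => monomial (patternWt u T.1)

end LittlewoodRichardson

/-! ### The bialternant formula -/

section TopPattern

variable {u : ℕ} {τ κ : Fin u → ℤ} {g : ℕ → ℕ → ℤ}

theorem IsDominantOver.antitone (h : IsDominantOver τ g) : Antitone (τ + patternWt u g) := by
  obtain ⟨c, hc⟩ := ((range (u + 1) ×ˢ range u).image fun p => g p.1 p.2).bddBelow
  have hle : ∀ r ≤ u, ∀ i < r, c ≤ g r i := fun r hr i hi =>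
    hc (mem_coe.2 (mem_image.2 ⟨(r, i), mem_product.2
      ⟨mem_range.2 (Nat.lt_succ_of_le hr), mem_range.2 (hi.trans_le hr)⟩, rfl⟩))
  have hrow : ∀ r ≤ u, maxRowSum g c r = rowSum g r := fun r hr =>
    sum_congr rfl fun i hi => max_eq_left (hle r hr i (mem_range.1 hi))
  have hwt : upperWt u g c = patternWt u g := by
    ext a
    rw [upperWt, patternWt, hrow _ (by omega), hrow _ (by omega)]
  exact hwt ▸ h c

/-- The pattern of highest weight: every column is constant. -/
def topPattern (κ : Fin u → ℤ) : ℕ → ℕ → ℤ := fun k i =>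
  if h : i < k ∧ k ≤ u then κ ⟨i, by omega⟩ else 0

theorem topPattern_apply (κ : Fin u → ℤ) {k i : ℕ} (hi : i < k) (hk : k ≤ u) :
    topPattern κ k i = κ ⟨i, by omega⟩ :=
  dif_pos ⟨hi, hk⟩

theorem isGelfandTsetlin_topPattern (hκ : Antitone κ) : IsGelfandTsetlin κ (topPattern κ) where
  top i := topPattern_apply κ i.2 le_rfl
  upper k i hi hk := by rw [topPattern_apply κ hi hk.le, topPattern_apply κ (by omega) hk]
  lower k i hi hk := by
    rw [topPattern_apply κ hi hk.le, topPattern_apply κ (by omega) hk]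
    exact hκ (Fin.mk_le_mk.2 (Nat.le_succ i))
  outside k i h := dif_neg (by omega)

theorem sum_topPattern_sub (κ : Fin u → ℤ) (f : ℤ → ℤ) (a : Fin u) :
    ∑ i ∈ range (a + 1), f (topPattern κ (a + 1) i) - ∑ i ∈ range a, f (topPattern κ a i) =
      f (κ a) := by
  have hrow : ∀ i ∈ range (a : ℕ), f (topPattern κ (a + 1) i) = f (topPattern κ a i) := by
    intro i hi
    rw [mem_range] at hi
    rw [topPattern_apply κ hi (by omega), topPattern_apply κ (by omega) (by omega)]
  rw [sum_range_succ, sum_congr rfl hrow, add_sub_cancel_left,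
    topPattern_apply κ (Nat.lt_succ_self a) (by omega)]

theorem upperWt_topPattern (κ : Fin u → ℤ) (c : ℤ) :
    upperWt u (topPattern κ) c = fun a => max (κ a) c :=
  funext fun a => sum_topPattern_sub κ (fun x => max x c) a

theorem patternWt_topPattern (κ : Fin u → ℤ) : patternWt u (topPattern κ) = κ :=
  funext fun a => sum_topPattern_sub κ id a

theorem isDominantOver_topPattern (hκ : Antitone κ) :
    IsDominantOver (0 : Fin u → ℤ) (topPattern κ) := by
  intro c
  rw [zero_add, upperWt_topPattern]
  exact fun i j hij => max_le_max_right c (hκ hij)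

theorem IsGelfandTsetlin.antitone_row (hg : IsGelfandTsetlin κ g) (hκ : Antitone κ) {k i j : ℕ}
    (hij : i ≤ j) (hj : j < k) (hk : k ≤ u) : g k j ≤ g k i := by
  induction j, hij using Nat.le_induction with
  | base => exact le_rfl
  | succ j _ ih =>
    refine le_trans ?_ (ih (by omega))
    rcases hk.lt_or_eq with hku | rfl
    · exact (hg.upper k _ hj hku).trans (hg.lower k j (by omega) hku)
    · rw [hg.top ⟨j + 1, hj⟩, hg.top ⟨j, by omega⟩]
      exact hκ (Fin.mk_le_mk.2 (Nat.le_succ j))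

theorem IsGelfandTsetlin.eq_topPattern_of_forall_eq (hg : IsGelfandTsetlin κ g)
    (h : ∀ k i, i < k → k < u → g k i = g (k + 1) i) : g = topPattern κ := by
  funext k i
  by_cases hki : i < k ∧ k ≤ u
  · have hcol : ∀ r, k ≤ r → r ≤ u → g k i = g r i := by
      intro r hr
      induction r, hr using Nat.le_induction with
      | base => exact fun _ => rfl
      | succ r hr ih => exact fun hru => (ih (by omega)).trans (h r i (by omega) hru)
    rw [topPattern_apply κ hki.1 hki.2, ← hg.top]
    exact hcol u hki.2 le_rfl
  · rw [topPattern, dif_neg hki]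
    exact hg.outside k i (by omega)

theorem exists_highest_jump {k i : ℕ} (hi : i < k) (hk : k < u) (hlt : g k i < g (k + 1) i) :
    ∃ k i, i < k ∧ k < u ∧ g k i < g (k + 1) i ∧
      ∀ l < k, ∀ j < l, g l j < g (l + 1) j → g (l + 1) j < g (k + 1) i := by
  let jumps : Finset (ℕ × ℕ) :=
    {p ∈ range u ×ˢ range u | p.2 < p.1 ∧ g p.1 p.2 < g (p.1 + 1) p.2}
  have mem_jumps : ∀ k i, (k, i) ∈ jumps ↔ k < u ∧ i < k ∧ g k i < g (k + 1) i := by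
    intro k i
    simp only [jumps, mem_filter, mem_product, mem_range]
    exact ⟨fun h => ⟨h.1.1, h.2⟩, fun h => ⟨⟨h.1, by omega⟩, h.2⟩⟩
  obtain ⟨⟨k, i⟩, hmem, hmax⟩ := exists_max_image jumps
    (fun p => toLex (g (p.1 + 1) p.2, -(p.1 : ℤ))) ⟨(k, i), (mem_jumps k i).2 ⟨hk, hi, hlt⟩⟩
  obtain ⟨hk, hi, hlt⟩ := (mem_jumps k i).1 hmem
  refine ⟨k, i, hi, hk, hlt, fun l hl j hj hjump => ?_⟩
  have hle := hmax (l, j) ((mem_jumps l j).2 ⟨by omega, hj, hjump⟩)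
  simp only [Prod.Lex.toLex_le_toLex] at hle
  omega

-- At a cut just below the highest jump, whose position is minimal, the weight of the row of the
-- jump falls short of the weight of the next row.
theorem IsGelfandTsetlin.eq_topPattern (hg : IsGelfandTsetlin κ g) (hκ : Antitone κ)
    (hdom : IsDominantOver (0 : Fin u → ℤ) g) : g = topPattern κ := by
  refine hg.eq_topPattern_of_forall_eq fun k i hi hk => ?_
  by_contra hne
  obtain ⟨k, i, hi, hk, hlt, hhighest⟩ := exists_highest_jump hi hk
    ((hg.upper k i hi hk).lt_of_ne hne)
  obtain ⟨a, rfl⟩ := Nat.exists_eq_succ_of_ne_zero (Nat.ne_zero_of_lt hi)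
  rw [Nat.succ_eq_add_one] at *
  set c : ℤ := g (a + 1 + 1) i - 1
  have hrow : ∀ j ∈ range a, max (g (a + 1) j) c = max (g a j) c := by
    intro j hj
    rw [mem_range] at hj
    have hupper := hg.upper a j hj (by omega)
    have hlow := hhighest a (by omega) j hj
    omega
  have hlast : g (a + 1) a ≤ c := by
    have hanti := hg.antitone_row hκ (i := i) (j := a) (k := a + 1) (by omega) (by omega) hk.le
    omega
  have hwt : upperWt u g c ⟨a, by omega⟩ = c := by
    rw [upperWt, maxRowSum, maxRowSum, sum_range_succ, sum_congr rfl hrow, add_sub_cancel_left,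
      max_eq_right hlast]
  have hsum : ∑ j ∈ range (a + 1), max (g (a + 1) j) c <
      ∑ j ∈ range (a + 1), max (g (a + 1 + 1) j) c :=
    sum_lt_sum (fun j hj => max_le_max_right _ (hg.upper _ _ (mem_range.1 hj) hk))
      ⟨i, mem_range.2 hi, by omega⟩
  have hwt' : c < upperWt u g c ⟨a + 1, hk⟩ := by
    change c < ∑ j ∈ range (a + 1 + 1), max (g (a + 1 + 1) j) c -
      ∑ j ∈ range (a + 1), max (g (a + 1) j) c
    rw [sum_range_succ]
    have hle := le_max_right (g (a + 1 + 1) (a + 1)) c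
    omega
  have hle := hdom c (Fin.mk_le_mk.2 (Nat.le_succ a) : (⟨a, by omega⟩ : Fin u) ≤ ⟨a + 1, hk⟩)
  rw [zero_add, hwt] at hle
  exact hle.not_gt hwt'

theorem alternant_staircase_mul_sum_pattern [Fintype (GelfandTsetlinPattern κ)]
    (hκ : Antitone κ) :
    alternant (staircase u) * ∑ T : GelfandTsetlinPattern κ, monomial (patternWt u T.1) =
      alternant (κ + staircase u) := by
  classical
  have hmul := alternant_mul_sum_pattern (τ := 0) (κ := κ) antitone_const
  rw [zero_add] at hmul
  rw [hmul, sum_eq_single (⟨topPattern κ, isGelfandTsetlin_topPattern hκ⟩ :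
    GelfandTsetlinPattern κ)]
  · rw [patternWt_topPattern, zero_add]
  · intro T hT hne
    exact absurd (Subtype.ext (T.2.eq_topPattern hκ (mem_filter.1 hT).2)) hne
  · exact fun hnot => (hnot (mem_filter.2 ⟨mem_univ _, isDominantOver_topPattern hκ⟩)).elim

end TopPattern

/-! ### Rational tableaux and Gelfand–Tsetlin patterns -/

theorem orderEmbOfFin_le_iff {α : Type*} [LinearOrder α] (S : Finset α) (i : ℕ) (s : α) :
    (∃ h : i < #S, S.orderEmbOfFin rfl ⟨i, h⟩ ≤ s) ↔ i < #{x ∈ S | x ≤ s} := by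
  constructor
  · rintro ⟨h, hle⟩
    refine Nat.lt_of_succ_le ((Fin.card_Iic (⟨i, h⟩ : Fin #S)).symm.trans_le ?_)
    exact card_le_card_of_injOn _ (fun x hx => mem_coe.2 (mem_filter.2 ⟨orderEmbOfFin_mem S rfl x,
      ((S.orderEmbOfFin rfl).monotone (mem_Iic.1 hx)).trans hle⟩))
      (S.orderEmbOfFin rfl).injective.injOn
  · intro hi
    have h : i < #S := hi.trans_le (card_filter_le _ _)
    refine ⟨h, ?_⟩
    by_contra! hlt
    have hsub : {x ∈ S | x ≤ s} ⊆ (Iio (⟨i, h⟩ : Fin #S)).image (S.orderEmbOfFin rfl) := by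
      intro x hx
      obtain ⟨hxS, hxs⟩ := mem_filter.1 hx
      obtain ⟨y, rfl⟩ : x ∈ Set.range (S.orderEmbOfFin rfl) := by rwa [range_orderEmbOfFin]
      exact mem_image_of_mem _ (mem_Iio.2 ((S.orderEmbOfFin rfl).lt_iff_lt.1 (hxs.trans_lt hlt)))
    exact hi.not_ge ((card_le_card hsub).trans (card_image_le.trans_eq (Fin.card_Iio _)))

theorem card_filter_le_add_card_filter_compl {u : ℕ} (S : Finset (Fin u)) (s : Fin u) :
    #{x ∈ S | x ≤ s} + #{x ∈ Sᶜ | x ≤ s} = s + 1 := by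
  rw [← card_union_of_disjoint (disjoint_filter_filter disjoint_compl_right), ← filter_union,
    union_compl, filter_ge_eq_Iic, Fin.card_Iic]

theorem le_card_iff_exists_eq {α : Type*} {S : Finset α} {f : α → ℤ} (hinj : Set.InjOn f S)
    (hpos : ∀ p ∈ S, 0 < f p) (hclosed : ∀ p ∈ S, ∀ j, 0 < j → j ≤ f p → ∃ q ∈ S, f q = j)
    {j : ℤ} (hj : 0 < j) : j ≤ #S ↔ ∃ p ∈ S, f p = j := by
  rcases S.eq_empty_or_nonempty with rfl | hne
  · simp only [card_empty, Nat.cast_zero, notMem_empty, false_and, exists_false, iff_false]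
    omega
  obtain ⟨m, hm, hmax⟩ := S.exists_max_image f hne
  have himage : S.image f = Icc 1 (f m) := by
    ext x
    rw [mem_image, mem_Icc]
    constructor
    · rintro ⟨p, hp, rfl⟩
      exact ⟨hpos p hp, hmax p hp⟩
    · exact fun hx => hclosed m hm x hx.1 hx.2
  rw [← mem_image, himage, mem_Icc, ← card_image_of_injOn hinj, himage, Int.card_Icc]
  have hm0 := hpos m hm
  omega

theorem le_of_forall_pos_of_forall_neg {a b : ℤ} (hpos : ∀ j, 0 < j → j ≤ a → j ≤ b)
    (hneg : ∀ j < 0, b ≤ j → a ≤ j) : a ≤ b := by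
  by_contra hcon
  rcases lt_or_ge 0 a with ha | ha
  · exact hcon (hpos a ha le_rfl)
  · exact hcon (hneg b (by omega) le_rfl)

section Box

variable {u : ℕ} {lam : GenPartition u}

theorem Box.ext_row_col {p q : Box lam} (hrow : p.row = q.row) (hcol : p.col = q.col) : p = q :=
  Sigma.subtype_ext hrow hcol

theorem Box.col_cases (p : Box lam) :
    (0 < p.col ∧ p.col ≤ lam.1 p.row) ∨ (p.col < 0 ∧ lam.1 p.row ≤ p.col) := by
  rcases mem_union.1 p.2.2 with h | h
  · exact Or.inl (mem_Icc.1 h)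
  · exact Or.inr ⟨Int.le_sub_one_iff.1 (mem_Icc.1 h).2, (mem_Icc.1 h).1⟩

theorem Box.le_of_pos {p : Box lam} (h : 0 < p.col) : p.col ≤ lam.1 p.row := by
  have hp := p.col_cases
  omega

theorem Box.le_of_neg {p : Box lam} (h : p.col < 0) : lam.1 p.row ≤ p.col := by
  have hp := p.col_cases
  omega

theorem Box.exists_of_pos (i : Fin u) {j : ℤ} (hj : 0 < j) (hle : j ≤ lam.1 i) :
    ∃ p : Box lam, p.row = i ∧ p.col = j :=
  ⟨⟨i, j, mem_union_left _ (mem_Icc.2 ⟨hj, hle⟩)⟩, rfl, rfl⟩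

theorem Box.exists_of_neg (i : Fin u) {j : ℤ} (hj : j < 0) (hle : lam.1 i ≤ j) :
    ∃ p : Box lam, p.row = i ∧ p.col = j :=
  ⟨⟨i, j, mem_union_right _ (mem_Icc.2 ⟨hle, Int.le_sub_one_iff.2 hj⟩)⟩, rfl, rfl⟩

/-- The condition on the row `t` of the pattern `g` that expresses that the entry in the box `p`
is less than `t`. In row `t` of the pattern, positive rows of boxes are counted from the left and
negative ones from the right. -/
def Box.Below (g : ℕ → ℕ → ℤ) (p : Box lam) (t : ℕ) : Prop :=
  (0 < p.col ∧ (p.row : ℕ) < t ∧ p.col ≤ g t p.row) ∨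
    (p.col < 0 ∧ u ≤ t + p.row ∧ g t (t + p.row - u) ≤ p.col)

/-- The pattern `g` records the sub-tableaux of `T` formed by the small letters. -/
def Corresponds (T : Box lam → Fin u) (g : ℕ → ℕ → ℤ) : Prop :=
  ∀ p : Box lam, ∀ t ≤ u, (T p : ℕ) < t ↔ p.Below g t

variable {g : ℕ → ℕ → ℤ} {T T' : Box lam → Fin u}

theorem Box.below_of_pos {p : Box lam} (hp : 0 < p.col) {t : ℕ} :
    p.Below g t ↔ (p.row : ℕ) < t ∧ p.col ≤ g t p.row := by
  simp only [Box.Below, hp, hp.not_gt, true_and, false_and, or_false]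

theorem Box.below_of_neg {p : Box lam} (hp : p.col < 0) {t : ℕ} :
    p.Below g t ↔ u ≤ t + p.row ∧ g t (t + p.row - u) ≤ p.col := by
  simp only [Box.Below, hp, hp.not_gt, true_and, false_and, false_or]

theorem Box.Below.mono (hg : IsGelfandTsetlin lam.1 g) {p : Box lam} {t s : ℕ} (h : p.Below g t)
    (hts : t ≤ s) (hs : s ≤ u) : p.Below g s := by
  induction s, hts using Nat.le_induction with
  | base => exact h
  | succ s _ ih =>
    have hp := p.row.2
    rcases ih (by omega) with ⟨hpos, hrow, hle⟩ | ⟨hneg, hrow, hle⟩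
    · exact Or.inl ⟨hpos, by omega, hle.trans (hg.upper s _ hrow hs)⟩
    · refine Or.inr ⟨hneg, by omega, le_trans ?_ hle⟩
      rw [show s + 1 + p.row - u = s + p.row - u + 1 by omega]
      exact hg.lower s _ (by omega) hs

theorem Box.below_top (hg : IsGelfandTsetlin lam.1 g) (p : Box lam) : p.Below g u := by
  have htop := hg.top p.row
  rcases p.col_cases with ⟨hpos, hle⟩ | ⟨hneg, hle⟩
  · exact Or.inl ⟨hpos, p.row.2, htop ▸ hle⟩
  · exact Or.inr ⟨hneg, Nat.le_add_right _ _, by rwa [Nat.add_sub_cancel_left, htop]⟩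

theorem Box.not_below_zero (p : Box lam) : ¬p.Below g 0 := by
  have hp := p.row.2
  rintro (⟨-, hrow, -⟩ | ⟨-, hrow, -⟩) <;> omega

theorem IsGelfandTsetlin.exists_corresponds (hg : IsGelfandTsetlin lam.1 g) :
    ∃ T : Box lam → Fin u, Corresponds T g := by
  classical
  have hex : ∀ p : Box lam, ∃ t, p.Below g t := fun p => ⟨u, p.below_top hg⟩
  have hpos : ∀ p : Box lam, 0 < Nat.find (hex p) := fun p =>
    (Nat.find_pos (hex p)).2 p.not_below_zero
  have hle : ∀ p : Box lam, Nat.find (hex p) ≤ u := fun p => Nat.find_min' _ (p.below_top hg)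
  refine ⟨fun p => ⟨Nat.find (hex p) - 1, (Nat.sub_one_lt (hpos p).ne').trans_le (hle p)⟩,
    fun p t ht => ?_⟩
  change Nat.find (hex p) - 1 < t ↔ _
  have hp := hpos p
  constructor
  · exact fun h => (Nat.find_spec (hex p)).mono hg (by omega) ht
  · intro h
    have hfind := Nat.find_min' (hex p) h
    omega

theorem Corresponds.unique (h : Corresponds T g) (h' : Corresponds T' g) : T = T' := by
  funext p
  have hlt := (h p _ (T' p).2).trans (h' p _ (T' p).2).symm
  have hlt' := (h p _ (T p).2).trans (h' p _ (T p).2).symm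
  exact Fin.ext (by omega)

section PatternToTableau

theorem Corresponds.le_iff_of_pos (h : Corresponds T g) (hg : IsGelfandTsetlin lam.1 g) {i t : ℕ}
    (hi : i < t) (ht : t ≤ u) {j : ℤ} (hj : 0 < j) :
    j ≤ g t i ↔ ∃ p : Box lam, (p.row : ℕ) = i ∧ p.col = j ∧ (T p : ℕ) < t := by
  constructor
  · intro hle
    obtain ⟨p, hrow, rfl⟩ := Box.exists_of_pos (lam := lam) ⟨i, by omega⟩ hj
      (hle.trans (hg.le_top hi ht))
    obtain rfl : (p.row : ℕ) = i := congrArg Fin.val hrow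
    exact ⟨p, rfl, rfl, (h p t ht).2 ((Box.below_of_pos hj).2 ⟨hi, hle⟩)⟩
  · rintro ⟨p, rfl, rfl, hp⟩
    exact ((Box.below_of_pos hj).1 ((h p t ht).1 hp)).2

theorem IsGelfandTsetlin.top_le {κ : Fin u → ℤ} (hg : IsGelfandTsetlin κ g) {i t : ℕ} (hi : i < u)
    (hit : u ≤ t + i) (ht : t ≤ u) : κ ⟨i, hi⟩ ≤ g t (t + i - u) := by
  suffices hdiag : ∀ r, t ≤ r → r ≤ u → g r (r + i - u) ≤ g t (t + i - u) by
    have htop := hdiag u ht le_rfl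
    rwa [Nat.add_sub_cancel_left, hg.top ⟨i, hi⟩] at htop
  intro r hr
  induction r, hr using Nat.le_induction with
  | base => exact fun _ => le_rfl
  | succ r hr ih =>
    refine fun hru => le_trans ?_ (ih (by omega))
    rw [show r + 1 + i - u = r + i - u + 1 by omega]
    exact hg.lower r _ (by omega) hru

theorem Corresponds.le_iff_of_neg (h : Corresponds T g) (hg : IsGelfandTsetlin lam.1 g) {i t : ℕ}
    (hi : i < t) (ht : t ≤ u) {j : ℤ} (hj : j < 0) :
    g t i ≤ j ↔ ∃ p : Box lam, (p.row : ℕ) + t = i + u ∧ p.col = j ∧ (T p : ℕ) < t := by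
  constructor
  · intro hle
    have htop := hg.top_le (i := i + u - t) (t := t) (by omega) (by omega) ht
    rw [show t + (i + u - t) - u = i by omega] at htop
    obtain ⟨p, hrow, rfl⟩ := Box.exists_of_neg (lam := lam) ⟨i + u - t, by omega⟩ hj
      (htop.trans hle)
    have hrow : (p.row : ℕ) = i + u - t := congrArg Fin.val hrow
    refine ⟨p, by omega, rfl, (h p t ht).2 ((Box.below_of_neg hj).2 ⟨by omega, ?_⟩)⟩
    rwa [show t + p.row - u = i by omega]
  · rintro ⟨p, hrow, rfl, hp⟩
    have hle := ((Box.below_of_neg hj).1 ((h p t ht).1 hp)).2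
    rwa [show t + p.row - u = i by omega] at hle

theorem Corresponds.lt_of_row_lt_of_pos (h : Corresponds T g) (hg : IsGelfandTsetlin lam.1 g)
    {p q : Box lam} (hcol : p.col = q.col) (hp : 0 < p.col) (hpq : p.row < q.row) :
    T p < T q := by
  rw [Fin.lt_def] at hpq
  have hTq := (T q).2
  obtain ⟨hrow, hle⟩ := (Box.below_of_pos (hcol ▸ hp)).1 ((h q _ hTq).1 (Nat.lt_succ_self _))
  refine (h p (T q) hTq.le).2 ((Box.below_of_pos hp).2 ⟨by omega, ?_⟩)
  have hlower := hg.lower (T q) (q.row - 1) (by omega) hTq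
  rw [Nat.sub_add_cancel (by omega)] at hlower
  rw [hcol]
  exact (hle.trans hlower).trans
    (hg.antitone_row lam.2 (by omega : (p.row : ℕ) ≤ q.row - 1) (by omega) hTq.le)

theorem Corresponds.lt_of_row_lt_of_neg (h : Corresponds T g) (hg : IsGelfandTsetlin lam.1 g)
    {p q : Box lam} (hcol : p.col = q.col) (hp : p.col < 0) (hpq : p.row < q.row) :
    T q < T p := by
  rw [Fin.lt_def] at hpq
  have hTp := (T p).2
  obtain ⟨hrow, hle⟩ := (Box.below_of_neg hp).1 ((h p _ hTp).1 (Nat.lt_succ_self _))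
  refine (h q (T p) hTp.le).2 ((Box.below_of_neg (hcol ▸ hp)).2 ⟨by omega, ?_⟩)
  rw [← hcol]
  exact (hg.antitone_row lam.2 (by omega : T p + 1 + p.row - u ≤ T p + q.row - u) (by omega)
    hTp.le).trans ((hg.upper (T p) _ (by omega) hTp).trans hle)

theorem Corresponds.card_entriesOfColNegOne_le (h : Corresponds T g)
    (hg : IsGelfandTsetlin lam.1 g) {p : Box lam} (hp : 0 < p.col) :
    #{x ∈ entriesOfColNegOne T | x ≤ T p} + p.row ≤ T p := by
  have hTp := (T p).2
  obtain ⟨hrow, hle⟩ := (Box.below_of_pos hp).1 ((h p (T p + 1) hTp).1 (Nat.lt_succ_self _))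
  have hmaps : Set.MapsTo (fun q : Box lam => (q.row : ℕ))
      ({q : Box lam | q.col = -1 ∧ T q ≤ T p} : Finset (Box lam))
      (Ioo (p.row + u - (T p + 1) : ℕ) u) := by
    intro q hq
    obtain ⟨hcol, hTq⟩ := (mem_filter.1 (mem_coe.1 hq)).2
    obtain ⟨-, hle'⟩ := (Box.below_of_neg (by omega : q.col < 0)).1
      ((h q (T p + 1) hTp).1 (Nat.lt_succ_of_le hTq))
    refine mem_coe.2 (mem_Ioo.2 ⟨?_, q.row.2⟩)
    by_contra! hcon
    have hanti := hg.antitone_row lam.2 (k := T p + 1) (i := T p + 1 + q.row - u) (j := p.row)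
      (by omega) hrow hTp
    omega
  have hcard := card_le_card_of_injOn _ hmaps fun q hq r hr hqr =>
    Box.ext_row_col (Fin.ext hqr) ((mem_filter.1 (mem_coe.1 hq)).2.1.trans
      (mem_filter.1 (mem_coe.1 hr)).2.1.symm)
  rw [Nat.card_Ioo] at hcard
  have himage : {x ∈ entriesOfColNegOne T | x ≤ T p} =
      ({q : Box lam | q.col = -1 ∧ T q ≤ T p} : Finset (Box lam)).image T := by
    rw [entriesOfColNegOne, filter_image, filter_filter]
  rw [himage]
  have hle_card := card_image_le (s := ({q : Box lam | q.col = -1 ∧ T q ≤ T p} :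
    Finset (Box lam))) (f := T)
  omega

theorem Corresponds.isRationalSemistandard (h : Corresponds T g)
    (hg : IsGelfandTsetlin lam.1 g) : IsRationalSemistandard T where
  row_pos p q hrow hp hpq := by
    by_contra! hlt
    have hq := (Box.below_of_pos (hp.trans hpq)).1 ((h q (T p) (T p).2.le).1 hlt)
    rw [← hrow] at hq
    exact lt_irrefl _ ((h p (T p) (T p).2.le).2
      ((Box.below_of_pos hp).2 ⟨hq.1, hpq.le.trans hq.2⟩))
  row_neg p q hrow hq hpq := by
    by_contra! hlt
    have hp := (Box.below_of_neg (hpq.trans hq)).1 ((h p (T q) (T q).2.le).1 hlt)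
    rw [hrow] at hp
    exact lt_irrefl _ ((h q (T q) (T q).2.le).2
      ((Box.below_of_neg hq).2 ⟨hp.1, hp.2.trans hpq.le⟩))
  col_pos _ _ hcol hp hpq := h.lt_of_row_lt_of_pos hg hcol hp hpq
  col_neg _ _ hcol hp hpq := h.lt_of_row_lt_of_neg hg hcol hp hpq
  compat p hp := by
    rw [orderEmbOfFin_le_iff]
    have hcard := card_filter_le_add_card_filter_compl (entriesOfColNegOne T) (T p)
    have hle := h.card_entriesOfColNegOne_le hg (p := p) (by omega)
    omega

end PatternToTableau

section TableauToPattern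

theorem IsRationalSemistandard.exists_row_of_pos (hT : IsRationalSemistandard T) {p : Box lam}
    {j : ℤ} (hj : 0 < j) (hle : j ≤ p.col) :
    ∃ q : Box lam, q.row = p.row ∧ q.col = j ∧ T q ≤ T p := by
  obtain ⟨q, hrow, rfl⟩ := Box.exists_of_pos (lam := lam) p.row hj
    (hle.trans (Box.le_of_pos (hj.trans_le hle)))
  refine ⟨q, hrow, rfl, ?_⟩
  rcases hle.lt_or_eq with hlt | heq
  · exact hT.row_pos q p hrow hj hlt
  · rw [Box.ext_row_col hrow heq]

theorem IsRationalSemistandard.exists_row_of_neg (hT : IsRationalSemistandard T) {p : Box lam}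
    {j : ℤ} (hj : j < 0) (hle : p.col ≤ j) :
    ∃ q : Box lam, q.row = p.row ∧ q.col = j ∧ T q ≤ T p := by
  obtain ⟨q, hrow, rfl⟩ := Box.exists_of_neg (lam := lam) p.row hj
    ((Box.le_of_neg (hle.trans_lt hj)).trans hle)
  refine ⟨q, hrow, rfl, ?_⟩
  rcases hle.lt_or_eq with hlt | heq
  · exact hT.row_neg p q hrow.symm hj hlt
  · rw [Box.ext_row_col hrow heq.symm]

theorem IsRationalSemistandard.exists_above (hT : IsRationalSemistandard T) {p : Box lam}
    (hp : 0 < p.col) {i : ℕ} (hi : i < p.row) :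
    ∃ q : Box lam, (q.row : ℕ) = i ∧ q.col = p.col ∧ T q < T p := by
  have hlt : (⟨i, hi.trans p.row.2⟩ : Fin u) < p.row := hi
  obtain ⟨q, hrow, hcol⟩ := Box.exists_of_pos _ hp ((Box.le_of_pos hp).trans (lam.2 hlt.le))
  exact ⟨q, congrArg Fin.val hrow, hcol, hT.col_pos q p hcol (hcol ▸ hp) (hrow ▸ hlt)⟩

theorem IsRationalSemistandard.exists_below (hT : IsRationalSemistandard T) {p : Box lam}
    (hp : p.col < 0) {i : ℕ} (hi : p.row < i) (hiu : i < u) :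
    ∃ q : Box lam, (q.row : ℕ) = i ∧ q.col = p.col ∧ T q < T p := by
  have hlt : p.row < (⟨i, hiu⟩ : Fin u) := hi
  obtain ⟨q, hrow, hcol⟩ := Box.exists_of_neg _ hp ((lam.2 hlt.le).trans (Box.le_of_neg hp))
  exact ⟨q, congrArg Fin.val hrow, hcol, hT.col_neg p q hcol.symm hp (hrow ▸ hlt)⟩

theorem IsRationalSemistandard.row_le (hT : IsRationalSemistandard T) {p : Box lam}
    (hp : 0 < p.col) : (p.row : ℕ) ≤ T p := by
  induction hi : (p.row : ℕ) generalizing p with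
  | zero => exact Nat.zero_le _
  | succ i ih =>
    obtain ⟨q, hrow, hcol, hlt⟩ := hT.exists_above hp (i := i) (by omega)
    have hle := ih (hcol ▸ hp) hrow
    rw [Fin.lt_def] at hlt
    omega

theorem IsRationalSemistandard.le_add_row (hT : IsRationalSemistandard T) {p : Box lam}
    (hp : p.col < 0) : u ≤ T p + 1 + p.row := by
  induction hi : u - p.row generalizing p with
  | zero => omega
  | succ i ih =>
    by_cases hu : p.row + 1 < u
    · obtain ⟨q, hrow, hcol, hlt⟩ := hT.exists_below hp (Nat.lt_succ_self _) hu
      have hle := ih (hcol ▸ hp) (by omega)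
      rw [Fin.lt_def] at hlt
      omega
    · omega

theorem IsRationalSemistandard.le_card_entriesOfColNegOne (hT : IsRationalSemistandard T)
    {q : Box lam} (hq : q.col < 0) {s : Fin u} (hs : T q ≤ s) :
    u ≤ #{x ∈ entriesOfColNegOne T | x ≤ s} + q.row := by
  let B : Finset (Box lam) := {r | r.col = -1 ∧ T r ≤ s}
  have himage : {x ∈ entriesOfColNegOne T | x ≤ s} = B.image T := by
    rw [entriesOfColNegOne, filter_image, filter_filter]
  have hinj : Set.InjOn T B := by
    intro r hr r' hr' heq
    have hcol : r.col = -1 := (mem_filter.1 (mem_coe.1 hr)).2.1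
    have hcol' : r'.col = -1 := (mem_filter.1 (mem_coe.1 hr')).2.1
    rcases lt_trichotomy r.row r'.row with hlt | hrow | hlt
    · exact absurd heq.symm (hT.col_neg r r' (by omega) (by omega) hlt).ne
    · exact Box.ext_row_col hrow (by omega)
    · exact absurd heq (hT.col_neg r' r (by omega) (by omega) hlt).ne
  have hrows : Ico (q.row : ℕ) u ⊆ B.image fun r => (r.row : ℕ) := by
    intro i hi
    obtain ⟨hqi, hiu⟩ := mem_Ico.1 hi
    obtain ⟨r, hrow, hcol, hle⟩ := hT.exists_row_of_neg (j := -1) (by omega)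
      (by omega : q.col ≤ -1)
    rcases hqi.eq_or_lt with rfl | hlt
    · exact mem_image.2 ⟨r, mem_filter.2 ⟨mem_univ _, hcol, hle.trans hs⟩, by rw [hrow]⟩
    · obtain ⟨r', hrow', hcol', hlt'⟩ := hT.exists_below (p := r) (by omega)
        (by rwa [hrow]) hiu
      exact mem_image.2 ⟨r', mem_filter.2 ⟨mem_univ _, hcol'.trans hcol,
        (hlt'.le.trans hle).trans hs⟩, hrow'⟩
  have hcard := (card_le_card hrows).trans card_image_le
  rw [Nat.card_Ico] at hcard
  rw [himage, card_image_of_injOn hinj]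
  omega

-- The compatibility of the columns `1` and `-1` enters only here.
theorem IsRationalSemistandard.not_pos_and_neg (hT : IsRationalSemistandard T) {p q : Box lam}
    {t : ℕ} (ht : t ≤ u) (hrow : (q.row : ℕ) + t = p.row + u) (hp : 0 < p.col) (hq : q.col < 0)
    (hTp : (T p : ℕ) < t) (hTq : (T q : ℕ) < t) : False := by
  obtain ⟨p₁, hrow₁, hcol₁, hle₁⟩ := hT.exists_row_of_pos (j := 1) one_pos hp
  let s : Fin u := ⟨t - 1, by omega⟩
  have hs : (s : ℕ) = t - 1 := rfl
  have hle_s : ∀ x : Fin u, (x : ℕ) < t → x ≤ s := fun x hx => Nat.le_sub_one_of_lt hx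
  have hcompat := (orderEmbOfFin_le_iff _ _ _).1 (hT.compat p₁ hcol₁)
  have hmono : #{x ∈ (entriesOfColNegOne T)ᶜ | x ≤ T p₁} ≤
      #{x ∈ (entriesOfColNegOne T)ᶜ | x ≤ s} :=
    card_le_card (monotone_filter_right _ fun x _ hx => (hx.trans hle₁).trans (hle_s _ hTp))
  have hcard := card_filter_le_add_card_filter_compl (entriesOfColNegOne T) s
  have hge := hT.le_card_entriesOfColNegOne hq (hle_s _ hTq)
  rw [hrow₁] at hcompat
  omega

/-- The number of boxes in the positive columns of row `i` with entry less than `t`. -/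
def posCount (T : Box lam → Fin u) (i t : ℕ) : ℕ :=
  #{p : Box lam | (p.row : ℕ) = i ∧ 0 < p.col ∧ (T p : ℕ) < t}

/-- The number of boxes in the negative columns of row `i` with entry less than `t`. -/
def negCount (T : Box lam → Fin u) (i t : ℕ) : ℕ :=
  #{p : Box lam | (p.row : ℕ) = i ∧ p.col < 0 ∧ (T p : ℕ) < t}

/-- The pattern of a rational tableau. The row `i` of the pattern's row `t` counts the boxes of
row `i` in the positive columns, and those of row `i + u - t` in the negative columns. -/
def patternOf (T : Box lam → Fin u) : ℕ → ℕ → ℤ := fun t i =>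
  if i < t ∧ t ≤ u then (posCount T i t : ℤ) - negCount T (i + u - t) t else 0

theorem IsRationalSemistandard.le_posCount (hT : IsRationalSemistandard T) {i t : ℕ} {j : ℤ}
    (hj : 0 < j) :
    j ≤ posCount T i t ↔ ∃ p : Box lam, (p.row : ℕ) = i ∧ p.col = j ∧ (T p : ℕ) < t := by
  have hmem : ∀ p : Box lam,
      p ∈ ({p | (p.row : ℕ) = i ∧ 0 < p.col ∧ (T p : ℕ) < t} : Finset (Box lam)) ↔
        (p.row : ℕ) = i ∧ 0 < p.col ∧ (T p : ℕ) < t := fun p => mem_filter_univ p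
  rw [posCount, le_card_iff_exists_eq (f := Box.col) _ _ _ hj]
  · simp only [hmem]
    exact exists_congr fun p =>
      ⟨fun h => ⟨h.1.1, h.2, h.1.2.2⟩, fun h => ⟨⟨h.1, h.2.1 ▸ hj, h.2.2⟩, h.2.1⟩⟩
  · intro p hp q hq hcol
    exact Box.ext_row_col (Fin.ext (((hmem p).1 hp).1.trans ((hmem q).1 hq).1.symm)) hcol
  · exact fun p hp => ((hmem p).1 hp).2.1
  · intro p hp k hk hle
    obtain ⟨hrow, -, hlt⟩ := (hmem p).1 hp
    obtain ⟨q, hrow', rfl, hle'⟩ := hT.exists_row_of_pos hk hle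
    exact ⟨q, (hmem q).2 ⟨hrow' ▸ hrow, hk, lt_of_le_of_lt hle' hlt⟩, rfl⟩

theorem IsRationalSemistandard.le_negCount (hT : IsRationalSemistandard T) {i t : ℕ} {j : ℤ}
    (hj : j < 0) :
    -j ≤ negCount T i t ↔ ∃ p : Box lam, (p.row : ℕ) = i ∧ p.col = j ∧ (T p : ℕ) < t := by
  have hmem : ∀ p : Box lam,
      p ∈ ({p | (p.row : ℕ) = i ∧ p.col < 0 ∧ (T p : ℕ) < t} : Finset (Box lam)) ↔
        (p.row : ℕ) = i ∧ p.col < 0 ∧ (T p : ℕ) < t := fun p => mem_filter_univ p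
  rw [negCount, le_card_iff_exists_eq (f := fun p => -p.col) _ _ _ (neg_pos.2 hj)]
  · simp only [hmem, neg_inj]
    exact exists_congr fun p =>
      ⟨fun h => ⟨h.1.1, h.2, h.1.2.2⟩, fun h => ⟨⟨h.1, h.2.1 ▸ hj, h.2.2⟩, h.2.1⟩⟩
  · intro p hp q hq hcol
    exact Box.ext_row_col (Fin.ext (((hmem p).1 hp).1.trans ((hmem q).1 hq).1.symm))
      (neg_inj.1 hcol)
  · exact fun p hp => neg_pos.2 ((hmem p).1 hp).2.1
  · intro p hp k hk hle
    obtain ⟨hrow, -, hlt⟩ := (hmem p).1 hp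
    obtain ⟨q, hrow', hcol, hle'⟩ := hT.exists_row_of_neg (p := p) (neg_neg_of_pos hk) (by omega)
    exact ⟨q, (hmem q).2 ⟨hrow' ▸ hrow, by omega, lt_of_le_of_lt hle' hlt⟩, by omega⟩

theorem IsRationalSemistandard.posCount_eq_zero_or (hT : IsRationalSemistandard T) {i t : ℕ}
    (ht : t ≤ u) : posCount T i t = 0 ∨ negCount T (i + u - t) t = 0 := by
  by_contra! hne
  obtain ⟨p, hp⟩ := card_ne_zero.1 hne.1
  obtain ⟨q, hq⟩ := card_ne_zero.1 hne.2
  rw [mem_filter_univ] at hp hq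
  exact hT.not_pos_and_neg ht (by omega) hp.2.1 hq.2.1 hp.2.2 hq.2.2

theorem IsRationalSemistandard.le_patternOf (hT : IsRationalSemistandard T) {i t : ℕ}
    (hi : i < t) (ht : t ≤ u) {j : ℤ} (hj : 0 < j) : j ≤ patternOf T t i ↔
      ∃ p : Box lam, (p.row : ℕ) = i ∧ p.col = j ∧ (T p : ℕ) < t := by
  have hzero := hT.posCount_eq_zero_or (i := i) ht
  rw [← hT.le_posCount hj, patternOf, if_pos ⟨hi, ht⟩]
  omega

theorem IsRationalSemistandard.patternOf_le (hT : IsRationalSemistandard T) {i t : ℕ}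
    (hi : i < t) (ht : t ≤ u) {j : ℤ} (hj : j < 0) : patternOf T t i ≤ j ↔
      ∃ p : Box lam, (p.row : ℕ) + t = i + u ∧ p.col = j ∧ (T p : ℕ) < t := by
  have hzero := hT.posCount_eq_zero_or (i := i) ht
  have hrow : ∀ p : Box lam, (p.row : ℕ) + t = i + u ↔ (p.row : ℕ) = i + u - t := fun p => by
    omega
  simp only [hrow]
  rw [← hT.le_negCount hj, patternOf, if_pos ⟨hi, ht⟩]
  omega

theorem IsRationalSemistandard.corresponds (hT : IsRationalSemistandard T) :
    Corresponds T (patternOf T) := by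
  intro p t ht
  have hp := p.row.2
  rcases p.col_cases with ⟨hpos, -⟩ | ⟨hneg, -⟩
  · rw [Box.below_of_pos hpos]
    constructor
    · intro hlt
      have hrow := (hT.row_le hpos).trans_lt hlt
      exact ⟨hrow, (hT.le_patternOf hrow ht hpos).2 ⟨p, rfl, rfl, hlt⟩⟩
    · rintro ⟨hrow, hle⟩
      obtain ⟨q, hrow', hcol, hlt⟩ := (hT.le_patternOf hrow ht hpos).1 hle
      rwa [← Box.ext_row_col (Fin.ext hrow') hcol]
  · rw [Box.below_of_neg hneg]
    constructor
    · intro hlt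
      have hrow := hT.le_add_row hneg
      exact ⟨by omega, (hT.patternOf_le (by omega) ht hneg).2 ⟨p, by omega, rfl, hlt⟩⟩
    · rintro ⟨hrow, hle⟩
      obtain ⟨q, hrow', hcol, hlt⟩ := (hT.patternOf_le (by omega) ht hneg).1 hle
      rwa [← Box.ext_row_col (Fin.ext (by omega)) hcol]

theorem IsRationalSemistandard.patternOf_top (hT : IsRationalSemistandard T) (i : Fin u) :
    patternOf T u i = lam.1 i := by
  have hpos : ∀ j, 0 < j → (j ≤ patternOf T u i ↔ j ≤ lam.1 i) := by
    intro j hj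
    rw [hT.le_patternOf i.2 le_rfl hj]
    constructor
    · rintro ⟨p, hrow, rfl, -⟩
      exact Fin.ext hrow ▸ Box.le_of_pos hj
    · intro hle
      obtain ⟨p, rfl, hcol⟩ := Box.exists_of_pos i hj hle
      exact ⟨p, rfl, hcol, (T p).2⟩
  have hneg : ∀ j < 0, (patternOf T u i ≤ j ↔ lam.1 i ≤ j) := by
    intro j hj
    rw [hT.patternOf_le i.2 le_rfl hj]
    constructor
    · rintro ⟨p, hrow, rfl, -⟩
      exact Fin.ext (Nat.add_right_cancel hrow) ▸ Box.le_of_neg hj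
    · intro hle
      obtain ⟨p, rfl, hcol⟩ := Box.exists_of_neg i hj hle
      exact ⟨p, rfl, hcol, (T p).2⟩
  exact le_antisymm
    (le_of_forall_pos_of_forall_neg (fun j hj => (hpos j hj).1) fun j hj => (hneg j hj).2)
    (le_of_forall_pos_of_forall_neg (fun j hj => (hpos j hj).2) fun j hj => (hneg j hj).1)

theorem IsRationalSemistandard.isGelfandTsetlin (hT : IsRationalSemistandard T) :
    IsGelfandTsetlin lam.1 (patternOf T) where
  top := hT.patternOf_top
  upper k i hi hk := by
    refine le_of_forall_pos_of_forall_neg (fun j hj hle => ?_) (fun j hj hle => ?_)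
    · rw [hT.le_patternOf (by omega) (by omega) hj] at hle ⊢
      obtain ⟨p, hrow, hcol, hlt⟩ := hle
      exact ⟨p, hrow, hcol, hlt.trans k.lt_succ_self⟩
    · rw [hT.patternOf_le (by omega) (by omega) hj] at hle ⊢
      obtain ⟨p, hrow, rfl, hlt⟩ := hle
      obtain ⟨q, hrow', hcol, hlt'⟩ := hT.exists_below hj (Nat.lt_succ_self p.row) (by omega)
      exact ⟨q, by omega, hcol, by rw [Fin.lt_def] at hlt'; omega⟩
  lower k i hi hk := by
    refine le_of_forall_pos_of_forall_neg (fun j hj hle => ?_) (fun j hj hle => ?_)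
    · rw [hT.le_patternOf (by omega) (by omega) hj] at hle ⊢
      obtain ⟨p, hrow, rfl, hlt⟩ := hle
      obtain ⟨q, hrow', hcol, hlt'⟩ := hT.exists_above hj (i := i) (by omega)
      exact ⟨q, hrow', hcol, by rw [Fin.lt_def] at hlt'; omega⟩
    · rw [hT.patternOf_le (by omega) (by omega) hj] at hle ⊢
      obtain ⟨p, hrow, hcol, hlt⟩ := hle
      exact ⟨p, by omega, hcol, hlt.trans k.lt_succ_self⟩
  outside k i h := if_neg (by omega)

theorem Corresponds.patternOf_eq (h : Corresponds T g) (hg : IsGelfandTsetlin lam.1 g)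
    (hT : IsRationalSemistandard T) : patternOf T = g := by
  funext t i
  by_cases hti : i < t ∧ t ≤ u
  · obtain ⟨hi, ht⟩ := hti
    have hpos : ∀ j, 0 < j → (j ≤ patternOf T t i ↔ j ≤ g t i) := fun j hj =>
      (hT.le_patternOf hi ht hj).trans (h.le_iff_of_pos hg hi ht hj).symm
    have hneg : ∀ j < 0, (patternOf T t i ≤ j ↔ g t i ≤ j) := fun j hj =>
      (hT.patternOf_le hi ht hj).trans (h.le_iff_of_neg hg hi ht hj).symm
    exact le_antisymm
      (le_of_forall_pos_of_forall_neg (fun j hj => (hpos j hj).1) fun j hj => (hneg j hj).2)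
      (le_of_forall_pos_of_forall_neg (fun j hj => (hpos j hj).2) fun j hj => (hneg j hj).1)
  · rw [hg.outside t i (by omega), patternOf, if_neg hti]

theorem IsRationalSemistandard.rowSum_patternOf (hT : IsRationalSemistandard T) {t : ℕ}
    (ht : t ≤ u) :
    rowSum (patternOf T) t =
      ∑ p : Box lam with (T p : ℕ) < t, if 0 < p.col then (1 : ℤ) else -1 := by
  have hpos : #{p : Box lam | (T p : ℕ) < t ∧ 0 < p.col} = ∑ i ∈ range t, posCount T i t := by
    rw [card_eq_sum_card_fiberwise (f := fun p => (p.row : ℕ)) (t := range t)]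
    · refine sum_congr rfl fun i _ => congrArg card ?_
      rw [filter_filter]
      exact filter_congr fun p _ => by tauto
    · intro p hp
      obtain ⟨hlt, hcol⟩ := (mem_filter_univ p).1 hp
      exact mem_coe.2 (mem_range.2 ((hT.row_le hcol).trans_lt hlt))
  have hneg : #{p : Box lam | (T p : ℕ) < t ∧ ¬ 0 < p.col} =
      ∑ i ∈ range t, negCount T (i + u - t) t := by
    have hcol : ∀ p : Box lam, ¬ 0 < p.col ↔ p.col < 0 := fun p => by
      have hp := p.col_cases
      omega
    simp only [hcol]
    rw [card_eq_sum_card_fiberwise (f := fun p => (t + p.row - u : ℕ)) (t := range t)]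
    · refine sum_congr rfl fun i hi => congrArg card ?_
      rw [filter_filter]
      refine filter_congr fun p _ => ?_
      have hrow := hT.le_add_row (p := p)
      rw [mem_range] at hi
      omega
    · intro p hp
      have hlt := ((mem_filter_univ p).1 hp).1
      have hrow := p.row.2
      refine mem_coe.2 (mem_range.2 ?_)
      change t + p.row - u < t
      omega
  rw [sum_ite, sum_const, sum_const, filter_filter, filter_filter, hpos, hneg, nsmul_eq_mul,
    nsmul_eq_mul, mul_one, mul_neg_one, ← sub_eq_add_neg, Nat.cast_sum, Nat.cast_sum,
    ← sum_sub_distrib]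
  exact sum_congr rfl fun i hi => if_pos ⟨mem_range.1 hi, ht⟩

theorem IsRationalSemistandard.rationalWt_eq (hT : IsRationalSemistandard T) :
    rationalWt T = Finsupp.equivFunOnFinite.symm (patternWt u (patternOf T)) := by
  ext a
  rw [rationalWt, Finsupp.finsetSum_apply, Finsupp.equivFunOnFinite_symm_apply_apply, patternWt,
    hT.rowSum_patternOf a.2, hT.rowSum_patternOf a.2.le, sum_filter, sum_filter,
    ← sum_sub_distrib]
  refine sum_congr rfl fun p _ => ?_
  rw [Finsupp.single_apply]
  simp only [Fin.ext_iff, Nat.lt_succ_iff]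
  split_ifs <;> omega

end TableauToPattern

end Box

/-- The bijection between rational tableaux and Gelfand–Tsetlin patterns. -/
def rationalTableauEquiv {u : ℕ} (lam : GenPartition u) :
    RationalTableau lam ≃ GelfandTsetlinPattern lam.1 :=
  Equiv.ofBijective (fun T => ⟨patternOf T.1, T.2.isGelfandTsetlin⟩)
    ⟨fun T T' h => Subtype.ext <| T.2.corresponds.unique <| by
      have hpattern : patternOf T.1 = patternOf T'.1 := congrArg Subtype.val h
      rw [hpattern]
      exact T'.2.corresponds,
    fun g => by
      obtain ⟨T, hT⟩ := g.2.exists_corresponds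
      have hss := hT.isRationalSemistandard g.2
      exact ⟨⟨T, hss⟩, Subtype.ext (hT.patternOf_eq g.2 hss)⟩⟩

instance {u : ℕ} (lam : GenPartition u) : Fintype (GelfandTsetlinPattern lam.1) :=
  open Classical in Fintype.ofEquiv _ (rationalTableauEquiv lam)

theorem rationalSchur_eq_sum_pattern {u : ℕ} (lam : GenPartition u) :
    rationalSchur lam = ∑ T : GelfandTsetlinPattern lam.1, monomial (patternWt u T.1) := by
  classical
  rw [rationalSchur]
  refine Fintype.sum_equiv (rationalTableauEquiv lam) _ _ fun T => ?_
  rw [T.2.rationalWt_eq]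
  rfl

theorem alternant_staircase_mul_rationalSchur {u : ℕ} (lam : GenPartition u) :
    alternant (staircase u) * rationalSchur lam = alternant (lam.1 + staircase u) := by
  rw [rationalSchur_eq_sum_pattern, alternant_staircase_mul_sum_pattern lam.2]

theorem schurCoeff_rationalSchur {u : ℕ} (κ lam : GenPartition u) :
    schurCoeff κ (rationalSchur lam) = if lam = κ then 1 else 0 := by
  rw [schurCoeff_of_alternant_mul_eq_sum {()} (fun _ => lam.1) (fun _ _ => lam.2)
    (by rw [alternant_staircase_mul_rationalSchur, sum_singleton]), filter_singleton]
  simp only [Subtype.ext_iff]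
  split_ifs <;> rfl

theorem eq_sum_rationalSchur {u : ℕ} {J : Type*} (S : Finset J) (f : J → GenPartition u)
    {P : Laurent u}
    (hP : alternant (staircase u) * P = ∑ j ∈ S, alternant ((f j).1 + staircase u)) :
    P = ∑ j ∈ S, rationalSchur (f j) := by
  apply mul_left_cancel₀ (alternant_staircase_ne_zero u)
  rw [hP, mul_sum]
  exact sum_congr rfl fun j _ => (alternant_staircase_mul_rationalSchur _).symm

theorem exists_rationalSchur_mul {u : ℕ} (τ κ : GenPartition u) :
    ∃ n : GenPartition u →₀ ℕ,
      rationalSchur τ * rationalSchur κ = n.sum fun ν m => m • rationalSchur ν := by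
  classical
  have hmul := alternant_mul_sum_pattern (κ := κ.1) τ.2
  rw [← rationalSchur_eq_sum_pattern, ← alternant_staircase_mul_rationalSchur, mul_assoc,
    ← sum_subtype_eq_sum_filter] at hmul
  let f : {T : GelfandTsetlinPattern κ.1 // IsDominantOver τ.1 T.1} → GenPartition u :=
    fun T => ⟨_, T.2.antitone⟩
  refine ⟨∑ T ∈ Finset.subtype _ univ, Finsupp.single (f T) 1, ?_⟩
  rw [eq_sum_rationalSchur _ f hmul, ← Finsupp.sum_finsetSum_index]
  · refine sum_congr rfl fun T _ => ?_
    rw [Finsupp.sum_single_index (by rw [zero_smul]), one_smul]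
  · exact fun _ => zero_smul _ _
  · exact fun _ _ _ => add_smul _ _ _

/-! ### The Pieri rules -/

/-- A step removes a vertical strip or adds a horizontal strip, of a given size. -/
inductive StepKind : Type
  | vert (r : ℕ)
  | horiz (r : ℕ)

/-- `κ'` arises from `κ` by a step of the given kind. -/
def IsStep {u : ℕ} : StepKind → (Fin u → ℤ) → (Fin u → ℤ) → Prop
  | .vert r, κ, κ' => (∀ i, κ' i ≤ κ i ∧ κ i ≤ κ' i + 1) ∧ Antitone κ' ∧ ∑ i, κ i = ∑ i, κ' i + r
  | .horiz r, κ, κ' => (∀ i, κ i ≤ κ' i) ∧ (∀ i j : Fin u, (i : ℕ) + 1 = j → κ' j ≤ κ i) ∧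
      ∑ i, κ' i = ∑ i, κ i + r

/-- The displacements of a step: the steps from `κ` without the interlacing conditions lead to
the vectors `κ + d`, where `d` is a displacement. -/
def StepKind.displacements (u : ℕ) : StepKind → Finset (Fin u → ℤ)
  | .vert r => {d ∈ Fintype.piFinset fun _ => Icc (-1) 0 | ∑ i, d i = -(r : ℤ)}
  | .horiz r => {d ∈ Fintype.piFinset fun _ => Icc 0 (r : ℤ) | ∑ i, d i = (r : ℤ)}

/-- The symmetric Laurent polynomial of a step: the elementary symmetric polynomial `e_r(y⁻¹)` for
a vertical strip and the complete one `h_r(y)` for a horizontal strip. -/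
def StepKind.poly (u : ℕ) (s : StepKind) : Laurent u := ∑ d ∈ s.displacements u, monomial d

open Classical in
/-- The vectors that arise from `κ` by a step of the given kind. -/
def StepKind.successors {u : ℕ} (s : StepKind) (κ : Fin u → ℤ) : Finset (Fin u → ℤ) :=
  {κ' ∈ (s.displacements u).map (addLeftEmbedding κ) | IsStep s κ κ'}

section Pieri

variable {u r : ℕ} {s : StepKind} {κ κ' d : Fin u → ℤ}

theorem mem_displacements_vert : d ∈ (StepKind.vert r).displacements u ↔
    (∀ i, -1 ≤ d i ∧ d i ≤ 0) ∧ ∑ i, d i = -(r : ℤ) := by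
  simp only [StepKind.displacements, mem_filter, Fintype.mem_piFinset, mem_Icc]

theorem mem_displacements_horiz : d ∈ (StepKind.horiz r).displacements u ↔
    (∀ i, 0 ≤ d i) ∧ ∑ i, d i = (r : ℤ) := by
  simp only [StepKind.displacements, mem_filter, Fintype.mem_piFinset, mem_Icc]
  refine ⟨fun h => ⟨fun i => (h.1 i).1, h.2⟩, fun h => ⟨fun i => ⟨h.1 i, ?_⟩, h.2⟩⟩
  rw [← h.2]
  exact single_le_sum (fun i _ => h.1 i) (mem_univ i)

theorem comp_mem_displacements (hd : d ∈ s.displacements u) (σ : Perm (Fin u)) :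
    d ∘ σ ∈ s.displacements u := by
  have hsum : ∑ i, (d ∘ σ) i = ∑ i, d i := Equiv.sum_comp σ d
  cases s with
  | vert r =>
    rw [mem_displacements_vert] at hd ⊢
    exact ⟨fun i => hd.1 _, hsum.trans hd.2⟩
  | horiz r =>
    rw [mem_displacements_horiz] at hd ⊢
    exact ⟨fun i => hd.1 _, hsum.trans hd.2⟩

theorem alternant_mul_poly (s : StepKind) (α : Fin u → ℤ) :
    alternant α * s.poly u = ∑ d ∈ s.displacements u, alternant (α + d) := by
  refine alternant_mul_sum_monomial (s.displacements u) id (fun σ => ?_) α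
  refine sum_nbij' (fun d => d ∘ σ) (fun d => d ∘ ⇑σ⁻¹) (fun _ hd => comp_mem_displacements hd σ)
    (fun _ hd => comp_mem_displacements hd σ⁻¹) (fun d _ => ?_) (fun d _ => ?_) fun _ _ => rfl
  · funext i
    exact congrArg d (σ.apply_symm_apply i)
  · funext i
    exact congrArg d (σ.symm_apply_apply i)

theorem IsStep.antitone (h : IsStep s κ κ') : Antitone κ' := by
  cases s with
  | vert r => exact h.2.1
  | horiz r => exact antitone_of_succ_le fun k hk =>
      (h.2.1 ⟨k, by omega⟩ ⟨k + 1, hk⟩ rfl).trans (h.1 _)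

theorem IsStep.sub_mem_displacements (h : IsStep s κ κ') : κ' - κ ∈ s.displacements u := by
  cases s with
  | vert r =>
    obtain ⟨hle, -, hsum⟩ := h
    rw [mem_displacements_vert]
    simp only [Pi.sub_apply, sum_sub_distrib]
    exact ⟨fun i => by have hi := hle i; omega, by omega⟩
  | horiz r =>
    obtain ⟨hle, -, hsum⟩ := h
    rw [mem_displacements_horiz]
    simp only [Pi.sub_apply, sum_sub_distrib]
    exact ⟨fun i => sub_nonneg.2 (hle i), by omega⟩

theorem mem_successors : κ' ∈ s.successors κ ↔ IsStep s κ κ' := by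
  classical
  rw [StepKind.successors, mem_filter, and_iff_right_iff_imp]
  exact fun h => mem_map.2 ⟨_, h.sub_mem_displacements, add_sub_cancel κ κ'⟩

theorem alternant_eq_zero_of_not_isStep_vert (hκ : Antitone κ)
    (hd : d ∈ (StepKind.vert r).displacements u) (h : ¬IsStep (.vert r) κ (κ + d)) :
    alternant (κ + staircase u + d) = 0 := by
  rw [mem_displacements_vert] at hd
  have hanti : ¬Antitone (κ + d) := by
    refine fun hanti => h ⟨fun i => ?_, hanti, ?_⟩
    · have hi := hd.1 i
      rw [Pi.add_apply]
      omega
    · simp only [Pi.add_apply, sum_add_distrib]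
      omega
  obtain ⟨k, hk, hlt⟩ : ∃ (k : ℕ) (hk : k + 1 < u),
      (κ + d) ⟨k, by omega⟩ < (κ + d) ⟨k + 1, hk⟩ := by
    by_contra! hle
    exact hanti (antitone_of_succ_le hle)
  have hκk := hκ (Fin.mk_le_mk.2 k.le_succ : (⟨k, by omega⟩ : Fin u) ≤ ⟨k + 1, hk⟩)
  have hdk := hd.1 ⟨k, by omega⟩
  have hdk' := hd.1 ⟨k + 1, hk⟩
  simp only [Pi.add_apply] at hlt
  refine alternant_eq_zero (i := ⟨k, by omega⟩) (j := ⟨k + 1, hk⟩)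
    (Fin.ne_of_lt (Fin.mk_lt_mk.2 k.lt_succ_self)) ?_
  simp only [Pi.add_apply, staircase]
  omega

end Pieri

section Reflection

variable {ι : Type*} [DecidableEq ι] (α : ι → ℤ) (i j : ι) (d : ι → ℤ)

/-- The displacement that leads from `α` to the point `α + d` with its coordinates `i` and `j`
interchanged. -/
def reflect : ι → ℤ := (α + d) ∘ swap i j - α

theorem add_reflect : α + reflect α i j d = (α + d) ∘ swap i j := add_sub_cancel _ _

theorem reflect_reflect : reflect α i j (reflect α i j d) = d := by
  rw [reflect, add_reflect, Function.comp_assoc, ← Perm.coe_mul, swap_mul_self, Perm.coe_one,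
    Function.comp_id, add_sub_cancel_left]

theorem reflect_left : reflect α i j d i = α j + d j - α i := by
  rw [reflect, Pi.sub_apply, Function.comp_apply, swap_apply_left, Pi.add_apply]

theorem reflect_right : reflect α i j d j = α i + d i - α j := by
  rw [reflect, Pi.sub_apply, Function.comp_apply, swap_apply_right, Pi.add_apply]

variable {i j} in
theorem reflect_of_ne {k : ι} (hi : k ≠ i) (hj : k ≠ j) : reflect α i j d k = d k := by
  rw [reflect, Pi.sub_apply, Function.comp_apply, swap_apply_of_ne_of_ne hi hj, Pi.add_apply,
    add_sub_cancel_left]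

theorem sum_reflect [Fintype ι] : ∑ k, reflect α i j d k = ∑ k, d k := by
  simp only [reflect, Pi.sub_apply, sum_sub_distrib, Function.comp_apply]
  rw [Equiv.sum_comp (swap i j) (α + d)]
  simp only [Pi.add_apply, sum_add_distrib, add_sub_cancel_left]

end Reflection

section HorizontalStrip

variable {u r : ℕ} {κ d : Fin u → ℤ} {i j : Fin u}

/-- The displacement `d` moves row `j` beyond the row `i` above it, and no later row beyond the one
above. -/
structure IsLastOvershoot (κ d : Fin u → ℤ) (i j : Fin u) : Prop where
  adjacent : (i : ℕ) + 1 = j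
  lt : κ i < κ j + d j
  last : ∀ i' j' : Fin u, (i' : ℕ) + 1 = j' → j < j' → κ j' + d j' ≤ κ i'

theorem IsLastOvershoot.ne (h : IsLastOvershoot κ d i j) : i ≠ j := by
  rintro rfl
  exact absurd h.adjacent (by omega)

theorem IsLastOvershoot.unique {i' j' : Fin u} (h : IsLastOvershoot κ d i j)
    (h' : IsLastOvershoot κ d i' j') : i = i' ∧ j = j' := by
  obtain rfl : j = j' := by
    rcases lt_trichotomy j j' with hlt | heq | hlt
    · exact absurd h'.lt (h.last i' j' h'.adjacent hlt).not_gt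
    · exact heq
    · exact absurd h.lt (h'.last i j h.adjacent hlt).not_gt
  exact ⟨Fin.ext (Nat.succ_injective (h.adjacent.trans h'.adjacent.symm)), rfl⟩

theorem IsLastOvershoot.not_isStep (h : IsLastOvershoot κ d i j) :
    ¬IsStep (.horiz r) κ (κ + d) := fun hstep =>
  h.lt.not_ge (hstep.2.1 i j h.adjacent)

theorem exists_isLastOvershoot (hd : d ∈ (StepKind.horiz r).displacements u)
    (h : ¬IsStep (.horiz r) κ (κ + d)) : ∃ i j, IsLastOvershoot κ d i j := by
  classical
  rw [mem_displacements_horiz] at hd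
  let S : Finset (Fin u) := {j | ∃ i : Fin u, (i : ℕ) + 1 = j ∧ κ i < κ j + d j}
  have hS : S.Nonempty := by
    by_contra! hempty
    refine h ⟨fun i => le_add_of_nonneg_right (hd.1 i), fun i j hij => ?_, ?_⟩
    · by_contra! hlt
      exact notMem_empty j (hempty ▸ mem_filter.2 ⟨mem_univ _, i, hij, hlt⟩)
    · simp only [Pi.add_apply, sum_add_distrib, hd.2]
  obtain ⟨i, hij, hlt⟩ := (mem_filter.1 (S.max'_mem hS)).2
  refine ⟨i, S.max' hS, hij, hlt, fun i' j' hij' hj' => ?_⟩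
  by_contra! hlt'
  exact (S.le_max' j' (mem_filter.2 ⟨mem_univ _, i', hij', hlt'⟩)).not_gt hj'

theorem IsLastOvershoot.reflect_mem_displacements (h : IsLastOvershoot κ d i j)
    (hκ : Antitone κ) (hd : d ∈ (StepKind.horiz r).displacements u) :
    reflect (κ + staircase u) i j d ∈ (StepKind.horiz r).displacements u := by
  rw [mem_displacements_horiz] at hd ⊢
  refine ⟨fun k => ?_, (sum_reflect _ _ _ _).trans hd.2⟩
  have hadj := h.adjacent
  have hlt := h.lt
  by_cases hki : k = i
  · rw [hki, reflect_left]
    simp only [Pi.add_apply, staircase]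
    omega
  by_cases hkj : k = j
  · have hκij := hκ (Fin.le_def.2 (by omega) : i ≤ j)
    have hdi := hd.1 i
    rw [hkj, reflect_right]
    simp only [Pi.add_apply, staircase]
    omega
  · rw [reflect_of_ne _ _ hki hkj]
    exact hd.1 k

theorem IsLastOvershoot.reflect (h : IsLastOvershoot κ d i j) (hdi : 0 ≤ d i) :
    IsLastOvershoot κ (reflect (κ + staircase u) i j d) i j := by
  have hadj := h.adjacent
  refine ⟨hadj, ?_, fun i' j' hij' hj' => ?_⟩
  · rw [reflect_right]
    simp only [Pi.add_apply, staircase]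
    omega
  · rw [reflect_of_ne _ _ (Fin.ne_of_gt ((Fin.lt_def.2 (by omega)).trans hj')) hj'.ne']
    exact h.last i' j' hij' hj'

open Classical in
theorem sum_alternant_not_isStep_horiz (r : ℕ) (hκ : Antitone κ) :
    ∑ d ∈ (StepKind.horiz r).displacements u with ¬IsStep (.horiz r) κ (κ + d),
      alternant (κ + staircase u + d) = 0 := by
  set S := {d ∈ (StepKind.horiz r).displacements u | ¬IsStep (.horiz r) κ (κ + d)}
  have hex : ∀ d ∈ S, ∃ p : Fin u × Fin u, IsLastOvershoot κ d p.1 p.2 := fun d hd => by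
    obtain ⟨hd, hstep⟩ := mem_filter.1 hd
    obtain ⟨i, j, h⟩ := exists_isLastOvershoot hd hstep
    exact ⟨(i, j), h⟩
  choose p hp using hex
  let flip (d) (hd : d ∈ S) : Fin u → ℤ := reflect (κ + staircase u) (p d hd).1 (p d hd).2 d
  have hflip : ∀ d hd, IsLastOvershoot κ (flip d hd) (p d hd).1 (p d hd).2 := fun d hd =>
    (hp d hd).reflect ((mem_displacements_horiz.1 (mem_filter.1 hd).1).1 _)
  have hmem : ∀ d hd, flip d hd ∈ S := fun d hd => mem_filter.2
    ⟨(hp d hd).reflect_mem_displacements hκ (mem_filter.1 hd).1, (hflip d hd).not_isStep⟩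
  have hneg : ∀ d hd, alternant (κ + staircase u + flip d hd) =
      -alternant (κ + staircase u + d) := fun d hd => by
    rw [add_reflect, alternant_comp_swap _ (hp d hd).ne]
  refine sum_involution flip (fun d hd => ?_)
    (fun d hd hne heq => hne (eq_zero_of_eq_neg_self ?_)) hmem (fun d hd => ?_)
  · rw [hneg, add_neg_cancel]
  · rw [← hneg d hd, heq]
  · obtain ⟨hi, hj⟩ := (hflip d hd).unique (hp _ (hmem d hd))
    change SemiInf.reflect _ (p (flip d hd) _).1 (p (flip d hd) _).2 (reflect _ _ _ d) = d
    rw [← hi, ← hj, reflect_reflect]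

end HorizontalStrip

theorem alternant_mul_poly_of_antitone {u : ℕ} (s : StepKind) {κ : Fin u → ℤ} (hκ : Antitone κ) :
    alternant (κ + staircase u) * s.poly u =
      ∑ κ' ∈ s.successors κ, alternant (κ' + staircase u) := by
  classical
  have hzero : ∑ d ∈ s.displacements u with ¬IsStep s κ (κ + d),
      alternant (κ + staircase u + d) = 0 := by
    cases s with
    | vert r =>
      exact sum_eq_zero fun d hd => alternant_eq_zero_of_not_isStep_vert hκ (mem_filter.1 hd).1
        (mem_filter.1 hd).2
    | horiz r => exact sum_alternant_not_isStep_horiz r hκ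
  rw [alternant_mul_poly, ← sum_filter_add_sum_filter_not _ fun d => IsStep s κ (κ + d), hzero,
    add_zero, StepKind.successors, filter_map, sum_map]
  simp only [addLeftEmbedding_apply, add_right_comm κ (staircase u)]
  rfl

/-! ### Chains of generalized partitions -/

/-- The number of cells of the strip of a step. -/
def StepKind.size : StepKind → ℕ
  | .vert r => r
  | .horiz r => r

section IsStep

variable {u r : ℕ} {s : StepKind} {κ κ' : Fin u → ℤ}

theorem IsStep.eq_of_size_eq_zero (h : IsStep s κ κ') (hs : s.size = 0) : κ' = κ := by
  cases s with
  | vert r =>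
    obtain ⟨hle, -, hsum⟩ := h
    replace hs : r = 0 := hs
    rw [hs, Nat.cast_zero, add_zero] at hsum
    exact funext fun i => (sum_eq_sum_iff_of_le fun i _ => (hle i).1).1 hsum.symm i (mem_univ i)
  | horiz r =>
    obtain ⟨hle, -, hsum⟩ := h
    replace hs : r = 0 := hs
    rw [hs, Nat.cast_zero, add_zero] at hsum
    exact funext fun i =>
      ((sum_eq_sum_iff_of_le fun i _ => hle i).1 hsum.symm i (mem_univ i)).symm

theorem isStep_self (hs : s.size = 0) (hκ : Antitone κ) : IsStep s κ κ := by
  cases s with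
  | vert r =>
    replace hs : r = 0 := hs
    exact ⟨fun i => ⟨le_rfl, by omega⟩, hκ, by rw [hs, Nat.cast_zero, add_zero]⟩
  | horiz r =>
    replace hs : r = 0 := hs
    exact ⟨fun i => le_rfl, fun i j hij => hκ (Fin.le_def.2 (by omega)),
      by rw [hs, Nat.cast_zero, add_zero]⟩

/-- The vector `κ* = (-κ_u, …, -κ_1)`. -/
def dual (κ : Fin u → ℤ) : Fin u → ℤ := fun i => -κ i.rev

theorem dual_dual (κ : Fin u → ℤ) : dual (dual κ) = κ := by
  funext i
  rw [dual, dual, neg_neg, Fin.rev_rev]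

theorem sum_dual (κ : Fin u → ℤ) : ∑ i, dual κ i = -∑ i, κ i := by
  simp only [dual, sum_neg_distrib]
  exact congrArg Neg.neg (Equiv.sum_comp Fin.revPerm κ)

theorem antitone_dual : Antitone (dual κ) ↔ Antitone κ := by
  refine ⟨fun h i j hij => ?_, fun h i j hij => neg_le_neg (h (Fin.rev_le_rev.2 hij))⟩
  have hrev := h (Fin.rev_le_rev.2 hij)
  rwa [dual, dual, Fin.rev_rev, Fin.rev_rev, neg_le_neg_iff] at hrev

theorem isStep_vert_dual : IsStep (.vert r) (dual κ) (dual κ') ↔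
    (∀ i, κ i ≤ κ' i ∧ κ' i ≤ κ i + 1) ∧ Antitone κ' ∧ ∑ i, κ' i = ∑ i, κ i + r := by
  rw [IsStep, antitone_dual, sum_dual, sum_dual, Fin.rev_surjective.forall]
  simp only [dual, Fin.rev_rev]
  refine and_congr (forall_congr' fun i => ?_) (and_congr_right fun _ => ?_) <;> omega

theorem isStep_horiz_dual : IsStep (.horiz r) (dual κ) (dual κ') ↔
    (∀ i, κ' i ≤ κ i) ∧ (∀ i j : Fin u, (i : ℕ) + 1 = j → κ j ≤ κ' i) ∧
      ∑ i, κ i = ∑ i, κ' i + r := by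
  rw [IsStep, sum_dual, sum_dual]
  refine and_congr ?_ (and_congr ⟨fun h i j hij => ?_, fun h i j hij => neg_le_neg (h _ _ ?_)⟩ ?_)
  · rw [Fin.rev_surjective.forall]
    simp only [dual, Fin.rev_rev, neg_le_neg_iff]
  · have hrev := h j.rev i.rev (by rw [Fin.val_rev, Fin.val_rev]; omega)
    rwa [dual, dual, Fin.rev_rev, Fin.rev_rev, neg_le_neg_iff] at hrev
  · rw [Fin.val_rev, Fin.val_rev]
    omega
  · omega

end IsStep

/-- Chains of `N` steps of the kinds `s 0, …, s (N - 1)`, starting at `0`; they are extended by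
constants. -/
structure IsChain {u : ℕ} (s : ℕ → StepKind) (N : ℕ) (α : ℕ → Fin u → ℤ) : Prop where
  zero : α 0 = 0
  step : ∀ n < N, IsStep (s n) (α n) (α (n + 1))
  const : ∀ n, N ≤ n → α n = α N

/-- The chain that follows `α` up to the place `N` and is equal to `κ` from then on. -/
def extendChain {X : Type*} (N : ℕ) (α : ℕ → X) (κ : X) : ℕ → X := fun n => if n ≤ N then α n else κ

/-- The chains of `N` steps of the kinds `s 0, …, s (N - 1)`. -/
def chains {u : ℕ} (s : ℕ → StepKind) : ℕ → Finset (ℕ → Fin u → ℤ)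
  | 0 => {0}
  | N + 1 => open Classical in
      ((chains s N).sigma fun α => (s N).successors (α N)).image fun x => extendChain N x.1 x.2

section Chain

variable {X : Type*} {u : ℕ} {s : ℕ → StepKind} {N : ℕ} {α : ℕ → Fin u → ℤ} {κ : Fin u → ℤ}

theorem extendChain_of_le {n : ℕ} (hn : n ≤ N) (α : ℕ → X) (x : X) :
    extendChain N α x n = α n :=
  if_pos hn

theorem extendChain_of_lt {n : ℕ} (hn : N < n) (α : ℕ → X) (x : X) : extendChain N α x n = x :=
  if_neg hn.not_ge

theorem IsChain.antitone (h : IsChain s N α) : Antitone (α N) := by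
  rcases N with _ | N
  · rw [h.zero]
    exact antitone_const
  · exact (h.step N (Nat.lt_succ_self N)).antitone

theorem isChain_iff_forall_isStep (hs : ∀ n, N ≤ n → (s n).size = 0) :
    IsChain s N α ↔ α 0 = 0 ∧ ∀ n, IsStep (s n) (α n) (α (n + 1)) := by
  refine ⟨fun h => ⟨h.zero, fun n => ?_⟩, fun h => ⟨h.1, fun n _ => h.2 n, fun n hn => ?_⟩⟩
  · rcases lt_or_ge n N with hn | hn
    · exact h.step n hn
    · rw [h.const (n + 1) (Nat.le_succ_of_le hn), h.const n hn]
      exact isStep_self (hs n hn) h.antitone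
  · induction n, hn using Nat.le_induction with
    | base => rfl
    | succ n hn ih => rw [(h.2 n).eq_of_size_eq_zero (hs n hn), ih]

theorem IsChain.monotone_of_horiz {c : ℕ → ℕ} (h : IsChain (fun n => .horiz (c n)) N α) :
    Monotone α := by
  refine monotone_nat_of_le_succ fun n => ?_
  rcases lt_or_ge n N with hn | hn
  · exact (h.step n hn).1
  · rw [h.const n hn, h.const (n + 1) (Nat.le_succ_of_le hn)]

theorem IsChain.antitone_of_vert {c : ℕ → ℕ} (h : IsChain (fun n => .vert (c n)) N α) :
    Antitone α := by
  refine antitone_nat_of_succ_le fun n => ?_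
  rcases lt_or_ge n N with hn | hn
  · exact fun i => ((h.step n hn).1 i).1
  · rw [h.const n hn, h.const (n + 1) (Nat.le_succ_of_le hn)]

theorem isChain_zero_iff : IsChain s 0 α ↔ α = 0 := by
  constructor
  · intro h
    funext n
    rw [h.const n (Nat.zero_le n), h.zero]
    rfl
  · rintro rfl
    exact ⟨rfl, fun n hn => absurd hn (Nat.not_lt_zero n), fun _ _ => rfl⟩

theorem IsChain.extend (h : IsChain s N α) (hκ : IsStep (s N) (α N) κ) :
    IsChain s (N + 1) (extendChain N α κ) where
  zero := by rw [extendChain_of_le (Nat.zero_le N), h.zero]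
  step n hn := by
    rw [extendChain_of_le (Nat.le_of_lt_succ hn)]
    rcases Nat.lt_succ_iff_lt_or_eq.1 hn with hlt | rfl
    · rw [extendChain_of_le (Nat.succ_le_of_lt hlt)]
      exact h.step n hlt
    · rwa [extendChain_of_lt (Nat.lt_succ_self n)]
  const n hn := by
    rw [extendChain_of_lt (Nat.lt_of_succ_le hn), extendChain_of_lt (Nat.lt_succ_self N)]

theorem IsChain.truncate (h : IsChain s (N + 1) α) : IsChain s N (extendChain N α (α N)) where
  zero := by rw [extendChain_of_le (Nat.zero_le N), h.zero]
  step n hn := by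
    rw [extendChain_of_le hn.le, extendChain_of_le (Nat.succ_le_of_lt hn)]
    exact h.step n (Nat.lt_succ_of_lt hn)
  const n hn := by
    rw [extendChain_of_le le_rfl]
    rcases hn.eq_or_lt with rfl | hlt
    · exact extendChain_of_le le_rfl _ _
    · exact extendChain_of_lt hlt _ _

theorem extendChain_injOn : Set.InjOn
    (fun x : Σ _ : ℕ → Fin u → ℤ, Fin u → ℤ => extendChain N x.1 x.2) {x | IsChain s N x.1} := by
  rintro ⟨α, κ⟩ hα ⟨α', κ'⟩ hα' heq
  replace hα : IsChain s N α := hα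
  replace hα' : IsChain s N α' := hα'
  replace heq : extendChain N α κ = extendChain N α' κ' := heq
  have hle : ∀ n ≤ N, α n = α' n := fun n hn => by
    have hn' := congrFun heq n
    rwa [extendChain_of_le hn, extendChain_of_le hn] at hn'
  have hκ := congrFun heq (N + 1)
  rw [extendChain_of_lt (Nat.lt_succ_self N), extendChain_of_lt (Nat.lt_succ_self N)] at hκ
  obtain rfl : α = α' := by
    funext n
    rcases le_total n N with hn | hn
    · exact hle n hn
    · rw [hα.const n hn, hα'.const n hn, hle N le_rfl]
  rw [Sigma.mk.injEq]
  exact ⟨rfl, heq_of_eq hκ⟩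

theorem mem_chains : α ∈ chains s N ↔ IsChain s N α := by
  classical
  induction N generalizing α with
  | zero => rw [chains, mem_singleton, isChain_zero_iff]
  | succ N ih =>
    rw [chains, mem_image]
    constructor
    · rintro ⟨⟨β, κ⟩, hx, rfl⟩
      obtain ⟨hβ, hκ⟩ := mem_sigma.1 hx
      exact (ih.1 hβ).extend (mem_successors.1 hκ)
    · intro h
      have hstep := h.step N (Nat.lt_succ_self N)
      refine ⟨⟨extendChain N α (α N), α (N + 1)⟩, mem_sigma.2 ⟨ih.2 h.truncate, ?_⟩, ?_⟩
      · rw [mem_successors]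
        change IsStep (s N) (extendChain N α (α N) N) (α (N + 1))
        rwa [extendChain_of_le le_rfl]
      · funext n
        change extendChain N (extendChain N α (α N)) (α (N + 1)) n = α n
        rcases le_or_gt n N with hn | hn
        · rw [extendChain_of_le hn, extendChain_of_le hn]
        · rw [extendChain_of_lt hn, h.const n hn]

theorem alternant_mul_prod_poly (s : ℕ → StepKind) (N : ℕ) :
    alternant (staircase u) * ∏ n ∈ range N, (s n).poly u =
      ∑ α ∈ chains s N, alternant (α N + staircase u) := by
  classical
  induction N with
  | zero => rw [prod_range_zero, mul_one, chains, sum_singleton, Pi.zero_apply, zero_add]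
  | succ N ih =>
    have hinj : Set.InjOn (fun x : Σ _ : ℕ → Fin u → ℤ, Fin u → ℤ => extendChain N x.1 x.2)
        ((chains s N).sigma fun α => (s N).successors (α N) :
          Finset (Σ _ : ℕ → Fin u → ℤ, Fin u → ℤ)) := by
      refine (extendChain_injOn (s := s)).mono fun x hx => ?_
      exact mem_chains.1 (mem_sigma.1 (mem_coe.1 hx)).1
    rw [chains, sum_image hinj, sum_sigma, prod_range_succ, ← mul_assoc, ih, sum_mul]
    refine sum_congr rfl fun α hα => ?_
    rw [alternant_mul_poly_of_antitone _ (mem_chains.1 hα).antitone]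
    exact sum_congr rfl fun κ _ => by rw [extendChain_of_lt (Nat.lt_succ_self N)]

theorem setOf_isChain_eq (s : ℕ → StepKind) (N : ℕ) (κ : GenPartition u) :
    {α : ℕ → Fin u → ℤ | IsChain s N α ∧ α N = κ.1} = ↑({α ∈ chains s N | α N = κ.1}) := by
  ext α
  rw [mem_coe, mem_filter, mem_chains, Set.mem_ofPred_eq]

theorem finite_setOf_isChain (s : ℕ → StepKind) (N : ℕ) (κ : GenPartition u) :
    {α : ℕ → Fin u → ℤ | IsChain s N α ∧ α N = κ.1}.Finite := by
  rw [setOf_isChain_eq]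
  exact finite_toSet _

theorem schurCoeff_prod_poly (s : ℕ → StepKind) (N : ℕ) (κ : GenPartition u) :
    schurCoeff κ (∏ n ∈ range N, (s n).poly u) =
      {α : ℕ → Fin u → ℤ | IsChain s N α ∧ α N = κ.1}.ncard := by
  rw [setOf_isChain_eq, Set.ncard_coe_finset]
  exact schurCoeff_of_alternant_mul_eq_sum (chains s N) (fun α => α N)
    (fun α hα => (mem_chains.1 hα).antitone) (alternant_mul_prod_poly s N) κ

end Chain

/-! ### Semistandard tableaux and chains -/

theorem lt_card_iff_mem {S : Finset ℕ} (hS : ∀ j ∈ S, ∀ k ≤ j, k ∈ S) {j : ℕ} :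
    j < #S ↔ j ∈ S := by
  constructor
  · intro hj
    by_contra hmem
    have hsub : S ⊆ range j := fun k hk =>
      mem_range.2 (not_le.1 fun hjk => hmem (hS k hk j hjk))
    exact hj.not_ge ((card_le_card hsub).trans (card_range j).le)
  · intro hj
    have hsub : range (j + 1) ⊆ S := fun k hk => hS j hj k (Nat.lt_succ_iff.1 (mem_range.1 hk))
    exact (card_range (j + 1)).symm.le.trans (card_le_card hsub)

theorem row_lt_of_mem {u : ℕ} {ν : YoungDiagram} (hν : ν.colLen 0 ≤ u) {i j : ℕ}
    (h : (i, j) ∈ ν) : i < u :=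
  (YoungDiagram.mem_iff_lt_colLen.1 h).trans_le ((ν.colLen_anti 0 j (Nat.zero_le j)).trans hν)

/-- The fillings of `ν` that increase weakly along the rows. -/
def IsRowWeak (ν : YoungDiagram) (F : ℕ → ℕ → ℕ) : Prop :=
  ∀ ⦃i j j' : ℕ⦄, j ≤ j' → (i, j') ∈ ν → F i j ≤ F i j'

/-- The number of entries less than `n` in the row `i` of the filling `F` of `ν`. -/
def rowCount (ν : YoungDiagram) (F : ℕ → ℕ → ℕ) (n i : ℕ) : ℕ :=
  #{j ∈ range (ν.rowLen i) | F i j < n}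

section RowCount

variable {u : ℕ} {ν : YoungDiagram} {F F' : ℕ → ℕ → ℕ} {n n' i i' j : ℕ}

theorem lt_rowCount_iff (hF : IsRowWeak ν F) :
    j < rowCount ν F n i ↔ (i, j) ∈ ν ∧ F i j < n := by
  rw [rowCount, lt_card_iff_mem, mem_filter, mem_range, YoungDiagram.mem_iff_lt_rowLen]
  intro j hj k hk
  rw [mem_filter, mem_range] at hj ⊢
  exact ⟨hk.trans_lt hj.1, (hF hk (YoungDiagram.mem_iff_lt_rowLen.2 hj.1)).trans_lt hj.2⟩

theorem rowCount_le_rowCount_iff (hF : IsRowWeak ν F) : rowCount ν F n' i' ≤ rowCount ν F n i ↔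
    ∀ j, (i', j) ∈ ν → F i' j < n' → (i, j) ∈ ν ∧ F i j < n := by
  refine ⟨fun h j hj hlt => ?_, fun h => le_of_forall_lt fun j hj => ?_⟩
  · exact (lt_rowCount_iff hF).1 (((lt_rowCount_iff hF).2 ⟨hj, hlt⟩).trans_le h)
  · obtain ⟨hmem, hlt⟩ := (lt_rowCount_iff hF).1 hj
    exact (lt_rowCount_iff hF).2 (h j hmem hlt)

theorem rowCount_zero (ν : YoungDiagram) (F : ℕ → ℕ → ℕ) (i : ℕ) : rowCount ν F 0 i = 0 := by
  simp only [rowCount, Nat.not_lt_zero, filter_false, card_empty]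

theorem rowCount_le_succ (ν : YoungDiagram) (F : ℕ → ℕ → ℕ) (n i : ℕ) :
    rowCount ν F n i ≤ rowCount ν F (n + 1) i :=
  card_le_card (monotone_filter_right _ fun _ _ h => Nat.lt_succ_of_lt h)

theorem rowCount_eq_rowLen (h : ∀ j, (i, j) ∈ ν → F i j < n) :
    rowCount ν F n i = ν.rowLen i := by
  rw [rowCount, filter_true_of_mem, card_range]
  exact fun j hj => h j (YoungDiagram.mem_iff_lt_rowLen.2 (mem_range.1 hj))

theorem sum_rowCount (hν : ν.colLen 0 ≤ u) (F : ℕ → ℕ → ℕ) (n : ℕ) :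
    ∑ i : Fin u, rowCount ν F n i = #{x ∈ ν.cells | F x.1 x.2 < n} := by
  rw [Fin.sum_univ_eq_sum_range (rowCount ν F n), card_eq_sum_card_fiberwise (f := Prod.fst)
    (t := range u) fun x hx => mem_coe.2 (mem_range.2 (row_lt_of_mem hν
      ((YoungDiagram.mem_cells _).1 (mem_filter.1 hx).1)))]
  refine sum_congr rfl fun i _ => ?_
  refine card_bij (fun j _ => (i, j)) (fun j hj => ?_) (fun j _ k _ h => (Prod.mk.inj h).2) ?_
  · rw [mem_filter, mem_range, ← YoungDiagram.mem_iff_lt_rowLen] at hj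
    exact mem_filter.2 ⟨mem_filter.2 ⟨(YoungDiagram.mem_cells _).2 hj.1, hj.2⟩, rfl⟩
  · rintro ⟨i', j⟩ hx
    obtain ⟨hcell, rfl⟩ := mem_filter.1 hx
    obtain ⟨hmem, hlt⟩ := mem_filter.1 hcell
    exact ⟨j, mem_filter.2 ⟨mem_range.2 (YoungDiagram.mem_iff_lt_rowLen.1 hmem), hlt⟩, rfl⟩

theorem sum_rowCount_succ (hν : ν.colLen 0 ≤ u) (F : ℕ → ℕ → ℕ) (n : ℕ) :
    ∑ i : Fin u, rowCount ν F (n + 1) i =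
      ∑ i : Fin u, rowCount ν F n i + #{x ∈ ν.cells | F x.1 x.2 = n} := by
  rw [sum_rowCount hν, sum_rowCount hν, ← card_union_of_disjoint]
  · rw [← filter_or]
    exact congrArg card (filter_congr fun x _ => Nat.lt_succ_iff_lt_or_eq)
  · exact disjoint_filter.2 fun x _ hlt heq => hlt.ne heq

theorem eq_of_rowCount_eq (hν : ν.colLen 0 ≤ u) (hF : IsRowWeak ν F) (hF' : IsRowWeak ν F')
    (h : ∀ n (i : Fin u), rowCount ν F n i = rowCount ν F' n i) (hij : (i, j) ∈ ν) :
    F i j = F' i j := by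
  refine eq_of_forall_gt_iff fun n => ?_
  have hiff := (lt_rowCount_iff (n := n) (j := j) hF).symm.trans
    ((h n ⟨i, row_lt_of_mem hν hij⟩).symm ▸ lt_rowCount_iff hF')
  rwa [and_iff_right hij, and_iff_right hij] at hiff

theorem col_strict_iff_rowCount (hν : ν.colLen 0 ≤ u) (hF : IsRowWeak ν F) :
    (∀ i i' j, i < i' → (i', j) ∈ ν → F i j < F i' j) ↔
      ∀ n (i i' : Fin u), (i : ℕ) + 1 = i' → rowCount ν F (n + 1) i' ≤ rowCount ν F n i := by
  simp only [rowCount_le_rowCount_iff hF]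
  constructor
  · intro h n i i' hii' j hj hlt
    refine ⟨ν.up_left_mem (by omega) le_rfl hj, ?_⟩
    exact (h i i' j (by omega) hj).trans_le (Nat.lt_succ_iff.1 hlt)
  · intro h i i' j hii' hj
    have hsucc : ∀ k, (k + 1, j) ∈ ν → F k j < F (k + 1) j := fun k hk =>
      have hku := row_lt_of_mem hν hk
      (h (F (k + 1) j) ⟨k, by omega⟩ ⟨k + 1, hku⟩ rfl j hk (Nat.lt_succ_self _)).2
    induction i', hii' using Nat.le_induction with
    | base => exact hsucc i hj
    | succ k _ ih => exact (ih (ν.up_left_mem k.le_succ le_rfl hj)).trans (hsucc k hj)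

theorem col_weak_iff_rowCount (hν : ν.colLen 0 ≤ u) (hF : IsRowWeak ν F) :
    (∀ i i' j, i ≤ i' → (i', j) ∈ ν → F i j ≤ F i' j) ↔
      ∀ n, Antitone fun i : Fin u => rowCount ν F n i := by
  simp only [Antitone, rowCount_le_rowCount_iff hF]
  constructor
  · intro h n i i' hii' j hj hlt
    exact ⟨ν.up_left_mem hii' le_rfl hj, (h i i' j hii' hj).trans_lt hlt⟩
  · intro h i i' j hii' hj
    have hi' := row_lt_of_mem hν hj
    exact Nat.lt_succ_iff.1 (h (F i' j + 1) (Fin.mk_le_mk.2 hii' :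
      (⟨i, by omega⟩ : Fin u) ≤ ⟨i', hi'⟩) j hj (Nat.lt_succ_self _)).2

theorem row_strict_iff_rowCount (hν : ν.colLen 0 ≤ u) (hF : IsRowWeak ν F) :
    (∀ i j j', j < j' → (i, j') ∈ ν → F i j < F i j') ↔
      ∀ n (i : Fin u), rowCount ν F (n + 1) i ≤ rowCount ν F n i + 1 := by
  constructor
  · intro h n i
    refine le_of_forall_lt fun j hj => ?_
    rcases j with _ | j
    · exact Nat.succ_pos _
    · obtain ⟨hmem, hlt⟩ := (lt_rowCount_iff hF).1 hj
      refine Nat.succ_lt_succ ((lt_rowCount_iff hF).2 ⟨ν.up_left_mem le_rfl j.le_succ hmem, ?_⟩)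
      exact (h i j (j + 1) j.lt_succ_self hmem).trans_le (Nat.lt_succ_iff.1 hlt)
  · intro h i j j' hjj' hmem
    have hj' : j' < rowCount ν F (F i j' + 1) i := (lt_rowCount_iff hF).2 ⟨hmem, Nat.lt_succ_self _⟩
    have hle := h (F i j') ⟨i, row_lt_of_mem hν hmem⟩
    exact ((lt_rowCount_iff hF).1 (hjj'.trans_le (Nat.lt_succ_iff.1 (hj'.trans_le hle)))).2

theorem exists_forall_lt_iff_of_monotone {f : ℕ → ℤ} (hf : Monotone f) {x : ℤ} {n : ℕ}
    (hzero : f 0 ≤ x) (hn : x < f n) : ∃ m, ∀ k, m < k ↔ x < f k := by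
  classical
  have hex : ∃ m, x < f (m + 1) := ⟨n, hn.trans_le (hf n.le_succ)⟩
  refine ⟨Nat.find hex, fun k => ⟨fun h => (Nat.find_spec hex).trans_le (hf h), fun h => ?_⟩⟩
  rcases k with _ | k
  · exact absurd h hzero.not_gt
  · exact Nat.lt_succ_of_le (Nat.find_min' hex h)

theorem exists_filling {α : ℕ → Fin u → ℤ} {N : ℕ} (hν : ν.colLen 0 ≤ u) (hzero : α 0 = 0)
    (hmono : Monotone α) (hconst : ∀ n, N ≤ n → α n = α N)
    (hN : α N = (GenPartition.ofPartition u ν).1) :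
    ∃ F, IsRowWeak ν F ∧ (∀ i j, (i, j) ∉ ν → F i j = 0) ∧
      ∀ n (i : Fin u), (rowCount ν F n i : ℤ) = α n i := by
  have hnonneg : ∀ n i, 0 ≤ α n i := fun n i => by
    have hle := hmono n.zero_le i
    rwa [hzero] at hle
  have hmem : ∀ n (i : Fin u) (j : ℕ), (j : ℤ) < α n i → ((i : ℕ), j) ∈ ν := fun n i j hj => by
    have hle := hmono (le_max_left n N) i
    rw [hconst _ (le_max_right n N), hN] at hle
    exact YoungDiagram.mem_iff_lt_rowLen.2 (Nat.cast_lt.1 (hj.trans_le hle))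
  have hentry : ∀ i j, ∃ m, ((i, j) ∉ ν → m = 0) ∧
      ∀ hi : i < u, (i, j) ∈ ν → ∀ n, m < n ↔ (j : ℤ) < α n ⟨i, hi⟩ := fun i j => by
    by_cases hij : (i, j) ∈ ν
    · have hi := row_lt_of_mem hν hij
      obtain ⟨m, hm⟩ := exists_forall_lt_iff_of_monotone (f := fun n => α n ⟨i, hi⟩) (x := j)
        (n := N) (fun _ _ h => hmono h _) ((congrFun hzero _).trans_le (Int.natCast_nonneg j))
        ((congrFun hN _).symm ▸ Nat.cast_lt.2 (YoungDiagram.mem_iff_lt_rowLen.1 hij))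
      exact ⟨m, fun h => absurd hij h, fun _ _ => hm⟩
    · exact ⟨0, fun _ => rfl, fun _ h => absurd h hij⟩
  choose F hout hF using hentry
  have hweak : IsRowWeak ν F := fun i j j' hjj' hij => by
    have hi := row_lt_of_mem hν hij
    refine Nat.lt_succ_iff.1 ((hF i j hi (ν.up_left_mem le_rfl hjj' hij) _).2 ?_)
    exact (Nat.cast_le.2 hjj').trans_lt ((hF i j' hi hij _).1 (Nat.lt_succ_self _))
  refine ⟨F, hweak, hout, fun n i => ?_⟩
  rw [← Int.toNat_of_nonneg (hnonneg n i), Nat.cast_inj]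
  refine eq_of_forall_lt_iff fun j => ?_
  rw [lt_rowCount_iff hweak, Int.lt_toNat]
  exact ⟨fun h => (hF i j i.2 h.1 n).1 h.2,
    fun h => ⟨hmem n i j h, (hF i j i.2 (hmem n i j h) n).2 h⟩⟩

theorem isStep_horiz_rowCount (hν : ν.colLen 0 ≤ u) (F : ℕ → ℕ → ℕ) (r n : ℕ) :
    IsStep (.horiz r) (fun i : Fin u => (rowCount ν F n i : ℤ))
        (fun i : Fin u => (rowCount ν F (n + 1) i : ℤ)) ↔
      (∀ i i' : Fin u, (i : ℕ) + 1 = i' → rowCount ν F (n + 1) i' ≤ rowCount ν F n i) ∧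
        #{x ∈ ν.cells | F x.1 x.2 = n} = r := by
  simp only [IsStep, Nat.cast_le, rowCount_le_succ, implies_true, true_and]
  norm_cast
  rw [sum_rowCount_succ hν, add_right_inj]

theorem isStep_vert_rowCount (hν : ν.colLen 0 ≤ u) (F : ℕ → ℕ → ℕ) (r n : ℕ) :
    IsStep (.vert r) (dual fun i : Fin u => (rowCount ν F n i : ℤ))
        (dual fun i : Fin u => (rowCount ν F (n + 1) i : ℤ)) ↔
      (∀ i : Fin u, rowCount ν F (n + 1) i ≤ rowCount ν F n i + 1) ∧
        (Antitone fun i : Fin u => rowCount ν F (n + 1) i) ∧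
          #{x ∈ ν.cells | F x.1 x.2 = n} = r := by
  rw [isStep_vert_dual]
  simp only [Nat.cast_le, rowCount_le_succ, true_and, Antitone]
  norm_cast
  rw [sum_rowCount_succ hν, add_right_inj]

end RowCount

/-- The semistandard tableaux of shape `ν` in which each `k` occurs `c k` times. -/
def ssytWithContent (ν : YoungDiagram) (c : ℕ → ℕ) : Set (SemistandardYoungTableau ν) :=
  {T | ∀ k, #{x ∈ ν.cells | T x.1 x.2 = k} = c k}

section Content

variable {u N : ℕ} {μ ν : YoungDiagram} {F : ℕ → ℕ → ℕ} {c : ℕ → ℕ}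

theorem isChain_horiz_rowCount_iff (hν : ν.colLen 0 ≤ u) (hF : IsRowWeak ν F)
    (hc : ∀ n, N ≤ n → c n = 0) :
    IsChain (fun n => .horiz (c n)) N (fun n (i : Fin u) => (rowCount ν F n i : ℤ)) ↔
      (∀ i i' j, i < i' → (i', j) ∈ ν → F i j < F i' j) ∧
        ∀ n, #{x ∈ ν.cells | F x.1 x.2 = n} = c n := by
  rw [isChain_iff_forall_isStep hc, col_strict_iff_rowCount hν hF, ← forall_and]
  simp only [isStep_horiz_rowCount hν]
  exact and_iff_right (funext fun i => by rw [rowCount_zero, Nat.cast_zero, Pi.zero_apply])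

theorem isChain_vert_rowCount_iff (hμ : μ.colLen 0 ≤ u) (hF : IsRowWeak μ F)
    (hc : ∀ n, N ≤ n → c n = 0) :
    IsChain (fun n => .vert (c n)) N (fun n => dual fun i : Fin u => (rowCount μ F n i : ℤ)) ↔
      (∀ i j j', j < j' → (i, j') ∈ μ → F i j < F i j') ∧
        (∀ i i' j, i ≤ i' → (i', j) ∈ μ → F i j ≤ F i' j) ∧
          ∀ n, #{x ∈ μ.cells | F x.1 x.2 = n} = c n := by
  have hzero : (dual fun i : Fin u => (rowCount μ F 0 i : ℤ)) = 0 := funext fun i => by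
    rw [dual, rowCount_zero, Nat.cast_zero, neg_zero, Pi.zero_apply]
  have hanti : (∀ n, Antitone fun i : Fin u => rowCount μ F n i) ↔
      ∀ n, Antitone fun i : Fin u => rowCount μ F (n + 1) i := by
    rw [← Nat.and_forall_add_one]
    refine and_iff_right fun i j _ => ?_
    simp only [rowCount_zero, le_refl]
  rw [isChain_iff_forall_isStep hc, row_strict_iff_rowCount hμ hF, col_weak_iff_rowCount hμ hF,
    hanti, ← forall_and, ← forall_and, and_iff_right hzero]
  simp only [isStep_vert_rowCount hμ]

theorem lt_of_mem_ssytWithContent (hc : ∀ n, N ≤ n → c n = 0) {T : SemistandardYoungTableau ν}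
    (hT : T ∈ ssytWithContent ν c) {x : ℕ × ℕ} (hx : x ∈ ν.cells) : T x.1 x.2 < N := by
  by_contra! hN
  have hempty := (hT (T x.1 x.2)).trans (hc _ hN)
  exact notMem_empty x (card_eq_zero.1 hempty ▸ mem_filter.2 ⟨hx, rfl⟩)

theorem mem_ssytWithContent_transpose {T : SemistandardYoungTableau μ.transpose} :
    T ∈ ssytWithContent μ.transpose c ↔ ∀ k, #{x ∈ μ.cells | T x.2 x.1 = k} = c k := by
  refine forall_congr' fun k => Eq.congr_left ?_
  refine card_bij (fun x _ => x.swap) (fun x hx => ?_) (fun x _ y _ h => Prod.swap_injective h)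
    fun x hx => ⟨x.swap, ?_, x.swap_swap⟩
  · rwa [mem_filter, YoungDiagram.mem_cells, YoungDiagram.mem_transpose,
      ← YoungDiagram.mem_cells] at *
  · rw [mem_filter, YoungDiagram.mem_cells, YoungDiagram.mem_transpose, Prod.swap_swap,
      ← YoungDiagram.mem_cells]
    exact mem_filter.1 hx

theorem bijOn_ssytWithContent_horiz (hν : ν.colLen 0 ≤ u) (hc : ∀ n, N ≤ n → c n = 0) :
    Set.BijOn (fun (T : SemistandardYoungTableau ν) n (i : Fin u) => (rowCount ν T n i : ℤ))
      (ssytWithContent ν c)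
      {α | IsChain (fun n => .horiz (c n)) N α ∧ α N = (GenPartition.ofPartition u ν).1} := by
  have hweak : ∀ T : SemistandardYoungTableau ν, IsRowWeak ν T :=
    fun T _ _ _ hj hcell => T.row_weak_of_le hj hcell
  refine ⟨fun T hT => ⟨?_, ?_⟩, fun T _ T' _ heq => ?_, fun α ⟨hα, hN⟩ => ?_⟩
  · refine (isChain_horiz_rowCount_iff hν (hweak T) hc).2 ⟨fun i i' j hi hcell => ?_, hT⟩
    exact T.col_strict hi hcell
  · funext i
    refine congrArg _ (rowCount_eq_rowLen fun j hj => ?_)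
    exact lt_of_mem_ssytWithContent hc hT ((YoungDiagram.mem_cells _).2 hj)
  · ext i j
    by_cases hij : (i, j) ∈ ν
    · exact eq_of_rowCount_eq hν (hweak T) (hweak T')
        (fun n i => Nat.cast_inj.1 (congrFun (congrFun heq n) i)) hij
    · rw [T.zeros hij, T'.zeros hij]
  · obtain ⟨F, hF, hout, hcount⟩ := exists_filling hν hα.zero hα.monotone_of_horiz hα.const hN
    obtain rfl := funext₂ hcount
    obtain ⟨hcol, hcontent⟩ := (isChain_horiz_rowCount_iff hν hF hc).1 hα
    exact ⟨⟨F, fun hj hcell => hF hj.le hcell, fun hi hcell => hcol _ _ _ hi hcell, hout _ _⟩,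
      hcontent, rfl⟩

theorem bijOn_ssytWithContent_vert (hμ : μ.colLen 0 ≤ u) (hc : ∀ n, N ≤ n → c n = 0) :
    Set.BijOn (fun (T : SemistandardYoungTableau μ.transpose) n =>
        dual fun i : Fin u => (rowCount μ (fun i j => T j i) n i : ℤ))
      (ssytWithContent μ.transpose c)
      {α | IsChain (fun n => .vert (c n)) N α ∧
        α N = (GenPartition.ofPartition u μ).star.1} := by
  have hweak : ∀ T : SemistandardYoungTableau μ.transpose, IsRowWeak μ fun i j => T j i :=
    fun T _ _ _ hj hcell => T.col_weak hj (YoungDiagram.mem_transpose.2 hcell)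
  refine ⟨fun T hT => ⟨?_, ?_⟩, fun T _ T' _ heq => ?_, fun α ⟨hα, hN⟩ => ?_⟩
  · refine (isChain_vert_rowCount_iff hμ (hweak T) hc).2 ⟨fun i j j' hj hcell => ?_,
      fun i i' j hi hcell => ?_, mem_ssytWithContent_transpose.1 hT⟩
    · exact T.col_strict hj (YoungDiagram.mem_transpose.2 hcell)
    · exact T.row_weak_of_le hi (YoungDiagram.mem_transpose.2 hcell)
  · refine congrArg dual (funext fun i => congrArg _ (rowCount_eq_rowLen fun j hj => ?_))
    exact lt_of_mem_ssytWithContent hc hT (x := (j, i)) ((YoungDiagram.mem_cells _).2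
      (YoungDiagram.mem_transpose.2 hj))
  · ext i j
    by_cases hij : (j, i) ∈ μ
    · refine eq_of_rowCount_eq hμ (hweak T) (hweak T') (i := j) (j := i)
        (fun n i => (Nat.cast_inj (R := ℤ)).1 ?_) hij
      exact congrFun ((dual_dual _).symm.trans ((congrArg dual (congrFun heq n)).trans
        (dual_dual _))) i
    · have hij' : (i, j) ∉ μ.transpose := fun h => hij (YoungDiagram.mem_transpose.1 h)
      rw [T.zeros hij', T'.zeros hij']
  · obtain ⟨F, hF, hout, hcount⟩ := exists_filling (α := fun n => dual (α n)) (N := N) hμ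
      (funext fun i => by simp only [hα.zero, dual, Pi.zero_apply, neg_zero])
      (fun _ _ hn i => neg_le_neg (hα.antitone_of_vert hn i.rev))
      (fun n hn => congrArg dual (hα.const n hn)) ((congrArg dual hN).trans (dual_dual _))
    obtain rfl : (fun n => dual fun i : Fin u => (rowCount μ F n i : ℤ)) = α := funext fun n =>
      (congrArg dual (funext (hcount n))).trans (dual_dual _)
    obtain ⟨hrow, hcol, hcontent⟩ := (isChain_vert_rowCount_iff hμ hF hc).1 hα
    refine ⟨⟨fun i j => F j i, fun hj hcell => ?_, fun hi hcell => ?_, fun hij => ?_⟩,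
      mem_ssytWithContent_transpose.2 hcontent, rfl⟩
    · exact hcol _ _ _ hj.le (YoungDiagram.mem_transpose.1 hcell)
    · exact hrow _ _ _ hi (YoungDiagram.mem_transpose.1 hcell)
    · exact hout _ _ fun h => hij (YoungDiagram.mem_transpose.2 h)

end Content

/-! ### Words and their heights -/

/-- The order isomorphism that numbers the barred letters by `…, -2, -1` and the unbarred ones by
`0, 1, …`. -/
def position : Letter ≃o ℤ where
  toFun b := if (b : ℤ) < 0 then b else b - 1
  invFun t := if h : t < 0 then ⟨t, h.ne⟩ else ⟨t + 1, by omega⟩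
  left_inv b := by
    have hb := b.2
    refine Subtype.ext ?_
    by_cases hneg : (b : ℤ) < 0
    · simp only [if_pos hneg, dif_pos hneg]
    · simp only [if_neg hneg, dif_neg (show ¬(b : ℤ) - 1 < 0 by omega), sub_add_cancel]
  right_inv t := by
    by_cases hneg : t < 0
    · simp only [dif_pos hneg, if_pos hneg]
    · simp only [dif_neg hneg, if_neg (show ¬t + 1 < 0 by omega), add_sub_cancel_right]
  map_rel_iff' {b b'} := by
    have hb := b.2
    have hb' := b'.2
    rw [← Subtype.coe_le_coe]
    simp only [Equiv.coe_fn_mk]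
    split_ifs <;> omega

theorem position_apply (b : Letter) : position b = if (b : ℤ) < 0 then (b : ℤ) else b - 1 := rfl

theorem position_barLetter (k : ℕ) : position (barLetter k) = -((k : ℤ) + 1) :=
  if_pos (show -((k : ℤ) + 1) < 0 by omega)

theorem position_posLetter (k : ℕ) : position (posLetter k) = k := by
  rw [position_apply, posLetter, if_neg (by simp only; omega), add_sub_cancel_right]

theorem deg_eq_zero_iff {b : Letter} : deg b = 0 ↔ position b < 0 := by
  have hb := b.2
  rw [deg, position_apply]
  split_ifs <;> simp only [true_iff, false_iff] <;> omega

theorem deg_eq_one_iff {b : Letter} : deg b = 1 ↔ 0 ≤ position b := by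
  have hb := b.2
  rw [deg, position_apply]
  split_ifs <;> simp only [true_iff, false_iff] <;> omega

theorem coe_eq_iff_position_eq {b : Letter} {t : ℤ} (ht : t < 0) :
    (b : ℤ) = t ↔ position b = t := by
  have hb := b.2
  rw [position_apply]
  split_ifs <;> omega

theorem hasCharge_iff {w : ℕ → Letter} {c : ℤ} :
    HasCharge w c ↔ ∀ᶠ k : ℕ in Filter.atTop, position (w k) = -(((k : ℤ) + 1) + c) := by
  refine Filter.eventually_congr ?_
  filter_upwards [Filter.eventually_ge_atTop c.natAbs] with k hk
  exact coe_eq_iff_position_eq (by omega)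

namespace Word

variable (w w' : Word) (t : ℤ)

theorem finite_setOf_le_position : {k : ℕ | t ≤ position (w.letter k)}.Finite := by
  obtain ⟨c, hc⟩ := w.charged
  obtain ⟨K, hK⟩ := Filter.eventually_atTop.1 (hasCharge_iff.1 hc)
  refine (Set.finite_Iio (max K (-t - c).toNat)).subset fun k hk => ?_
  replace hk : t ≤ position (w.letter k) := hk
  rw [Set.mem_Iio]
  by_contra! hge
  have hpos := hK k (le_of_max_le_left hge)
  omega

/-- The number of letters at positions at least `t`. -/
def letterCount : ℕ := #(w.finite_setOf_le_position t).toFinset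

variable {w w' t}

theorem lt_letterCount_iff {k : ℕ} : k < w.letterCount t ↔ t ≤ position (w.letter k) := by
  rw [letterCount, lt_card_iff_mem, Set.Finite.mem_toFinset, Set.mem_ofPred_eq]
  intro j hj k hk
  rw [Set.Finite.mem_toFinset, Set.mem_ofPred_eq] at hj ⊢
  exact hj.trans (position.le_iff_le.2 (w.antitone hk))

theorem letterCount_le_letterCount_add_iff {t' : ℤ} {d : ℕ} :
    w'.letterCount t' ≤ w.letterCount t + d ↔
      ∀ k, t' ≤ position (w'.letter (k + d)) → t ≤ position (w.letter k) := by
  simp only [← lt_letterCount_iff]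
  refine ⟨fun h k hk => by omega, fun h => ?_⟩
  by_contra! hlt
  exact lt_irrefl _ (h _ hlt)

theorem eq_of_letterCount_eq (h : ∀ t, w.letterCount t = w'.letterCount t) : w = w' := by
  refine Word.ext (funext fun k => position.injective (eq_of_forall_le_iff fun t => ?_))
  rw [← lt_letterCount_iff, ← lt_letterCount_iff, h]

theorem letterCount_succ_le : w.letterCount (t + 1) ≤ w.letterCount t :=
  (letterCount_le_letterCount_add_iff (d := 0)).2 fun _ h => (lt_add_one t).le.trans h

theorem letterCount_le_succ (ht : t < 0) : w.letterCount t ≤ w.letterCount (t + 1) + 1 := by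
  rw [letterCount_le_letterCount_add_iff]
  intro k hk
  have hle := position.le_iff_le.2 (w.weak k)
  refine lt_of_le_of_ne (hk.trans hle) fun heq => ?_
  have hdeg := deg_eq_one_iff.1 (w.strict k (position.injective (le_antisymm hle (heq ▸ hk))))
  omega

theorem setOf_letter_eq (b : Letter) : {k : ℕ | w.letter k = b} =
    ↑(Ico (w.letterCount (position b + 1)) (w.letterCount (position b))) := by
  ext k
  rw [coe_Ico, Set.mem_Ico, ← not_lt, lt_letterCount_iff, lt_letterCount_iff, Set.mem_ofPred_eq,
    ← position.injective.eq_iff]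
  omega

theorem forall_letter_le_iff {d : ℕ} :
    (∀ k, w'.letter (k + d) ≤ w.letter k ∧
        (w.letter k = w'.letter (k + d) → deg (w.letter k) = 0)) ↔
      ∀ t, w'.letterCount t ≤ w.letterCount t + d ∧
        (0 ≤ t → w'.letterCount t ≤ w.letterCount (t + 1) + d) := by
  simp only [letterCount_le_letterCount_add_iff, deg_eq_zero_iff]
  simp only [← position.le_iff_le, ← position.injective.eq_iff]
  constructor
  · refine fun h t => ⟨fun k hk => hk.trans (h k).1, fun ht k hk => ?_⟩
    obtain ⟨hle, heq⟩ := h k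
    omega
  · intro h k
    obtain ⟨hle, hlt⟩ := h (position (w'.letter (k + d)))
    refine ⟨hle k le_rfl, fun heq => ?_⟩
    by_contra! hneg
    have hk := hlt (heq ▸ hneg) k le_rfl
    omega

/-- The number of letters at positions at least `t`, normalized by the term `min t 0` so that it
is eventually constant for `t → -∞`. -/
def height (w : Word) (t : ℤ) : ℤ := w.letterCount t + min t 0

theorem height_succ_of_neg (ht : t < 0) :
    w.height t ≤ w.height (t + 1) ∧ w.height (t + 1) ≤ w.height t + 1 := by
  have hanti := w.letterCount_succ_le (t := t)
  have hle := w.letterCount_le_succ ht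
  rw [height, height, min_eq_left ht.le, min_eq_left (Int.add_one_le_iff.2 ht)]
  omega

theorem height_succ_le_of_nonneg (ht : 0 ≤ t) : w.height (t + 1) ≤ w.height t := by
  have hanti := w.letterCount_succ_le (t := t)
  rw [height, height, min_eq_right ht, min_eq_right (by omega)]
  omega

theorem mult_eq_height_sub (w : Word) (b : Letter) :
    w.mult b = w.height (position b) - w.height (position b + 1) := by
  rw [mult, setOf_letter_eq, Set.ncard_coe_finset, Nat.card_Ico, height, height]
  have hanti := w.letterCount_succ_le (t := position b)
  simp only [deg_eq_zero_iff]
  split_ifs <;> omega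

theorem eventually_height_eq_zero (w : Word) : ∀ᶠ t in Filter.atTop, w.height t = 0 := by
  filter_upwards [Filter.eventually_ge_atTop (max 0 (position (w.letter 0) + 1))] with t ht
  have hcount : ¬0 < w.letterCount t := by
    rw [lt_letterCount_iff]
    omega
  rw [height, min_eq_right (le_of_max_le_left ht)]
  omega

theorem eventually_height_eq_neg {c : ℤ} (hc : HasCharge w.letter c) :
    ∀ᶠ t in Filter.atBot, w.height t = -c := by
  obtain ⟨K, hK⟩ := Filter.eventually_atTop.1 (hasCharge_iff.1 hc)
  filter_upwards [Filter.eventually_le_atBot (min 0 (-(K + 1 + c)))] with t ht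
  have hcount : w.letterCount t = (-t - c).toNat := eq_of_forall_lt_iff fun k => by
    rw [lt_letterCount_iff, Int.lt_toNat]
    rcases le_total K k with hk | hk
    · rw [hK k hk]
      omega
    · have hle := position.le_iff_le.2 (w.antitone hk)
      rw [hK K le_rfl] at hle
      omega
  rw [height, hcount, min_eq_left (le_min_iff.1 ht).1]
  omega

theorem eq_of_height_eq (h : w.height = w'.height) : w = w' :=
  eq_of_letterCount_eq fun t => by
    simpa only [height, add_left_inj, Nat.cast_inj] using congrFun h t

theorem exists_forall_le_iff_lt_of_antitone {M : ℤ → ℕ} (hM : Antitone M)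
    (hbot : Filter.Tendsto M Filter.atBot Filter.atTop) (htop : ∀ᶠ t in Filter.atTop, M t = 0)
    (k : ℕ) : ∃ t', ∀ t, t ≤ t' ↔ k < M t := by
  obtain ⟨T, hT⟩ := htop.exists
  obtain ⟨t', ht', hmax⟩ := Int.exists_greatest_of_bdd (P := fun t => k < M t)
    ⟨T, fun t ht => not_lt.1 fun hlt => by have hle := hM hlt.le; omega⟩
    (hbot.eventually_gt_atTop k).exists
  exact ⟨t', fun t => ⟨fun h => ht'.trans_le (hM h), hmax t⟩⟩

theorem exists_letterCount_eq {M : ℤ → ℕ} {c : ℤ} (hM : Antitone M)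
    (hbot : ∀ᶠ t in Filter.atBot, (M t : ℤ) = -t - c) (htop : ∀ᶠ t in Filter.atTop, M t = 0)
    (hstrict : ∀ t < 0, M t ≤ M (t + 1) + 1) :
    ∃ w : Word, HasCharge w.letter c ∧ w.letterCount = M := by
  obtain ⟨B, hB⟩ := Filter.eventually_atBot.1 hbot
  have htendsto : Filter.Tendsto M Filter.atBot Filter.atTop := Filter.tendsto_atTop.2 fun k => by
    filter_upwards [hbot, Filter.eventually_le_atBot (-(k + c))] with t ht hle
    omega
  choose f hf using exists_forall_le_iff_lt_of_antitone hM htendsto htop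
  have hcharge : HasCharge (fun k => position.symm (f k)) c := by
    rw [hasCharge_iff]
    filter_upwards [Filter.eventually_ge_atTop (1 - B - c).toNat] with k hk
    have hle := hf k (-(k + 1 + c))
    have hlt := hf k (-(k + 1 + c) + 1)
    have hMle := hB (-(k + 1 + c)) (by omega)
    have hMlt := hB (-(k + 1 + c) + 1) (by omega)
    rw [position.apply_symm_apply]
    omega
  refine ⟨⟨fun k => position.symm (f k), fun k => ?_, fun k hk => ?_, c, hcharge⟩, hcharge,
    funext fun t => eq_of_forall_lt_iff fun k => ?_⟩
  · rw [position.symm.le_iff_le, hf k]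
    exact (Nat.lt_succ_self k).trans ((hf (k + 1) _).1 le_rfl)
  · rw [deg_eq_one_iff, position.apply_symm_apply]
    by_contra! hneg
    have hcount := (hf (k + 1) _).1 (position.symm.injective hk).ge
    have hstep := hstrict (f k) hneg
    have hnot := (hf k (f k + 1)).not.1 (lt_add_one _).not_ge
    omega
  · rw [lt_letterCount_iff, ← hf, position.apply_symm_apply]

theorem exists_height_eq {h : ℤ → ℤ} {c : ℤ} (hbot : ∀ᶠ t in Filter.atBot, h t = -c)
    (htop : ∀ᶠ t in Filter.atTop, h t = 0)
    (hvert : ∀ t < 0, h t ≤ h (t + 1) ∧ h (t + 1) ≤ h t + 1)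
    (hhoriz : ∀ t, 0 ≤ t → h (t + 1) ≤ h t) :
    ∃ w : Word, HasCharge w.letter c ∧ w.height = h := by
  have hanti : Antitone fun t => h t - min t 0 := antitone_int_of_succ_le fun t => by
    rcases lt_or_ge t 0 with ht | ht
    · have hstep := hvert t ht
      omega
    · have hstep := hhoriz t ht
      omega
  have hnonneg : ∀ t, 0 ≤ h t - min t 0 := fun t => by
    obtain ⟨T, hT, hge⟩ := (htop.and (Filter.eventually_ge_atTop (max t 0))).exists
    have hle := hanti (le_of_max_le_left hge)
    simp only at hle
    omega
  obtain ⟨w, hcharge, hcount⟩ := exists_letterCount_eq (c := c)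
    (M := fun t => (h t - min t 0).toNat) (fun _ _ hle => Int.toNat_le_toNat (hanti hle))
    (by
      filter_upwards [hbot, Filter.eventually_le_atBot 0] with t ht hneg
      have hle := hnonneg t
      omega)
    (by
      filter_upwards [htop, Filter.eventually_ge_atTop 0] with t ht hpos
      omega)
    (fun t ht => by
      have hstep := hvert t ht
      omega)
  refine ⟨w, hcharge, funext fun t => ?_⟩
  rw [height, hcount, Int.toNat_of_nonneg (hnonneg t), sub_add_cancel]

end Word

/-! ### Tableaux as chains -/

/-- The sign conditions on the exponents of a monomial in the variables `x_b⁻¹` with `|b| = 0` and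
`x_b` with `|b| = 1`. -/
def HasWeightSigns (γ : Letter →₀ ℤ) : Prop := ∀ b, (deg b = 0 → γ b ≤ 0) ∧ (deg b = 1 → 0 ≤ γ b)

/-- The heights at `t` of the words of a tableau, shifted by their charges so that the vector
vanishes for `t → -∞` and is `λ` for `t → ∞`. -/
def profile {u : ℕ} (lam : GenPartition u) (w : Fin u → Word) (t : ℤ) : Fin u → ℤ :=
  fun i => lam.1 i + (w i).height t

/-- The step between the duals of the profiles at `t` and `t + 1` of a tableau of weight `γ`. -/
def letterStep (γ : Letter →₀ ℤ) (t : ℤ) : StepKind :=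
  if t < 0 then .vert (γ (position.symm t)).natAbs else .horiz (γ (position.symm t)).natAbs

/-- The steps `letterStep γ t` with `t ≥ -N`, indexed by `ℕ`. -/
def wordSteps (N : ℕ) (γ : Letter →₀ ℤ) (n : ℕ) : StepKind := letterStep γ (n - N)

/-- The duals of the profiles at `t ≥ -N`, indexed by `ℕ`. -/
def dualProfiles {u : ℕ} (lam : GenPartition u) (N : ℕ) (w : Fin u → Word) (n : ℕ) : Fin u → ℤ :=
  dual (profile lam w (n - N))

section Tableau

variable {u : ℕ} {lam : GenPartition u} {w : Fin u → Word} {γ : Letter →₀ ℤ} {t : ℤ}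

theorem hasWeightSigns_iff : HasWeightSigns γ ↔
    ∀ t, (t < 0 → γ (position.symm t) ≤ 0) ∧ (0 ≤ t → 0 ≤ γ (position.symm t)) := by
  rw [HasWeightSigns, position.symm.surjective.forall]
  simp only [deg_eq_zero_iff, deg_eq_one_iff, OrderIso.apply_symm_apply]

theorem wt_snd_position_symm (lam : GenPartition u) (w : Fin u → Word) (t : ℤ) :
    (wt w).2 (position.symm t) = ∑ i, profile lam w t i - ∑ i, profile lam w (t + 1) i := by
  have hmult : (wt w).2 (position.symm t) = ∑ i, (w i).mult (position.symm t) := by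
    rw [wt, Prod.snd_sum, Finsupp.finsetSum_apply]
    rfl
  rw [hmult, ← sum_sub_distrib]
  refine sum_congr rfl fun i _ => ?_
  rw [Word.mult_eq_height_sub, position.apply_symm_apply, profile, profile,
    add_sub_add_left_eq_sub]

theorem profile_succ_of_neg (ht : t < 0) (i : Fin u) : profile lam w t i ≤ profile lam w (t + 1) i ∧
    profile lam w (t + 1) i ≤ profile lam w t i + 1 := by
  have hheight := (w i).height_succ_of_neg ht
  simp only [profile]
  omega

theorem profile_succ_le_of_nonneg (ht : 0 ≤ t) (i : Fin u) :
    profile lam w (t + 1) i ≤ profile lam w t i :=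
  add_le_add_right ((w i).height_succ_le_of_nonneg ht) _

theorem hasWeightSigns_wt (w : Fin u → Word) : HasWeightSigns (wt w).2 := by
  rw [hasWeightSigns_iff]
  intro t
  rw [wt_snd_position_symm ⟨0, antitone_const⟩]
  exact ⟨fun ht => sub_nonpos.2 (sum_le_sum fun i _ => (profile_succ_of_neg ht i).1),
    fun ht => sub_nonneg.2 (sum_le_sum fun i _ => profile_succ_le_of_nonneg ht i)⟩

theorem weightSpace_eq_empty (lam : GenPartition u) (hγ : ¬HasWeightSigns γ) :
    weightSpace lam γ = ∅ :=
  Set.eq_empty_of_forall_notMem fun w hw => hγ (hw.2 ▸ hasWeightSigns_wt w)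

theorem antitone_iff_succ_le {κ : Fin u → ℤ} :
    Antitone κ ↔ ∀ i j : Fin u, (i : ℕ) + 1 = j → κ j ≤ κ i :=
  ⟨fun h i j hij => h (Fin.le_def.2 (by omega)),
    fun h => antitone_of_succ_le fun k hk => h ⟨k, by omega⟩ ⟨k + 1, hk⟩ rfl⟩

theorem mem_tableaux_iff : w ∈ tableaux lam ↔ (∀ i, HasCharge (w i).letter (lam.1 i)) ∧
    ∀ t, Antitone (profile lam w t) ∧
      (0 ≤ t → ∀ i j : Fin u, (i : ℕ) + 1 = j → profile lam w t j ≤ profile lam w (t + 1) i) := by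
  have hrow : ∀ i j : Fin u, (i : ℕ) + 1 = j →
      ((∀ k, (w j).letter (k + (lam.1 i - lam.1 j).toNat) ≤ (w i).letter k ∧
        ((w i).letter k = (w j).letter (k + (lam.1 i - lam.1 j).toNat) →
          deg ((w i).letter k) = 0)) ↔
      ∀ t, profile lam w t j ≤ profile lam w t i ∧
        (0 ≤ t → profile lam w t j ≤ profile lam w (t + 1) i)) := by
    intro i j hij
    have hle : lam.1 j ≤ lam.1 i := lam.2 (Fin.le_def.2 (by omega))
    rw [Word.forall_letter_le_iff]
    refine forall_congr' fun t => and_congr ?_ (imp_congr_right fun ht => ?_)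
    · simp only [profile, Word.height]
      omega
    · simp only [profile, Word.height]
      omega
  refine and_congr_right fun _ => ?_
  simp only [antitone_iff_succ_le]
  refine ⟨fun h t => ⟨fun i j hij => ((hrow i j hij).1 (h i j hij) t).1,
    fun ht i j hij => ((hrow i j hij).1 (h i j hij) t).2 ht⟩,
    fun h i j hij => (hrow i j hij).2 fun t => ⟨(h t).1 i j hij, fun ht => (h t).2 ht i j hij⟩⟩

theorem isStep_letterStep_of_neg (hγ : HasWeightSigns γ) (ht : t < 0) {κ κ' : Fin u → ℤ} :
    IsStep (letterStep γ t) (dual κ) (dual κ') ↔ (∀ i, κ i ≤ κ' i ∧ κ' i ≤ κ i + 1) ∧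
      Antitone κ' ∧ γ (position.symm t) = ∑ i, κ i - ∑ i, κ' i := by
  have hsign := (hasWeightSigns_iff.1 hγ t).1 ht
  rw [letterStep, if_pos ht, isStep_vert_dual]
  refine and_congr_right fun _ => and_congr_right fun _ => ?_
  omega

theorem isStep_letterStep_of_nonneg (hγ : HasWeightSigns γ) (ht : 0 ≤ t) {κ κ' : Fin u → ℤ} :
    IsStep (letterStep γ t) (dual κ) (dual κ') ↔ (∀ i, κ' i ≤ κ i) ∧
      (∀ i j : Fin u, (i : ℕ) + 1 = j → κ j ≤ κ' i) ∧
        γ (position.symm t) = ∑ i, κ i - ∑ i, κ' i := by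
  have hsign := (hasWeightSigns_iff.1 hγ t).2 ht
  rw [letterStep, if_neg ht.not_gt, isStep_horiz_dual]
  refine and_congr_right fun _ => and_congr_right fun _ => ?_
  omega

theorem mem_weightSpace_iff (hγ : HasWeightSigns γ) : w ∈ weightSpace lam γ ↔
    (∀ i, HasCharge (w i).letter (lam.1 i)) ∧
      ∀ t, IsStep (letterStep γ t) (dual (profile lam w t)) (dual (profile lam w (t + 1))) := by
  have hmem : w ∈ weightSpace lam γ ↔ w ∈ tableaux lam ∧ (wt w).2 = γ := Iff.rfl
  rw [hmem, mem_tableaux_iff, and_assoc]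
  refine and_congr_right fun _ => ?_
  rw [DFunLike.ext_iff, position.symm.surjective.forall]
  simp only [wt_snd_position_symm lam]
  constructor
  · rintro ⟨hrow, hwt⟩ t
    rcases lt_or_ge t 0 with ht | ht
    · rw [isStep_letterStep_of_neg hγ ht]
      exact ⟨profile_succ_of_neg ht, (hrow (t + 1)).1, (hwt t).symm⟩
    · rw [isStep_letterStep_of_nonneg hγ ht]
      exact ⟨profile_succ_le_of_nonneg ht, (hrow t).2 ht, (hwt t).symm⟩
  · intro h
    have hhoriz := fun t ht => (isStep_letterStep_of_nonneg hγ ht).1 (h t)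
    refine ⟨fun t => ⟨?_, fun ht => (hhoriz t ht).2.1⟩, fun t => ?_⟩
    · rcases lt_or_ge t 0 with ht | ht
      · have hstep := h (t - 1)
        rw [isStep_letterStep_of_neg hγ (by omega), sub_add_cancel] at hstep
        exact hstep.2.1
      · rw [antitone_iff_succ_le]
        exact fun i j hij => ((hhoriz t ht).2.1 i j hij).trans ((hhoriz t ht).1 i)
    · rcases lt_or_ge t 0 with ht | ht
      · exact ((isStep_letterStep_of_neg hγ ht).1 (h t)).2.2.symm
      · exact (hhoriz t ht).2.2.symm

theorem size_letterStep (γ : Letter →₀ ℤ) (t : ℤ) :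
    (letterStep γ t).size = (γ (position.symm t)).natAbs := by
  rw [letterStep]
  split_ifs <;> rfl

theorem eq_of_succ_eq {X : Type*} {f : ℤ → X} {a b : ℤ} (hab : a ≤ b)
    (h : ∀ t, a ≤ t → t < b → f (t + 1) = f t) : f b = f a := by
  induction b, hab using Int.leInduction with
  | base => rfl
  | succ b hab ih =>
    rw [h b hab (lt_add_one b), ih fun t hat htb => h t hat (htb.trans (lt_add_one b))]

section Window

variable {N : ℕ} {α : ℕ → Fin u → ℤ}
  (hN : ∀ t : ℤ, t < -N ∨ N ≤ t → γ (position.symm t) = 0)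

include hN

theorem size_letterStep_eq_zero (ht : t < -N ∨ N ≤ t) : (letterStep γ t).size = 0 := by
  rw [size_letterStep, hN t ht, Int.natAbs_zero]

theorem profile_succ_eq (hγ : HasWeightSigns γ) (hw : w ∈ weightSpace lam γ)
    (ht : t < -N ∨ N ≤ t) : profile lam w (t + 1) = profile lam w t := by
  have hdual := (((mem_weightSpace_iff hγ).1 hw).2 t).eq_of_size_eq_zero
    (size_letterStep_eq_zero hN ht)
  rw [← dual_dual (profile lam w (t + 1)), hdual, dual_dual]

theorem profile_of_le (hγ : HasWeightSigns γ) (hw : w ∈ weightSpace lam γ) (ht : t ≤ -N) :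
    profile lam w t = 0 := by
  have hbot : ∀ᶠ t in Filter.atBot, profile lam w t = 0 := by
    filter_upwards [Filter.eventually_all.2 fun i =>
      (w i).eventually_height_eq_neg (((mem_weightSpace_iff hγ).1 hw).1 i)] with t ht
    exact funext fun i => by rw [profile, ht, add_neg_cancel, Pi.zero_apply]
  obtain ⟨B, hB, hle⟩ := (hbot.and (Filter.eventually_le_atBot t)).exists
  rw [← hB]
  exact eq_of_succ_eq hle fun s _ hs => profile_succ_eq hN hγ hw (.inl (hs.trans_le ht))

theorem profile_of_ge (hγ : HasWeightSigns γ) (hw : w ∈ weightSpace lam γ) (ht : N ≤ t) :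
    profile lam w t = lam.1 := by
  have htop : ∀ᶠ t in Filter.atTop, profile lam w t = lam.1 := by
    filter_upwards [Filter.eventually_all.2 fun i => (w i).eventually_height_eq_zero] with t ht
    exact funext fun i => by rw [profile, ht, add_zero]
  obtain ⟨T, hT, hle⟩ := (htop.and (Filter.eventually_ge_atTop t)).exists
  rw [← hT]
  exact (eq_of_succ_eq hle fun s hs _ => profile_succ_eq hN hγ hw (.inr (ht.trans hs))).symm

theorem isChain_wordSteps_iff : IsChain (wordSteps N γ) (2 * N) α ↔
    α 0 = 0 ∧ ∀ t : ℤ, IsStep (letterStep γ t) (α (t + N).toNat) (α (t + 1 + N).toNat) := by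
  have hsize : ∀ n, 2 * N ≤ n → (wordSteps N γ n).size = 0 := fun n hn =>
    size_letterStep_eq_zero hN (.inr (by omega))
  rw [isChain_iff_forall_isStep hsize]
  refine and_congr_right fun hzero => ⟨fun h t => ?_, fun h n => ?_⟩
  · rcases lt_or_ge t (-N) with ht | ht
    · rw [Int.toNat_of_nonpos (show t + N ≤ 0 by omega),
        Int.toNat_of_nonpos (show t + 1 + N ≤ 0 by omega), hzero]
      exact isStep_self (size_letterStep_eq_zero hN (.inl ht)) antitone_const
    · have hstep := h (t + N).toNat
      rwa [wordSteps, Int.toNat_of_nonneg (by omega), add_sub_cancel_right,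
        show (t + N).toNat + 1 = (t + 1 + N).toNat by omega] at hstep
  · have hstep := h (n - N)
    rwa [sub_add_cancel, sub_add_eq_add_sub, sub_add_cancel, Int.toNat_natCast,
      show ((n : ℤ) + 1).toNat = n + 1 by omega] at hstep

theorem dualProfiles_toNat (hγ : HasWeightSigns γ) (hw : w ∈ weightSpace lam γ) (t : ℤ) :
    dualProfiles lam N w (t + N).toNat = dual (profile lam w t) := by
  rw [dualProfiles]
  rcases le_total t (-N) with ht | ht
  · rw [profile_of_le hN hγ hw ht, profile_of_le hN hγ hw (by omega)]
  · rw [Int.toNat_of_nonneg (by omega), add_sub_cancel_right]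

theorem mapsTo_dualProfiles (hγ : HasWeightSigns γ) :
    Set.MapsTo (dualProfiles lam N) (weightSpace lam γ)
      {α | IsChain (wordSteps N γ) (2 * N) α ∧ α (2 * N) = lam.star.1} := by
  intro w hw
  refine ⟨(isChain_wordSteps_iff hN).2 ⟨?_, fun t => ?_⟩, ?_⟩
  · rw [dualProfiles, profile_of_le hN hγ hw (by omega)]
    exact funext fun _ => neg_zero
  · rw [dualProfiles_toNat hN hγ hw, dualProfiles_toNat hN hγ hw]
    exact ((mem_weightSpace_iff hγ).1 hw).2 t
  · rw [dualProfiles, profile_of_ge hN hγ hw (by omega)]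
    rfl

theorem injOn_dualProfiles (hγ : HasWeightSigns γ) :
    Set.InjOn (dualProfiles lam N) (weightSpace lam γ) := by
  intro w hw w' hw' heq
  have hprofile : ∀ t, profile lam w t = profile lam w' t := fun t => by
    rw [← dual_dual (profile lam w t), ← dualProfiles_toNat hN hγ hw, heq,
      dualProfiles_toNat hN hγ hw', dual_dual]
  exact funext fun i => Word.eq_of_height_eq <| funext fun t =>
    add_left_cancel (congrFun (hprofile t) i)

omit hN in
theorem exists_profile_eq (hγ : HasWeightSigns γ) {β : ℤ → Fin u → ℤ}
    (hbot : ∀ᶠ t in Filter.atBot, β t = 0) (htop : ∀ᶠ t in Filter.atTop, β t = lam.1)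
    (hβ : ∀ t, IsStep (letterStep γ t) (dual (β t)) (dual (β (t + 1)))) :
    ∃ w ∈ weightSpace lam γ, profile lam w = β := by
  have hword : ∀ i, ∃ w : Word, HasCharge w.letter (lam.1 i) ∧
      w.height = fun t => β t i - lam.1 i := by
    refine fun i => Word.exists_height_eq (hbot.mono fun t ht => ?_) (htop.mono fun t ht => ?_)
      (fun t ht => ?_) (fun t ht => ?_)
    · rw [ht, Pi.zero_apply, zero_sub]
    · rw [ht, sub_self]
    · have hstep := ((isStep_letterStep_of_neg hγ ht).1 (hβ t)).1 i
      omega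
    · exact sub_le_sub_right (((isStep_letterStep_of_nonneg hγ ht).1 (hβ t)).1 i) _
  choose w hcharge hheight using hword
  have hprofile : profile lam w = β := by
    funext t i
    rw [profile, hheight, add_sub_cancel]
  refine ⟨w, (mem_weightSpace_iff hγ).2 ⟨hcharge, ?_⟩, hprofile⟩
  rwa [hprofile]

theorem surjOn_dualProfiles (hγ : HasWeightSigns γ) :
    Set.SurjOn (dualProfiles lam N) (weightSpace lam γ)
      {α | IsChain (wordSteps N γ) (2 * N) α ∧ α (2 * N) = lam.star.1} := by
  rintro α ⟨hα, hlast⟩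
  have hstep := (isChain_wordSteps_iff hN).1 hα
  have hbot : ∀ᶠ t : ℤ in Filter.atBot, dual (α (t + N).toNat) = 0 := by
    filter_upwards [Filter.eventually_le_atBot (-N : ℤ)] with t ht
    rw [Int.toNat_of_nonpos (by omega), hstep.1]
    exact funext fun _ => neg_zero
  have htop : ∀ᶠ t : ℤ in Filter.atTop, dual (α (t + N).toNat) = lam.1 := by
    filter_upwards [Filter.eventually_ge_atTop (N : ℤ)] with t ht
    rw [hα.const _ (by omega), hlast]
    exact dual_dual lam.1
  obtain ⟨w, hw, hprofile⟩ := exists_profile_eq hγ hbot htop fun t => by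
    rw [dual_dual, dual_dual]
    exact hstep.2 t
  refine ⟨w, hw, funext fun n => ?_⟩
  rw [dualProfiles, hprofile, dual_dual, sub_add_cancel, Int.toNat_natCast]

theorem bijOn_dualProfiles (hγ : HasWeightSigns γ) :
    Set.BijOn (dualProfiles lam N) (weightSpace lam γ)
      {α | IsChain (wordSteps N γ) (2 * N) α ∧ α (2 * N) = lam.star.1} :=
  ⟨mapsTo_dualProfiles hN hγ, injOn_dualProfiles hN hγ, surjOn_dualProfiles hN hγ⟩

end Window

end Tableau

/-! ### Products of elementary and complete symmetric polynomials -/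

theorem card_transpose (μ : YoungDiagram) : μ.transpose.card = μ.card := card_map _

theorem finite_setOf_card_eq (m : ℕ) : {ν : YoungDiagram | ν.card = m}.Finite := by
  refine Set.Finite.of_finite_image (f := YoungDiagram.cells)
    ((finite_toSet (range m ×ˢ range m).powerset).subset ?_)
    (fun ν _ ν' _ h => YoungDiagram.ext h)
  rintro _ ⟨ν, rfl, rfl⟩
  rw [mem_coe, mem_powerset]
  rintro ⟨i, j⟩ hij
  rw [YoungDiagram.mem_cells] at hij
  rw [mem_product, mem_range, mem_range]
  constructor
  · refine (YoungDiagram.mem_iff_lt_colLen.1 hij).trans_le ?_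
    rw [YoungDiagram.colLen_eq_card]
    exact card_le_card (filter_subset _ _)
  · refine (YoungDiagram.mem_iff_lt_rowLen.1 hij).trans_le ?_
    rw [YoungDiagram.rowLen_eq_card]
    exact card_le_card (filter_subset _ _)

/-- The partitions of `m`, as Young diagrams. -/
def diagramsOfCard (m : ℕ) : Finset YoungDiagram := (finite_setOf_card_eq m).toFinset

theorem mem_diagramsOfCard {m : ℕ} {ν : YoungDiagram} : ν ∈ diagramsOfCard m ↔ ν.card = m := by
  rw [diagramsOfCard, Set.Finite.mem_toFinset, Set.mem_ofPred_eq]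

section Products

variable {u N : ℕ} {s : ℕ → StepKind} {c : ℕ → ℕ} {ν : YoungDiagram}

theorem exists_ofPartition_eq (κ : GenPartition u) (hκ : ∀ i, 0 ≤ κ.1 i) :
    ∃ ν : YoungDiagram, ν.colLen 0 ≤ u ∧ GenPartition.ofPartition u ν = κ := by
  have hsorted : (List.ofFn fun i => (κ.1 i).toNat).SortedGE :=
    List.sortedGE_ofFn_iff.2 fun _ _ h => Int.toNat_le_toNat (κ.2 h)
  refine ⟨YoungDiagram.ofRowLens _ hsorted, ?_, Subtype.ext (funext fun i => ?_)⟩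
  · by_contra! hlt
    rw [← YoungDiagram.mem_iff_lt_colLen, YoungDiagram.mem_ofRowLens] at hlt
    obtain ⟨hlength, -⟩ := hlt
    exact lt_irrefl u (hlength.trans_eq List.length_ofFn)
  · have hrow := YoungDiagram.rowLen_ofRowLens (hw := hsorted) (i.cast List.length_ofFn.symm)
    simp only [Fin.val_cast, Fin.getElem_fin, List.getElem_ofFn] at hrow
    exact (congrArg Nat.cast hrow).trans (Int.toNat_of_nonneg (hκ i))

theorem injOn_ofPartition :
    Set.InjOn (GenPartition.ofPartition u) {ν : YoungDiagram | ν.colLen 0 ≤ u} := by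
  intro μ hμ ν hν h
  ext ⟨i, j⟩
  rw [YoungDiagram.mem_cells, YoungDiagram.mem_cells]
  rcases lt_or_ge i u with hi | hi
  · have hrow : (μ.rowLen i : ℤ) = ν.rowLen i := congrFun (congrArg Subtype.val h) (⟨i, hi⟩ : Fin u)
    rw [YoungDiagram.mem_iff_lt_rowLen, YoungDiagram.mem_iff_lt_rowLen]
    omega
  · exact iff_of_false (fun h => hi.not_gt (row_lt_of_mem hμ h))
      fun h => hi.not_gt (row_lt_of_mem hν h)

theorem star_star (κ : GenPartition u) : κ.star.star = κ := Subtype.ext (dual_dual κ.1)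

theorem prod_poly_eq_sum {E : Finset (GenPartition u)}
    (hE : ∀ κ : GenPartition u, {α | IsChain s N α ∧ α N = κ.1}.Nonempty → κ ∈ E) :
    ∏ n ∈ range N, (s n).poly u =
      ∑ κ ∈ E, {α | IsChain s N α ∧ α N = κ.1}.ncard • rationalSchur κ := by
  classical
  have hmaps : ∀ α ∈ chains s N, α N ∈ E.map (Function.Embedding.subtype _) := fun α hα => by
    rw [mem_chains] at hα
    exact mem_map.2 ⟨⟨α N, hα.antitone⟩, hE _ ⟨α, hα, rfl⟩, rfl⟩
  apply mul_left_cancel₀ (alternant_staircase_ne_zero u)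
  rw [alternant_mul_prod_poly, mul_sum, ← sum_fiberwise_of_maps_to hmaps, sum_map]
  refine sum_congr rfl fun κ _ => ?_
  rw [mul_smul_comm, alternant_staircase_mul_rationalSchur, setOf_isChain_eq, Set.ncard_coe_finset]
  exact sum_eq_card_nsmul fun α hα => by rw [(mem_filter.1 hα).2]; rfl

theorem prod_poly_eq_sum_diagrams {f : YoungDiagram → GenPartition u} {F : Finset YoungDiagram}
    (hf : Set.InjOn f {ν | ν.colLen 0 ≤ u})
    (hF : ∀ κ : GenPartition u, {α | IsChain s N α ∧ α N = κ.1}.Nonempty →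
      ∃ ν ∈ F, ν.colLen 0 ≤ u ∧ f ν = κ) :
    ∏ n ∈ range N, (s n).poly u =
      ∑ ν ∈ F with ν.colLen 0 ≤ u,
        {α | IsChain s N α ∧ α N = (f ν).1}.ncard • rationalSchur (f ν) := by
  classical
  rw [prod_poly_eq_sum (E := {ν ∈ F | ν.colLen 0 ≤ u}.image f) fun κ hκ => ?_]
  · exact sum_image (hf.mono fun ν hν => (mem_filter.1 hν).2)
  · obtain ⟨ν, hν, hlen, rfl⟩ := hF κ hκ
    exact mem_image_of_mem f (mem_filter.2 ⟨hν, hlen⟩)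

theorem card_eq_of_mem_ssytWithContent (hc : ∀ n, N ≤ n → c n = 0)
    {T : SemistandardYoungTableau ν} (hT : T ∈ ssytWithContent ν c) :
    ν.card = ∑ k ∈ range N, c k := by
  rw [YoungDiagram.card, card_eq_sum_card_fiberwise fun x hx =>
    mem_coe.2 (mem_range.2 (lt_of_mem_ssytWithContent hc hT hx))]
  exact sum_congr rfl fun k _ => hT k

theorem prod_horiz_eq_sum (u : ℕ) (hc : ∀ n, N ≤ n → c n = 0) :
    ∏ n ∈ range N, (StepKind.horiz (c n)).poly u =
      ∑ ν ∈ diagramsOfCard (∑ k ∈ range N, c k), (ssytWithContent ν c).ncard • schurY u ν := by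
  have hdiagram : ∀ κ : GenPartition u,
      {α | IsChain (fun n => .horiz (c n)) N α ∧ α N = κ.1}.Nonempty →
        ∃ ν ∈ diagramsOfCard (∑ k ∈ range N, c k),
          ν.colLen 0 ≤ u ∧ GenPartition.ofPartition u ν = κ := by
    rintro κ ⟨α, hα, hακ⟩
    obtain ⟨ν, hν, hκ⟩ := exists_ofPartition_eq κ fun i => by
      have hmono := hα.monotone_of_horiz (Nat.zero_le N) i
      rwa [hα.zero, hακ] at hmono
    obtain ⟨T, hT, -⟩ := (bijOn_ssytWithContent_horiz hν hc).surjOn ⟨hα, hκ ▸ hακ⟩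
    exact ⟨ν, mem_diagramsOfCard.2 (card_eq_of_mem_ssytWithContent hc hT), hν, hκ⟩
  rw [prod_poly_eq_sum_diagrams injOn_ofPartition hdiagram, sum_filter]
  refine sum_congr rfl fun ν _ => ?_
  rw [schurY]
  split_ifs with hν
  · rw [(bijOn_ssytWithContent_horiz hν hc).ncard_eq]
  · rw [smul_zero]

theorem prod_vert_eq_sum (u : ℕ) (hc : ∀ n, N ≤ n → c n = 0) :
    ∏ n ∈ range N, (StepKind.vert (c n)).poly u =
      ∑ μ ∈ diagramsOfCard (∑ k ∈ range N, c k),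
        (ssytWithContent μ.transpose c).ncard • schurYStar u μ := by
  have hinj : Set.InjOn (fun μ => (GenPartition.ofPartition u μ).star)
      {μ : YoungDiagram | μ.colLen 0 ≤ u} :=
    (Function.LeftInverse.injective star_star).comp_injOn injOn_ofPartition
  have hdiagram : ∀ κ : GenPartition u,
      {α | IsChain (fun n => .vert (c n)) N α ∧ α N = κ.1}.Nonempty →
        ∃ μ ∈ diagramsOfCard (∑ k ∈ range N, c k),
          μ.colLen 0 ≤ u ∧ (GenPartition.ofPartition u μ).star = κ := by
    rintro κ ⟨α, hα, hακ⟩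
    obtain ⟨μ, hμ, hκ⟩ := exists_ofPartition_eq κ.star fun i => by
      have hanti := hα.antitone_of_vert (Nat.zero_le N) i.rev
      rw [hα.zero, hακ] at hanti
      exact neg_nonneg.2 hanti
    replace hκ : (GenPartition.ofPartition u μ).star = κ := by rw [hκ, star_star]
    obtain ⟨T, hT, -⟩ := (bijOn_ssytWithContent_vert hμ hc).surjOn ⟨hα, hκ ▸ hακ⟩
    refine ⟨μ, mem_diagramsOfCard.2 ?_, hμ, hκ⟩
    rw [← card_transpose, card_eq_of_mem_ssytWithContent hc hT]
  rw [prod_poly_eq_sum_diagrams hinj hdiagram, sum_filter]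
  refine sum_congr rfl fun μ _ => ?_
  rw [schurYStar]
  split_ifs with hμ
  · rw [(bijOn_ssytWithContent_vert hμ hc).ncard_eq]
  · rw [smul_zero]

end Products

/-! ### Coefficients of products of Schur functions -/

theorem coeff_mul_eq_filter_mul_filter {σ R : Type*} [Semiring R] {p : σ → Prop} [DecidablePred p]
    {F G : MvPowerSeries σ R}
    (hF : ∀ n, MvPowerSeries.coeff n F ≠ 0 → ∀ b, ¬p b → n b = 0)
    (hG : ∀ n, MvPowerSeries.coeff n G ≠ 0 → ∀ b, p b → n b = 0) (n : σ →₀ ℕ) :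
    MvPowerSeries.coeff n (F * G) =
      MvPowerSeries.coeff (n.filter p) F * MvPowerSeries.coeff (n.filter fun b => ¬p b) G := by
  classical
  rw [MvPowerSeries.coeff_mul]
  refine sum_eq_single_of_mem (n.filter p, n.filter fun b => ¬p b)
    (mem_antidiagonal.2 (Finsupp.filter_add_filter_not n p)) ?_
  rintro ⟨m, m'⟩ hadd hne
  by_contra hmul
  have hm := hF m (left_ne_zero_of_mul hmul)
  have hm' := hG m' (right_ne_zero_of_mul hmul)
  obtain rfl : m + m' = n := mem_antidiagonal.1 hadd
  have hself : (m'.filter fun b => ¬p b) = m' :=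
    (Finsupp.filter_eq_self_iff _ _).2 fun b hb hpb => hb (hm' b hpb)
  refine hne (Prod.ext ?_ ?_)
  · change m = (m + m').filter p
    rw [Finsupp.filter_add, (Finsupp.filter_eq_self_iff _ _).2 fun b hb => not_imp_comm.1 (hm b) hb,
      (Finsupp.filter_eq_zero_iff _ _).2 hm', add_zero]
  · change m' = (m + m').filter fun b => ¬p b
    rw [Finsupp.filter_add, (Finsupp.filter_eq_zero_iff _ _).2 hm, hself, zero_add]

section Schur

variable {σ : Type} {v v' : ℕ → σ} {ν : YoungDiagram} {n : σ →₀ ℕ}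

theorem sum_single_entry_eq_iff (hv : v.Injective) (T : SemistandardYoungTableau ν) :
    ∑ c ∈ ν.cells, Finsupp.single (v (T c.1 c.2)) 1 = n ↔
      T ∈ ssytWithContent ν (fun k => n (v k)) ∧ ∀ b ∉ Set.range v, n b = 0 := by
  classical
  have hsum : ∀ b, (∑ c ∈ ν.cells, Finsupp.single (v (T c.1 c.2)) 1 : σ →₀ ℕ) b =
      #{c ∈ ν.cells | v (T c.1 c.2) = b} := fun b => by
    rw [Finsupp.finsetSum_apply, card_filter]
    exact sum_congr rfl fun c _ => Finsupp.single_apply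
  have hout : ∀ b ∉ Set.range v, #{c ∈ ν.cells | v (T c.1 c.2) = b} = 0 := fun b hb =>
    card_eq_zero.2 (filter_eq_empty_iff.2 fun c _ hc => hb ⟨_, hc⟩)
  have hin : ∀ k, #{c ∈ ν.cells | v (T c.1 c.2) = v k} = #{c ∈ ν.cells | T c.1 c.2 = k} :=
    fun k => by simp only [hv.eq_iff]
  rw [Finsupp.ext_iff]
  simp only [hsum]
  constructor
  · exact fun hT =>
      ⟨fun k => (hin k).symm.trans (hT (v k)), fun b hb => (hT b).symm.trans (hout b hb)⟩
  · rintro ⟨hT, hn⟩ b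
    by_cases hb : b ∈ Set.range v
    · obtain ⟨k, rfl⟩ := hb
      exact (hin k).trans (hT k)
    · rw [hout b hb, hn b hb]

theorem coeff_schur (hv : v.Injective) (hn : ∀ b ∉ Set.range v, n b = 0) :
    MvPowerSeries.coeff n (schur v ν) = (ssytWithContent ν fun k => n (v k)).ncard := by
  change (({T | _ = n} : Set (SemistandardYoungTableau ν)).ncard : ℤ) = _
  congr 2
  ext T
  exact (sum_single_entry_eq_iff hv T).trans (and_iff_left hn)

theorem eq_zero_of_coeff_schur_ne_zero (hv : v.Injective)
    (hcoeff : MvPowerSeries.coeff n (schur v ν) ≠ 0) : ∀ b ∉ Set.range v, n b = 0 := by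
  obtain ⟨T, hT⟩ : ({T | _ = n} : Set (SemistandardYoungTableau ν)).Nonempty :=
    Set.nonempty_of_ncard_ne_zero (Nat.cast_ne_zero.1 hcoeff)
  exact ((sum_single_entry_eq_iff hv T).1 hT).2

theorem coeff_schur_mul_schur (hv : v.Injective) (hv' : v'.Injective)
    (hrange : Set.range v' = (Set.range v)ᶜ) (μ ν : YoungDiagram) (n : σ →₀ ℕ) :
    MvPowerSeries.coeff n (schur v μ * schur v' ν) =
      (ssytWithContent μ fun k => n (v k)).ncard * (ssytWithContent ν fun k => n (v' k)).ncard := by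
  classical
  have hmem : ∀ k, v' k ∉ Set.range v := fun k => by
    rw [← Set.mem_compl_iff, ← hrange]
    exact Set.mem_range_self k
  have hnotMem : ∀ b ∉ Set.range v', b ∈ Set.range v := fun b hb => by
    rwa [hrange, Set.notMem_compl_iff] at hb
  rw [coeff_mul_eq_filter_mul_filter (p := (· ∈ Set.range v))
    (fun _ => eq_zero_of_coeff_schur_ne_zero hv) fun m hm b hb =>
      eq_zero_of_coeff_schur_ne_zero hv' hm b (by rwa [hrange, Set.notMem_compl_iff]),
    coeff_schur hv fun b => Finsupp.filter_apply_neg _ _,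
    coeff_schur hv' fun b hb => Finsupp.filter_apply_neg _ _ (not_not.2 (hnotMem b hb))]
  simp only [Finsupp.filter_apply_pos (· ∈ Set.range v) n (Set.mem_range_self _),
    Finsupp.filter_apply_pos (fun b => ¬b ∈ Set.range v) n (hmem _)]

end Schur

theorem position_symm_neg (k : ℕ) : position.symm (-((k : ℤ) + 1)) = barLetter k :=
  position.symm_apply_eq.2 (position_barLetter k).symm

theorem position_symm_natCast (k : ℕ) : position.symm k = posLetter k :=
  position.symm_apply_eq.2 (position_posLetter k).symm

theorem barLetter_injective : barLetter.Injective := fun k k' h => by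
  have hposition := congrArg position h
  rw [position_barLetter, position_barLetter] at hposition
  omega

theorem posLetter_injective : posLetter.Injective := fun k k' h => by
  have hposition := congrArg position h
  rwa [position_posLetter, position_posLetter, Nat.cast_inj] at hposition

theorem range_posLetter : Set.range posLetter = (Set.range barLetter)ᶜ := by
  ext b
  obtain ⟨t, rfl⟩ := position.symm.surjective b
  simp only [Set.mem_compl_iff, Set.mem_range, ← position_symm_natCast, ← position_symm_neg,
    position.symm.injective.eq_iff]
  constructor
  · rintro ⟨k, rfl⟩ ⟨k', hk'⟩
    omega
  · intro ht
    exact ⟨t.toNat, Int.toNat_of_nonneg (not_lt.1 fun hneg => ht ⟨(-t - 1).toNat, by omega⟩)⟩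

theorem schurProduct_apply (μ ν : YoungDiagram) {γ : Letter →₀ ℤ} (hγ : HasWeightSigns γ) :
    schurProduct μ ν γ =
      (ssytWithContent μ.transpose fun k => (γ (barLetter k)).natAbs).ncard *
        (ssytWithContent ν fun k => (γ (posLetter k)).natAbs).ncard :=
  (if_pos hγ).trans
    (coeff_schur_mul_schur barLetter_injective posLetter_injective range_posLetter _ _ _)

theorem schurProduct_eq_zero (μ ν : YoungDiagram) {γ : Letter →₀ ℤ} (hγ : ¬HasWeightSigns γ) :
    schurProduct μ ν γ = 0 :=
  if_neg hγ

/-! ### Littlewood–Richardson coefficients -/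

theorem schurCoeff_sum {u : ℕ} (n : GenPartition u →₀ ℕ) (κ : GenPartition u) :
    schurCoeff κ (n.sum fun ν m => m • rationalSchur ν) = n κ := by
  classical
  simp only [Finsupp.sum, map_sum, map_nsmul, schurCoeff_rationalSchur]
  simp only [nsmul_eq_mul, mul_ite, mul_one, mul_zero]
  rw [sum_ite_eq', ite_eq_left_iff, Finsupp.mem_support_iff, not_not]
  intro hκ
  rw [hκ, Nat.cast_zero]

theorem IsLRCoefficients.eq_schurCoeff {u : ℕ}
    {N : YoungDiagram → YoungDiagram → GenPartition u →₀ ℕ} (hN : IsLRCoefficients u N)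
    (μ ν : YoungDiagram) (κ : GenPartition u) :
    (N μ ν κ : ℤ) = schurCoeff κ (schurYStar u μ * schurY u ν) := by
  rw [hN μ ν, schurCoeff_sum]

theorem existsUnique_isLRCoefficients (u : ℕ) :
    ∃! N : YoungDiagram → YoungDiagram → GenPartition u →₀ ℕ, IsLRCoefficients u N := by
  have hexpand : ∀ μ ν : YoungDiagram, ∃ n : GenPartition u →₀ ℕ,
      schurYStar u μ * schurY u ν = n.sum fun κ m => m • rationalSchur κ := by
    intro μ ν
    rw [schurYStar, schurY]
    split_ifs
    · exact exists_rationalSchur_mul _ _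
    · exact ⟨0, by rw [mul_zero, Finsupp.sum_zero_index]⟩
    · exact ⟨0, by rw [zero_mul, Finsupp.sum_zero_index]⟩
    · exact ⟨0, by rw [zero_mul, Finsupp.sum_zero_index]⟩
  choose N hN using hexpand
  refine ⟨N, hN, fun N' (hN' : IsLRCoefficients u N') => ?_⟩
  funext μ ν
  ext κ
  have hcast := (hN'.eq_schurCoeff μ ν κ).trans (IsLRCoefficients.eq_schurCoeff hN μ ν κ).symm
  exact_mod_cast hcast

/-! ### The character formula -/

section Character

variable {u : ℕ} {γ : Letter →₀ ℤ} {N : ℕ}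

theorem exists_support_bound (γ : Letter →₀ ℤ) :
    ∃ N : ℕ, ∀ t : ℤ, t < -N ∨ N ≤ t → γ (position.symm t) = 0 := by
  refine ⟨γ.support.sup fun b => (position b).natAbs + 1, fun t ht => ?_⟩
  by_contra hcon
  have hle := le_sup (f := fun b => (position b).natAbs + 1) (Finsupp.mem_support_iff.2 hcon)
  simp only [OrderIso.apply_symm_apply] at hle
  omega

theorem natAbs_barLetter_eq_zero (hN : ∀ t : ℤ, t < -N ∨ N ≤ t → γ (position.symm t) = 0)
    (k : ℕ) (hk : N ≤ k) : (γ (barLetter k)).natAbs = 0 := by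
  rw [← position_symm_neg, hN _ (Or.inl (by omega)), Int.natAbs_zero]

theorem natAbs_posLetter_eq_zero (hN : ∀ t : ℤ, t < -N ∨ N ≤ t → γ (position.symm t) = 0)
    (k : ℕ) (hk : N ≤ k) : (γ (posLetter k)).natAbs = 0 := by
  rw [← position_symm_natCast, hN _ (Or.inr (by omega)), Int.natAbs_zero]

theorem prod_wordSteps (u N : ℕ) (γ : Letter →₀ ℤ) :
    ∏ n ∈ range (2 * N), (wordSteps N γ n).poly u =
      (∏ k ∈ range N, (StepKind.vert (γ (barLetter k)).natAbs).poly u) *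
        ∏ k ∈ range N, (StepKind.horiz (γ (posLetter k)).natAbs).poly u := by
  rw [two_mul, prod_range_add, ← prod_range_reflect]
  congr 1 <;> refine prod_congr rfl fun k hk => ?_
  · have hk : ((N - 1 - k : ℕ) : ℤ) - N = -(k + 1) := by
      have := mem_range.1 hk
      omega
    rw [wordSteps, hk, letterStep, if_pos (by omega), position_symm_neg]
  · rw [wordSteps, Nat.cast_add, add_sub_cancel_left, letterStep,
      if_neg (by omega), position_symm_natCast]

theorem finite_weightSpace (lam : GenPartition u) (γ : Letter →₀ ℤ) :
    (weightSpace lam γ).Finite := by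
  by_cases hγ : HasWeightSigns γ
  · obtain ⟨N, hN⟩ := exists_support_bound γ
    exact (bijOn_dualProfiles hN hγ).finite_iff_finite.2 (finite_setOf_isChain _ _ _)
  · rw [weightSpace_eq_empty lam hγ]
    exact Set.finite_empty

theorem ch_eq_zero (lam : GenPartition u) (hγ : ¬HasWeightSigns γ) : ch lam γ = 0 := by
  rw [ch, weightSpace_eq_empty lam hγ, Set.ncard_empty, Nat.cast_zero]

theorem ch_apply (lam : GenPartition u) (hγ : HasWeightSigns γ)
    (hN : ∀ t : ℤ, t < -N ∨ N ≤ t → γ (position.symm t) = 0) :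
    ch lam γ = schurCoeff lam.star
      ((∏ k ∈ range N, (StepKind.vert (γ (barLetter k)).natAbs).poly u) *
        ∏ k ∈ range N, (StepKind.horiz (γ (posLetter k)).natAbs).poly u) := by
  rw [ch, (bijOn_dualProfiles hN hγ).ncard_eq, ← schurCoeff_prod_poly, prod_wordSteps]

theorem ssytWithContent_eq_empty {c : ℕ → ℕ} {ν : YoungDiagram} (hc : ∀ n, N ≤ n → c n = 0)
    (hν : ν ∉ diagramsOfCard (∑ k ∈ range N, c k)) : ssytWithContent ν c = ∅ :=
  Set.eq_empty_of_forall_notMem fun _ hT =>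
    hν (mem_diagramsOfCard.2 (card_eq_of_mem_ssytWithContent hc hT))

theorem schurProduct_eq_zero_of_notMem {μ ν : YoungDiagram} (hγ : HasWeightSigns γ)
    (hN : ∀ t : ℤ, t < -N ∨ N ≤ t → γ (position.symm t) = 0)
    (hμν : (μ, ν) ∉ diagramsOfCard (∑ k ∈ range N, (γ (barLetter k)).natAbs) ×ˢ
      diagramsOfCard (∑ k ∈ range N, (γ (posLetter k)).natAbs)) :
    schurProduct μ ν γ = 0 := by
  rw [schurProduct_apply μ ν hγ]
  rw [mem_product, not_and_or] at hμν
  rcases hμν with hμ | hν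
  · rw [mem_diagramsOfCard, ← card_transpose, ← mem_diagramsOfCard] at hμ
    rw [ssytWithContent_eq_empty (natAbs_barLetter_eq_zero hN) hμ, Set.ncard_empty, Nat.cast_zero,
      zero_mul]
  · rw [ssytWithContent_eq_empty (natAbs_posLetter_eq_zero hN) hν, Set.ncard_empty, Nat.cast_zero,
      mul_zero]

theorem ch_eq_sum_schurProduct {c : YoungDiagram → YoungDiagram → GenPartition u →₀ ℕ}
    (hc : IsLRCoefficients u c) (lam : GenPartition u) (hγ : HasWeightSigns γ)
    (hN : ∀ t : ℤ, t < -N ∨ N ≤ t → γ (position.symm t) = 0) :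
    ch lam γ = ∑ p ∈ diagramsOfCard (∑ k ∈ range N, (γ (barLetter k)).natAbs) ×ˢ
      diagramsOfCard (∑ k ∈ range N, (γ (posLetter k)).natAbs),
        c p.1 p.2 lam.star • schurProduct p.1 p.2 γ := by
  rw [ch_apply lam hγ hN, prod_vert_eq_sum u (natAbs_barLetter_eq_zero hN),
    prod_horiz_eq_sum u (natAbs_posLetter_eq_zero hN), sum_mul_sum, ← sum_product', map_sum]
  refine sum_congr rfl fun p _ => ?_
  rw [smul_mul_smul_comm, map_nsmul, ← hc.eq_schurCoeff, schurProduct_apply _ _ hγ, nsmul_eq_mul,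
    nsmul_eq_mul, Nat.cast_mul, mul_comm]

theorem hasSum_ch {c : YoungDiagram → YoungDiagram → GenPartition u →₀ ℕ}
    (hc : IsLRCoefficients u c) (lam : GenPartition u) :
    HasSum (fun p : YoungDiagram × YoungDiagram => c p.1 p.2 lam.star • schurProduct p.1 p.2)
      (ch lam) := by
  refine Pi.hasSum.2 fun γ => ?_
  simp only [Pi.smul_apply]
  by_cases hγ : HasWeightSigns γ
  · obtain ⟨N, hN⟩ := exists_support_bound γ
    rw [ch_eq_sum_schurProduct hc lam hγ hN]
    refine hasSum_sum_of_ne_finset_zero fun p hp => ?_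
    rw [schurProduct_eq_zero_of_notMem hγ hN hp, smul_zero]
  · simp only [schurProduct_eq_zero _ _ hγ, smul_zero, ch_eq_zero lam hγ]
    exact hasSum_zero

end Character

end SemiInf

end

theorem mainTheorem10 (u : ℕ) (hu : 1 ≤ u) :
    (∃! N : YoungDiagram → YoungDiagram → SemiInf.GenPartition u →₀ ℕ,
      SemiInf.IsLRCoefficients u N) ∧
    ∀ N : YoungDiagram → YoungDiagram → SemiInf.GenPartition u →₀ ℕ,
      SemiInf.IsLRCoefficients u N →
      ∀ lam : SemiInf.GenPartition u,
        (∀ γ : SemiInf.Letter →₀ ℤ, (SemiInf.weightSpace lam γ).Finite) ∧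
        HasSum (fun p : YoungDiagram × YoungDiagram =>
            N p.1 p.2 lam.star • SemiInf.schurProduct p.1 p.2)
          (SemiInf.ch lam) :=
  ⟨SemiInf.existsUnique_isLRCoefficients u, fun _ hN lam =>
    ⟨SemiInf.finite_weightSpace lam, SemiInf.hasSum_ch hN lam⟩⟩
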